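/- **Setting.** Let $k\ge 0$, let $N$ be a smooth manifold with closed two-forms $\omega^1,\dots,\omega^k$ such that $\bigcap_a\ker\omega^a=0$ (a polysymplectic structure), and let a Lie group $G$ with Lie algebra $\mathfrak g$ act smoothly on $N$ from the left by maps $\Phi_g$ with $\Phi_g^*\omega^a=\omega^a$. Let $J=(J^1,\dots,J^k)\colon N\to\mathfrak g^*\times\cdots\times\mathfrak g^*$ be a smooth momentum map, i.e. $\xi_N\lrcorner\,\omega^a=d\langle J^a,\xi\rangle$ for all $\xi\in\mathfrak g$ and all $a$, equivariant: $J^a(g\cdot x)=\mathrm{Ad}^*_{g^{-1}}J^a(x)$. Let $\mu=(\mu_1,\dots,\mu_k)$ be a regular value of $J$, let $G_{\mu_a}$ be the coadjoint isotropy group of $\mu_a$ and $G_\mu=\bigcap_aG_{\mu_a}$, and assume that for all $x\in J^{-1}(\mu)$ * (C1) $\ker(T_xJ^a)=T_x(J^{-1}(\mu))+\ker\omega^a|_x+T_x(G_{\mu_a}\cdot x)$ for each $a$; * (C2) $T_x(G_\mu\cdot x)=\bigcap_a\big[T_x(G_{\mu_a}\cdot x)+\ker\omega^a|_x\big]\cap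 T_x(J^{-1}(\mu))$. Assume that $G_\mu$ acts freely and properly on $J^{-1}(\mu)$, let $\pi_\mu\colon J^{-1}(\mu)\to N_\mu=J^{-1}(\mu)/G_\mu$ be the projection (with the usual smooth structures: $G_\mu\subset G$ and $J^{-1}(\mu)\subset N$ are embedded, $\pi_\mu$ is a submersion). Let $H\colon N\to\mathbb R$ be smooth and $G$-invariant, and let $\pmb X=(X_1,\dots,X_k)$ be a smooth $k$-vector field on $N$ with $\sum_aX_a\lrcorner\,\omega^a=dH$ that is $G_\mu$-invariant and tangent to $J^{-1}(\mu)$. Let $\pmb X_\mu$ be its restriction to $J^{-1}(\mu)$ and $\overline{\pmb X}_\mu$ the reduced $k$-vector field on $N_\mu$, given by $T\pi_\mu\circ(X_\mu)_a=(\overline X_\mu)_a\circ\pi_\mu$. An integral section of a $k$-vector field $\pmb Y$ on $M$ is a smooth map $\phi\colon\mathbb R^k\to M$ with $\partial\phi/\partial t^a=Y_a\circ\phi$ for all $a$; $\pmb Y$ is integrable if through each point of $M$ there passes an integral section defined on a neighbourhood of $0\in\mathbb R^k$. For an integral section $\overline\phi_\mu$ of $\overline{\pmb X}_\mu$, let $\mathcal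 H(\pmb X_\mu,\overline\phi_\mu)$ be the connection on the $G_\mu$-bundle $\overline\phi_\mu^*(J^{-1}(\mu))=\{(t,p)\in\mathbb R^k\times J^{-1}(\mu):\overline\phi_\mu(t)=\pi_\mu(p)\}\to\mathbb R^k$ whose horizontal space at $(t,p)$ is spanned by the vectors $\partial/\partial t^a|_t+(X_\mu)_a|_p$, $1\le a\le k$. A connection is flat if its curvature $K(Y,Z)=-\mathrm{Ver}[\mathrm{Hor}\,Y,\mathrm{Hor}\,Z]$ vanishes. **Theorem.** Let $\overline\phi_\mu\colon\mathbb R^k\to N_\mu$ be an integral section of $\overline{\pmb X}_\mu$ such that the connection $\mathcal H(\pmb X_\mu,\overline\phi_\mu)$ is flat. 1. There is an integral section $\phi_\mu\colon\mathbb R^k\to J^{-1}(\mu)$ of $\pmb X_\mu$ with $\pi_\mu\circ\phi_\mu=\overline\phi_\mu$. 2. Let $\mathcal A\colon T(J^{-1}(\mu))\to\mathfrak g_\mu$ be a principal connection form on $J^{-1}(\mu)\to N_\mu$, and let $\overline{\pmb X}{}^h_\mu$ be the $k$-vector field on $J^{-1}(\mu)$ whose components are the $\mathcal A$-horizontal lifts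 of those of $\overline{\pmb X}_\mu$. If $\overline{\pmb X}{}^h_\mu$ is integrable, then $\overline\phi_\mu$ has a horizontal lift, that is, an integral section $(\overline\phi_\mu)_h\colon\mathbb R^k\to J^{-1}(\mu)$ of $\overline{\pmb X}{}^h_\mu$ with $\pi_\mu\circ(\overline\phi_\mu)_h=\overline\phi_\mu$. For every such lift $(\overline\phi_\mu)_h$, the reconstruction equation $$g(t)^{-1}\cdot\frac{\partial g}{\partial t^a}(t)=\mathcal A\big((X_\mu)_a((\overline\phi_\mu)_h(t))\big),\qquad t\in\mathbb R^k,\ 1\le a\le k,$$ has a smooth solution $g\colon\mathbb R^k\to G_\mu$; for every smooth solution $g$, the map $\phi_\mu(t)=g(t)\cdot(\overline\phi_\mu)_h(t)$ is an integral section of $\pmb X_\mu$ with $\pi_\mu\circ\phi_\mu=\overline\phi_\mu$; and every integral section $\phi_\mu\colon\mathbb R^k\to J^{-1}(\mu)$ of $\pmb X_\mu$ with $\pi_\mu\circ\phi_\mu=\overline\phi_\mu$ is of this form. -/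

import Mathlib

open scoped Manifold ContDiff Topology

/-! Conventions. Manifolds are smooth (`∞`), finite-dimensional and without boundary, modelled on a
normed space `E` through `𝓘(ℝ, E)`. Mathlib's tangent space `TangentSpace 𝓘(ℝ, E) x` is, as a
type, the model space `E`; in particular the Lie algebra `T₁G` of a Lie group `G` modelled on `EG`
is `EG`, and its dual is `EG →L[ℝ] ℝ`. -/

noncomputable section

/-! ### Lie groups and actions -/

section LieGroups

variable {EG : Type*} [NormedAddCommGroup EG] [NormedSpace ℝ EG] {G : Type*} [TopologicalSpace G]
  [ChartedSpace EG G] [Group G]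

/-- The adjoint action `Ad_g : 𝔤 → 𝔤`, the derivative at `1` of `h ↦ g h g⁻¹`. -/
def Ad (EG : Type*) [NormedAddCommGroup EG] [NormedSpace ℝ EG] {G : Type*} [TopologicalSpace G]
    [ChartedSpace EG G] [Group G] (g : G) : EG →L[ℝ] EG :=
  mfderiv 𝓘(ℝ, EG) 𝓘(ℝ, EG) (fun h : G => g * h * g⁻¹) 1

/-- The coadjoint action `Coad_g ν = Ad_{g⁻¹}^* ν` on `𝔤*`. -/
def Coad (g : G) (ν : EG →L[ℝ] ℝ) : EG →L[ℝ] ℝ := ν.comp (Ad EG g⁻¹)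

/-- The `k`-coadjoint action on `𝔤* × ⋯ × 𝔤*`. -/
def CoadK {k : ℕ} (g : G) (μ : Fin k → EG →L[ℝ] ℝ) : Fin k → EG →L[ℝ] ℝ :=
  fun a => Coad g (μ a)

lemma hasMFDerivAt_conj [LieGroup 𝓘(ℝ, EG) ∞ G] (g : G) :
    HasMFDerivAt 𝓘(ℝ, EG) 𝓘(ℝ, EG) (fun h : G => g * h * g⁻¹) 1 (Ad EG g) := by
  have hs : ContMDiff 𝓘(ℝ, EG) 𝓘(ℝ, EG) ∞ (fun h : G => g * h * g⁻¹) :=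
    (contMDiff_const.mul contMDiff_id).mul contMDiff_const
  exact (hs.mdifferentiable (by simp) 1).hasMFDerivAt

lemma Ad_one : Ad EG (1 : G) = ContinuousLinearMap.id ℝ EG := by
  have h : (fun h : G => 1 * h * (1 : G)⁻¹) = id := by funext h; simp
  unfold Ad
  rw [h]
  exact mfderiv_id

lemma Ad_mul [LieGroup 𝓘(ℝ, EG) ∞ G] (g h : G) :
    Ad EG (g * h) = (Ad EG g).comp (Ad EG h) := by
  have h1 : h * 1 * h⁻¹ = 1 := by simp
  have hg : HasMFDerivAt 𝓘(ℝ, EG) 𝓘(ℝ, EG) (fun x : G => g * x * g⁻¹) (h * 1 * h⁻¹) (Ad EG g) := by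
    rw [h1]
    exact hasMFDerivAt_conj g
  have hc := HasMFDerivAt.comp (1 : G) hg (hasMFDerivAt_conj h)
  have he : (fun x : G => g * h * x * (g * h)⁻¹) =
      (fun x : G => g * x * g⁻¹) ∘ (fun x : G => h * x * h⁻¹) := by
    funext x
    simp [mul_assoc]
  have hgh := hasMFDerivAt_conj (EG := EG) (g * h)
  rw [he] at hgh
  exact hasMFDerivAt_unique hgh hc

lemma Coad_one (ν : EG →L[ℝ] ℝ) : Coad (1 : G) ν = ν := by
  simp [Coad, Ad_one]

lemma Coad_mul [LieGroup 𝓘(ℝ, EG) ∞ G] (g h : G) (ν : EG →L[ℝ] ℝ) :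
    Coad (g * h) ν = Coad g (Coad h ν) := by
  simp only [Coad, mul_inv_rev, Ad_mul]
  rfl

/-- The isotropy group of `ν ∈ 𝔤*` for the coadjoint action. -/
def isotropy (EG : Type*) [NormedAddCommGroup EG] [NormedSpace ℝ EG] (G : Type*)
    [TopologicalSpace G] [ChartedSpace EG G] [Group G] [LieGroup 𝓘(ℝ, EG) ∞ G]
    (ν : EG →L[ℝ] ℝ) : Subgroup G where
  carrier := {g | Coad g ν = ν}
  one_mem' := Coad_one ν
  mul_mem' := fun {g h} (hg : Coad g ν = ν) (hh : Coad h ν = ν) => by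
    change Coad (g * h) ν = ν
    rw [Coad_mul, hh, hg]
  inv_mem' := fun {g} (hg : Coad g ν = ν) => by
    change Coad g⁻¹ ν = ν
    conv_lhs => rw [← hg]
    rw [← Coad_mul, inv_mul_cancel, Coad_one]

/-- The isotropy group `G_μ` of `μ ∈ 𝔤* × ⋯ × 𝔤*` for the `k`-coadjoint action. -/
def isotropyK (EG : Type*) [NormedAddCommGroup EG] [NormedSpace ℝ EG] (G : Type*)
    [TopologicalSpace G] [ChartedSpace EG G] [Group G] [LieGroup 𝓘(ℝ, EG) ∞ G] {k : ℕ}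
    (μ : Fin k → EG →L[ℝ] ℝ) : Subgroup G where
  carrier := {g | CoadK g μ = μ}
  one_mem' := funext fun a => Coad_one (μ a)
  mul_mem' := fun {g h} (hg : CoadK g μ = μ) (hh : CoadK h μ = μ) => funext fun a =>
    (isotropy EG G (μ a)).mul_mem (congrFun hg a) (congrFun hh a)
  inv_mem' := fun {g} (hg : CoadK g μ = μ) => funext fun a =>
    (isotropy EG G (μ a)).inv_mem (congrFun hg a)

/-- The Lie algebra of a (closed) subgroup `K ≤ G`, as a subset of `𝔤`: the initial velocities of
the smooth one-parameter subgroups of `G` that stay in `K`, i.e. `{ξ | exp (s ξ) ∈ K for all s}`. -/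
def subgroupLieAlgebra (K : Subgroup G) : Set (GroupLieAlgebra 𝓘(ℝ, EG) G) :=
  {ξ | ∃ γ : ℝ → G, ContMDiff 𝓘(ℝ, ℝ) 𝓘(ℝ, EG) ∞ γ ∧ (∀ s t, γ (s + t) = γ s * γ t) ∧
    (∀ t, γ t ∈ K) ∧ ξ = mfderiv 𝓘(ℝ, ℝ) 𝓘(ℝ, EG) γ 0 (1 : ℝ)}

variable {EM : Type*} [NormedAddCommGroup EM] [NormedSpace ℝ EM] {M : Type*} [TopologicalSpace M]
  [ChartedSpace EM M] [MulAction G M]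

/-- The infinitesimal generator `ξ_M` of a left action of `G` on `M`, at the point `x`. -/
def infGen (ξ : GroupLieAlgebra 𝓘(ℝ, EG) G) (x : M) : TangentSpace 𝓘(ℝ, EM) x :=
  mfderiv 𝓘(ℝ, EG) 𝓘(ℝ, EM) (fun g : G => g • x) 1 ξ

/-- The tangent map `T_x Φ_g` of the action of `g`, i.e. `v ↦ g · v`. -/
def tangentAct (EM : Type*) [NormedAddCommGroup EM] [NormedSpace ℝ EM] {M : Type*}
    [TopologicalSpace M] [ChartedSpace EM M] [MulAction G M] (g : G) (x : M) :
    TangentSpace 𝓘(ℝ, EM) x →L[ℝ] TangentSpace 𝓘(ℝ, EM) (g • x) :=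
  mfderiv 𝓘(ℝ, EM) 𝓘(ℝ, EM) (fun y : M => g • y) x

/-- The tangent space `T_x (K · x)` of the orbit of `x` under a (closed) subgroup `K ≤ G`. -/
def orbitTangent (EG : Type*) [NormedAddCommGroup EG] [NormedSpace ℝ EG] {G : Type*}
    [TopologicalSpace G] [ChartedSpace EG G] [Group G] (K : Subgroup G) (EM : Type*)
    [NormedAddCommGroup EM] [NormedSpace ℝ EM] {M : Type*} [TopologicalSpace M]
    [ChartedSpace EM M] [MulAction G M] (x : M) : Submodule ℝ (TangentSpace 𝓘(ℝ, EM) x) :=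
  Submodule.span ℝ ((fun ξ => infGen (EG := EG) (EM := EM) ξ x) '' subgroupLieAlgebra K)

end LieGroups

/-! ### Polysymplectic structures and momentum maps -/

section Polysymplectic

/-- Two-forms on `M` (no regularity). -/
abbrev TwoForm (EM : Type*) [NormedAddCommGroup EM] [NormedSpace ℝ EM] (M : Type*)
    [TopologicalSpace M] [ChartedSpace EM M] : Type _ :=
  ∀ x : M, TangentSpace 𝓘(ℝ, EM) x [⋀^Fin 2]→L[ℝ] ℝ

variable {EM : Type*} [NormedAddCommGroup EM] [NormedSpace ℝ EM] {M : Type*} [TopologicalSpace M]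
  [ChartedSpace EM M]

/-- The two-form `η` read in the chart at `x₀`: the pullback of `η` by the inverse of that chart. -/
def TwoForm.inChart (η : TwoForm EM M) (x₀ : M) (y : EM) : EM [⋀^Fin 2]→L[ℝ] ℝ :=
  (η ((extChartAt 𝓘(ℝ, EM) x₀).symm y)).compContinuousLinearMap
    (mfderiv 𝓘(ℝ, EM) 𝓘(ℝ, EM) (extChartAt 𝓘(ℝ, EM) x₀).symm y)

/-- `η` is a smooth two-form. -/
def TwoForm.IsSmooth (η : TwoForm EM M) : Prop :=
  ∀ x₀ : M, ContDiffOn ℝ ∞ (η.inChart x₀) (extChartAt 𝓘(ℝ, EM) x₀).target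

/-- `dη = 0`. -/
def TwoForm.IsClosed (η : TwoForm EM M) : Prop :=
  ∀ x₀ : M, ∀ y ∈ (extChartAt 𝓘(ℝ, EM) x₀).target, extDeriv (η.inChart x₀) y = 0

/-- The kernel of `η` at `x`. -/
def TwoForm.kerAt (η : TwoForm EM M) (x : M) : Submodule ℝ (TangentSpace 𝓘(ℝ, EM) x) where
  carrier := {v | ∀ w, η x ![v, w] = 0}
  zero_mem' := fun w => (η x).map_coord_zero 0 rfl
  add_mem' := fun {u v} hu hv w => by
    have h := (η x).vecCons_add ![w] u v
    rw [h, hu w, hv w, add_zero]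
  smul_mem' := fun c v hv w => by
    have h := (η x).vecCons_smul ![w] c v
    rw [h, hv w, smul_zero]

/-- `(ω¹, …, ωᵏ)` is a `k`-polysymplectic structure: smooth closed two-forms with
`⋂ₐ ker ωᵃ = 0`. -/
structure IsPolysymplectic {k : ℕ} (Ω : Fin k → TwoForm EM M) : Prop where
  smooth : ∀ a, (Ω a).IsSmooth
  closed : ∀ a, (Ω a).IsClosed
  nondegenerate : ∀ x, ⨅ a, (Ω a).kerAt x = ⊥

/-- A polysymplectic manifold `(M, ω¹, …, ωᵏ)` with a smooth polysymplectic action of a Lie group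
`G` and an equivariant momentum map `J : M → 𝔤* × ⋯ × 𝔤*`. -/
structure PolyHamiltonianSpace (k : ℕ) (EM : Type*) [NormedAddCommGroup EM] [NormedSpace ℝ EM]
    (M : Type*) [TopologicalSpace M] [ChartedSpace EM M]
    (EG : Type*) [NormedAddCommGroup EG] [NormedSpace ℝ EG] (G : Type*) [TopologicalSpace G]
    [ChartedSpace EG G] [Group G] [MulAction G M] where
  /-- the forms `ωᵃ` -/
  form : Fin k → TwoForm EM M
  /-- the momentum map -/
  J : M → Fin k → EG →L[ℝ] ℝ
  polysymplectic : IsPolysymplectic form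
  contMDiff_smul : ContMDiff (𝓘(ℝ, EG).prod 𝓘(ℝ, EM)) 𝓘(ℝ, EM) ∞ (fun p : G × M => p.1 • p.2)
  invariant : ∀ (a : Fin k) (g : G) (x : M),
    (form a (g • x)).compContinuousLinearMap (tangentAct EM g x) = form a x
  contMDiff_J : ContMDiff 𝓘(ℝ, EM) 𝓘(ℝ, Fin k → EG →L[ℝ] ℝ) ∞ J
  momentum : ∀ (a : Fin k) (ξ : GroupLieAlgebra 𝓘(ℝ, EG) G) (x : M) (v : TangentSpace 𝓘(ℝ, EM) x),
    form a x ![infGen ξ x, v] = mfderiv 𝓘(ℝ, EM) 𝓘(ℝ, ℝ) (fun y => J y a ξ) x v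
  equivariant : ∀ (g : G) (x : M), J (g • x) = CoadK g (J x)

end Polysymplectic

section LevelSets

variable {k : ℕ} {EM : Type*} [NormedAddCommGroup EM] [NormedSpace ℝ EM]
  {M : Type*} [TopologicalSpace M] [ChartedSpace EM M]
  {EG : Type*} [NormedAddCommGroup EG] [NormedSpace ℝ EG] {G : Type*} [TopologicalSpace G]
  [ChartedSpace EG G] [Group G] [MulAction G M]

/-- The level set `J⁻¹(μ)`. -/
def PolyHamiltonianSpace.Level (S : PolyHamiltonianSpace k EM M EG G)
    (μ : Fin k → EG →L[ℝ] ℝ) : Type _ := {x : M // S.J x = μ}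

/-- The inclusion `i_μ : J⁻¹(μ) → M`. -/
def PolyHamiltonianSpace.incl (S : PolyHamiltonianSpace k EM M EG G)
    (μ : Fin k → EG →L[ℝ] ℝ) : S.Level μ → M := Subtype.val

instance (S : PolyHamiltonianSpace k EM M EG G) (μ : Fin k → EG →L[ℝ] ℝ) :
    TopologicalSpace (S.Level μ) :=
  inferInstanceAs (TopologicalSpace {x : M // S.J x = μ})

/-- The restricted action of `G_μ` on `J⁻¹(μ)`. -/
instance [LieGroup 𝓘(ℝ, EG) ∞ G] (S : PolyHamiltonianSpace k EM M EG G)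
    (μ : Fin k → EG →L[ℝ] ℝ) : MulAction (isotropyK EG G μ) (S.Level μ) where
  smul g x := ⟨(g : G) • x.1, by
    rw [S.equivariant, x.2]
    exact g.2⟩
  one_smul x := Subtype.ext (one_smul G x.1)
  mul_smul g h x := Subtype.ext (mul_smul (g : G) (h : G) x.1)

/-- `μ` is a regular value of `J`. -/
def PolyHamiltonianSpace.IsRegularValue (S : PolyHamiltonianSpace k EM M EG G)
    (μ : Fin k → EG →L[ℝ] ℝ) : Prop :=
  ∀ x : M, S.J x = μ →
    Function.Surjective (mfderiv 𝓘(ℝ, EM) 𝓘(ℝ, Fin k → EG →L[ℝ] ℝ) S.J x)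

variable {EP : Type*} [NormedAddCommGroup EP] [NormedSpace ℝ EP]

/-- `T_x (J⁻¹(μ))` as a subspace of `T_x M`. -/
def PolyHamiltonianSpace.levelTangent (S : PolyHamiltonianSpace k EM M EG G)
    (μ : Fin k → EG →L[ℝ] ℝ) (EP : Type*) [NormedAddCommGroup EP] [NormedSpace ℝ EP]
    [ChartedSpace EP (S.Level μ)] (x : S.Level μ) :
    Submodule ℝ (TangentSpace 𝓘(ℝ, EM) (S.incl μ x)) :=
  LinearMap.range (mfderiv 𝓘(ℝ, EP) 𝓘(ℝ, EM) (S.incl μ) x).toLinearMap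

/-- Condition (C1): for each `x ∈ J⁻¹(μ)` and each `a`,
`ker T_x Jᵃ = T_x (J⁻¹(μ)) + ker ωᵃ|ₓ + T_x (G_{μ_a} · x)`. -/
def PolyHamiltonianSpace.CondC1 [LieGroup 𝓘(ℝ, EG) ∞ G] (S : PolyHamiltonianSpace k EM M EG G)
    (μ : Fin k → EG →L[ℝ] ℝ) (EP : Type*) [NormedAddCommGroup EP] [NormedSpace ℝ EP]
    [ChartedSpace EP (S.Level μ)] : Prop :=
  ∀ (x : S.Level μ) (a : Fin k),
    LinearMap.ker (mfderiv 𝓘(ℝ, EM) 𝓘(ℝ, EG →L[ℝ] ℝ) (fun y => S.J y a) (S.incl μ x)).toLinearMap =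
      S.levelTangent μ EP x ⊔ (S.form a).kerAt (S.incl μ x) ⊔
        orbitTangent EG (isotropy EG G (μ a)) EM (S.incl μ x)

/-- Condition (C2): for each `x ∈ J⁻¹(μ)`,
`T_x (G_μ · x) = ⋂ₐ [T_x (G_{μ_a} · x) + ker ωᵃ|ₓ] ∩ T_x (J⁻¹(μ))`. -/
def PolyHamiltonianSpace.CondC2 [LieGroup 𝓘(ℝ, EG) ∞ G] (S : PolyHamiltonianSpace k EM M EG G)
    (μ : Fin k → EG →L[ℝ] ℝ) (EP : Type*) [NormedAddCommGroup EP] [NormedSpace ℝ EP]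
    [ChartedSpace EP (S.Level μ)] : Prop :=
  ∀ x : S.Level μ,
    orbitTangent EG (isotropyK EG G μ) EM (S.incl μ x) =
      (⨅ a, (orbitTangent EG (isotropy EG G (μ a)) EM (S.incl μ x) ⊔
        (S.form a).kerAt (S.incl μ x))) ⊓ S.levelTangent μ EP x

end LevelSets

/-! ### `k`-vector fields and integral sections -/

section KVectorFields

/-- `k`-vector fields `(X₁, …, X_k)` on `M` (no regularity). -/
abbrev KVectorField (k : ℕ) (EM : Type*) [NormedAddCommGroup EM] [NormedSpace ℝ EM] (M : Type*)
    [TopologicalSpace M] [ChartedSpace EM M] : Type _ :=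
  Fin k → ∀ x : M, TangentSpace 𝓘(ℝ, EM) x

variable {k : ℕ} {EM : Type*} [NormedAddCommGroup EM] [NormedSpace ℝ EM]
  {M : Type*} [TopologicalSpace M] [ChartedSpace EM M]

/-- `Y` is a smooth vector field. -/
def IsSmoothVectorField [IsManifold 𝓘(ℝ, EM) ∞ M] (Y : ∀ x : M, TangentSpace 𝓘(ℝ, EM) x) : Prop :=
  ContMDiff 𝓘(ℝ, EM) 𝓘(ℝ, EM).tangent ∞ (fun x => (⟨x, Y x⟩ : TangentBundle 𝓘(ℝ, EM) M))

/-- The partial derivative `T_t φ (∂/∂tᵃ)` of a map `φ` defined on (a subset of) `ℝᵏ`. -/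
def partialAt (EM : Type*) [NormedAddCommGroup EM] [NormedSpace ℝ EM] {M : Type*}
    [TopologicalSpace M] [ChartedSpace EM M] (φ : EuclideanSpace ℝ (Fin k) → M)
    (t : EuclideanSpace ℝ (Fin k)) (a : Fin k) : TangentSpace 𝓘(ℝ, EM) (φ t) :=
  mfderiv 𝓘(ℝ, EuclideanSpace ℝ (Fin k)) 𝓘(ℝ, EM) φ t (EuclideanSpace.single a (1 : ℝ))

/-- `φ` is, on the open set `U ⊆ ℝᵏ`, an integral section of `X`. -/
def IsIntegralSectionOn (X : KVectorField k EM M) (φ : EuclideanSpace ℝ (Fin k) → M)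
    (U : Set (EuclideanSpace ℝ (Fin k))) : Prop :=
  ContMDiffOn 𝓘(ℝ, EuclideanSpace ℝ (Fin k)) 𝓘(ℝ, EM) ∞ φ U ∧
    ∀ t ∈ U, ∀ a, partialAt EM φ t a = X a (φ t)

/-- `φ : ℝᵏ → M` is an integral section of `X`. -/
def IsIntegralSection (X : KVectorField k EM M) (φ : EuclideanSpace ℝ (Fin k) → M) : Prop :=
  IsIntegralSectionOn X φ Set.univ

/-- `X` is integrable: through every point passes an integral section, defined on some
neighbourhood of `0`. -/
def IsIntegrable (X : KVectorField k EM M) : Prop :=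
  ∀ p : M, ∃ (U : Set (EuclideanSpace ℝ (Fin k))) (φ : EuclideanSpace ℝ (Fin k) → M),
    IsOpen U ∧ 0 ∈ U ∧ φ 0 = p ∧ IsIntegralSectionOn X φ U

/-- `X` is invariant under the subgroup `K` of a group acting on `M`. -/
def IsInvariantUnder {G : Type*} [Group G] [MulAction G M] (K : Subgroup G)
    (X : KVectorField k EM M) : Prop :=
  ∀ g ∈ K, ∀ (a : Fin k) (x : M), tangentAct EM g x (X a x) = X a (g • x)

/-- `X` solves the `k`-symplectic Hamiltonian equations `∑ₐ Xₐ ⌟ ωᵃ = dH`. -/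
def IsKSymplecticSolution (Ω : Fin k → TwoForm EM M) (H : M → ℝ) (X : KVectorField k EM M) :
    Prop :=
  ∀ (x : M) (v : TangentSpace 𝓘(ℝ, EM) x),
    ∑ a, Ω a x ![X a x, v] = mfderiv 𝓘(ℝ, EM) 𝓘(ℝ, ℝ) H x v

variable {EG : Type*} [NormedAddCommGroup EG] [NormedSpace ℝ EG] {G : Type*} [TopologicalSpace G]
  [ChartedSpace EG G] [Group G] [MulAction G M]

/-- `X` is tangent to `J⁻¹(μ)`. -/
def PolyHamiltonianSpace.IsTangent (S : PolyHamiltonianSpace k EM M EG G)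
    (μ : Fin k → EG →L[ℝ] ℝ) (EP : Type*) [NormedAddCommGroup EP] [NormedSpace ℝ EP]
    [ChartedSpace EP (S.Level μ)] (X : KVectorField k EM M) : Prop :=
  ∀ (a : Fin k) (x : S.Level μ), X a (S.incl μ x) ∈ S.levelTangent μ EP x

/-- The restriction `X_μ` to `J⁻¹(μ)` of a `k`-vector field `X` that is tangent to `J⁻¹(μ)`:
`X_μ(x)` is the vector with `T i_μ (X_μ(x)) = X(x)` (it is unique, as `i_μ` is an immersion). -/
def PolyHamiltonianSpace.restrict (S : PolyHamiltonianSpace k EM M EG G)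
    (μ : Fin k → EG →L[ℝ] ℝ) (EP : Type*) [NormedAddCommGroup EP] [NormedSpace ℝ EP]
    [ChartedSpace EP (S.Level μ)] (X : KVectorField k EM M) : KVectorField k EP (S.Level μ) :=
  fun a x => Classical.epsilon fun w : TangentSpace 𝓘(ℝ, EP) x =>
    mfderiv 𝓘(ℝ, EP) 𝓘(ℝ, EM) (S.incl μ) x w = X a (S.incl μ x)

end KVectorFields

/-! ### Connections on a principal bundle `P → P/G` -/

section Bundles

/-- The projection `π_P : P → P/G` onto the orbit space. -/
def orbitProj (G : Type*) [Group G] {P : Type*} [MulAction G P] (p : P) :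
    MulAction.orbitRel.Quotient G P := Quotient.mk _ p

variable {k : ℕ} {EG : Type*} [NormedAddCommGroup EG] [NormedSpace ℝ EG] {G : Type*}
  [TopologicalSpace G] [ChartedSpace EG G] [Group G]
  {EP : Type*} [NormedAddCommGroup EP] [NormedSpace ℝ EP] {P : Type*} [TopologicalSpace P]
  [ChartedSpace EP P] [MulAction G P]
  {EQ : Type*} [NormedAddCommGroup EQ] [NormedSpace ℝ EQ]
  [ChartedSpace EQ (MulAction.orbitRel.Quotient G P)]

/-- The reduced `k`-vector field `X̄` on `P/G` of an invariant `k`-vector field `X` on `P`, given by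
`X̄ₐ([p]) = T π_P (Xₐ(p))` for any representative `p` of the orbit. -/
def reducedKVF (G : Type*) [Group G] [MulAction G P] (EQ : Type*) [NormedAddCommGroup EQ]
    [NormedSpace ℝ EQ] [ChartedSpace EQ (MulAction.orbitRel.Quotient G P)]
    (X : KVectorField k EP P) : KVectorField k EQ (MulAction.orbitRel.Quotient G P) :=
  fun a q => mfderiv 𝓘(ℝ, EP) 𝓘(ℝ, EQ) (orbitProj G (P := P)) q.out (X a q.out)

/-- The pullback bundle `φ̄^*P ⊆ ℝᵏ × P` of `P → P/G` by a map `φ̄ : ℝᵏ → P/G`. -/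
def PullbackBundle (φ : EuclideanSpace ℝ (Fin k) → MulAction.orbitRel.Quotient G P) : Type _ :=
  {tp : EuclideanSpace ℝ (Fin k) × P // φ tp.1 = orbitProj G tp.2}

/-- The inclusion `φ̄^*P → ℝᵏ × P`. -/
def PullbackBundle.incl (φ : EuclideanSpace ℝ (Fin k) → MulAction.orbitRel.Quotient G P) :
    PullbackBundle φ → EuclideanSpace ℝ (Fin k) × P := Subtype.val

instance (φ : EuclideanSpace ℝ (Fin k) → MulAction.orbitRel.Quotient G P) :
    TopologicalSpace (PullbackBundle φ) :=
  inferInstanceAs (TopologicalSpace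
    {tp : EuclideanSpace ℝ (Fin k) × P // φ tp.1 = orbitProj G tp.2})

/-- The distribution `H(X, φ̄) = ⟨∂/∂t¹ + X₁, …, ∂/∂tᵏ + X_k⟩` on `φ̄^*P ⊆ ℝᵏ × P`. -/
def horizontalDist (X : KVectorField k EP P)
    (φ : EuclideanSpace ℝ (Fin k) → MulAction.orbitRel.Quotient G P)
    (EB : Type*) [NormedAddCommGroup EB] [NormedSpace ℝ EB] [ChartedSpace EB (PullbackBundle φ)]
    (b : PullbackBundle φ) : Submodule ℝ (TangentSpace 𝓘(ℝ, EB) b) :=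
  (Submodule.span ℝ (Set.range fun a : Fin k =>
      (((EuclideanSpace.single a (1 : ℝ) : EuclideanSpace ℝ (Fin k)), (X a b.1.2 : EP)) :
        TangentSpace (𝓘(ℝ, EuclideanSpace ℝ (Fin k)).prod 𝓘(ℝ, EP)) (PullbackBundle.incl φ b)))).comap
    (mfderiv 𝓘(ℝ, EB) (𝓘(ℝ, EuclideanSpace ℝ (Fin k)).prod 𝓘(ℝ, EP))
      (PullbackBundle.incl φ) b).toLinearMap

/-- The vertical distribution of the projection `φ̄^*P → ℝᵏ`. -/
def verticalDist (φ : EuclideanSpace ℝ (Fin k) → MulAction.orbitRel.Quotient G P)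
    (EB : Type*) [NormedAddCommGroup EB] [NormedSpace ℝ EB] [ChartedSpace EB (PullbackBundle φ)]
    (b : PullbackBundle φ) : Submodule ℝ (TangentSpace 𝓘(ℝ, EB) b) :=
  LinearMap.ker (mfderiv 𝓘(ℝ, EB) 𝓘(ℝ, EuclideanSpace ℝ (Fin k))
    (fun b : PullbackBundle φ => b.1.1) b).toLinearMap

section Curvature

variable {EB : Type*} [NormedAddCommGroup EB] [NormedSpace ℝ EB] {B : Type*} [TopologicalSpace B]
  [ChartedSpace EB B]

/-- The horizontal part of `v`, for complementary distributions `Hd` (horizontal) and `Vd`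
(vertical). -/
def horPart (Hd Vd : ∀ b : B, Submodule ℝ (TangentSpace 𝓘(ℝ, EB) b)) (b : B)
    (v : TangentSpace 𝓘(ℝ, EB) b) : TangentSpace 𝓘(ℝ, EB) b :=
  Classical.epsilon fun w => w ∈ Hd b ∧ v - w ∈ Vd b

/-- The vertical part of `v`. -/
def verPart (Hd Vd : ∀ b : B, Submodule ℝ (TangentSpace 𝓘(ℝ, EB) b)) (b : B)
    (v : TangentSpace 𝓘(ℝ, EB) b) : TangentSpace 𝓘(ℝ, EB) b :=
  v - horPart Hd Vd b v

/-- The curvature `K(Y, Z) = - Ver [Hor Y, Hor Z]`. -/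
def curvature (Hd Vd : ∀ b : B, Submodule ℝ (TangentSpace 𝓘(ℝ, EB) b))
    (Y Z : ∀ b : B, TangentSpace 𝓘(ℝ, EB) b) (b : B) : TangentSpace 𝓘(ℝ, EB) b :=
  -verPart Hd Vd b (VectorField.mlieBracket 𝓘(ℝ, EB) (fun c => horPart Hd Vd c (Y c))
    (fun c => horPart Hd Vd c (Z c)) b)

/-- The connection with horizontal distribution `Hd` is flat: its curvature vanishes. -/
def IsFlat [IsManifold 𝓘(ℝ, EB) ∞ B] (Hd Vd : ∀ b : B, Submodule ℝ (TangentSpace 𝓘(ℝ, EB) b)) :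
    Prop :=
  ∀ Y Z : ∀ b : B, TangentSpace 𝓘(ℝ, EB) b, IsSmoothVectorField Y → IsSmoothVectorField Z →
    ∀ b, curvature Hd Vd Y Z b = 0

end Curvature

/-- A principal connection on `P → P/G`, given by its connection one-form `𝒜 : TP → 𝔤`. -/
structure PrincipalConnection (EG : Type*) [NormedAddCommGroup EG] [NormedSpace ℝ EG] (G : Type*)
    [TopologicalSpace G] [ChartedSpace EG G] [Group G] (EP : Type*) [NormedAddCommGroup EP]
    [NormedSpace ℝ EP] (P : Type*) [TopologicalSpace P] [ChartedSpace EP P]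
    [IsManifold 𝓘(ℝ, EP) ∞ P] [MulAction G P] where
  /-- the connection one-form -/
  form : ∀ p : P, TangentSpace 𝓘(ℝ, EP) p →L[ℝ] GroupLieAlgebra 𝓘(ℝ, EG) G
  smooth : ContMDiff (M' := EG) 𝓘(ℝ, EP).tangent 𝓘(ℝ, EG) ∞
    (fun v : TangentBundle 𝓘(ℝ, EP) P => form v.1 v.2)
  reproduces : ∀ (ξ : GroupLieAlgebra 𝓘(ℝ, EG) G) (p : P), form p (infGen ξ p) = ξ
  equivariant : ∀ (g : G) (p : P) (v : TangentSpace 𝓘(ℝ, EP) p),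
    form (g • p) (tangentAct EP g p v) = Ad EG g (form p v)

/-- The horizontal lift `X̄ʰ` to `P` of a `k`-vector field `X̄` on `P/G`: `X̄ₐʰ(p)` is the vector
at `p` that is horizontal for `𝒜` and projects onto `X̄ₐ(π_P(p))`. -/
def PrincipalConnection.horizontalLift [IsManifold 𝓘(ℝ, EP) ∞ P]
    (A : PrincipalConnection EG G EP P)
    (Xbar : KVectorField k EQ (MulAction.orbitRel.Quotient G P)) : KVectorField k EP P :=
  fun a p => Classical.epsilon fun w : TangentSpace 𝓘(ℝ, EP) p =>
    A.form p w = 0 ∧ mfderiv 𝓘(ℝ, EP) 𝓘(ℝ, EQ) (orbitProj G (P := P)) p w = Xbar a (orbitProj G p)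

/-- `φh : ℝᵏ → P` is a horizontal lift of the integral section `φ̄` of `X̄`: it is an integral section
of `X̄ʰ` that projects onto `φ̄`. -/
def PrincipalConnection.IsHorizontalLiftOf [IsManifold 𝓘(ℝ, EP) ∞ P]
    (A : PrincipalConnection EG G EP P)
    (Xbar : KVectorField k EQ (MulAction.orbitRel.Quotient G P))
    (φh : EuclideanSpace ℝ (Fin k) → P)
    (φbar : EuclideanSpace ℝ (Fin k) → MulAction.orbitRel.Quotient G P) : Prop :=
  IsIntegralSection (A.horizontalLift Xbar) φh ∧ ∀ t, orbitProj G (φh t) = φbar t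

/-- `g : ℝᵏ → G` is a smooth solution of the reconstruction equation `g⁻¹ g⁽¹⁾ = 𝒜(X ∘ φh)`, i.e.
`g(t)⁻¹ · ∂g/∂tᵃ(t) = 𝒜(Xₐ(φh(t)))` in `𝔤` for all `t` and `a`. -/
def PrincipalConnection.SolvesReconstruction [IsManifold 𝓘(ℝ, EP) ∞ P]
    (A : PrincipalConnection EG G EP P) (X : KVectorField k EP P)
    (φh : EuclideanSpace ℝ (Fin k) → P) (g : EuclideanSpace ℝ (Fin k) → G) : Prop :=
  ContMDiff 𝓘(ℝ, EuclideanSpace ℝ (Fin k)) 𝓘(ℝ, EG) ∞ g ∧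
    ∀ (t : EuclideanSpace ℝ (Fin k)) (a : Fin k),
      (mfderiv 𝓘(ℝ, EG) 𝓘(ℝ, EG) (fun h : G => (g t)⁻¹ * h) (g t) (partialAt EG g t a) : EG) =
        A.form (φh t) (X a (φh t))

end Bundles

end

/-!
Write `P = J⁻¹(μ)`, `K = G_μ`, `X` for the restricted `k`-vector field and `X̄` for the reduced one.

*Flatness gives local integral sections.* An integral curve of `Xₐ` projects to an integral curve of
`X̄ₐ`, so `∂/∂tᵃ + Xₐ` is tangent to the pullback bundle `φ̄^*P ⊆ ℝᵏ × P`
(`exists_mfderiv_pullbackIncl_eq`). These `k` fields on the bundle are horizontal and lift the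
coordinate fields of `ℝᵏ`; their brackets are vertical because the coordinate fields commute, and
flatness makes the vertical part of the bracket vanish. So the fields commute, and the Frobenius
theorem provides local integral sections through every point of the bundle; their components in `P`
are local integral sections of `X` over `φ̄` (`exists_integralSectionOn_of_isFlat`). The Frobenius
theorem is proved for total differential equations `Dσ = V ∘ σ`, which are solved along the rays from
the origin; that the second derivatives prescribed by `V` are symmetric makes the map obtained from
the radial solutions a solution (`exists_hasFDerivAt_eq_of_symm`).

*Invariance makes the local sections global.* The group moves a local section over a ball to one
through any other point of the fibre, so the size of the ball depends on its centre only. Hence a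
section over a ball around `0` continues to a larger concentric ball, and so to all of `ℝᵏ`
(`exists_section_univ`, `exists_integralSection_lift_of_invariant`). The horizontal lift `X̄ʰ` is
invariant too, and the same argument applies to it when it is integrable.

*Reconstruction.* The kernel of `T π` consists of the vertical vectors `ξ_P(p)`, so
`X̄ʰ = X - (𝒜(X))_P`. By the Leibniz rule for `g(t) · φₕ(t)` and the invariance of `X`, the
reconstruction equation for `g` says that `g · φₕ` is an integral section of `X`
(`PrincipalConnection.solvesReconstruction_iff`). Finally, two smooth maps into `P` over the same map
to `P/K` differ by a smooth map into `K`: that map is continuous because the action is free and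
proper, and smooth by the inverse function theorem, as `𝒜` splits the infinitesimal action
(`contMDiffAt_of_smul_eq`). Hence the integral sections of `X` over `φ̄` correspond to the solutions
of the reconstruction equation, and the lift provided by flatness shows that one exists.
-/

/-! ### Total differential equations -/

section TotalODE

open Set Metric

variable {E F : Type*} [NormedAddCommGroup E] [NormedSpace ℝ E] [NormedAddCommGroup F]
  [NormedSpace ℝ F]

/-- The autonomous equation `y' = V(y) u` has a solution on `[0, 1]` that does not leave a given
ball around the initial point, as soon as `u` is short enough. -/
lemma exists_radial_solution [CompleteSpace E] {V : E → F →L[ℝ] E} {y₀ : E} {ρ C : ℝ}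
    {K : NNReal} (hC : 0 ≤ C) (hV : ∀ y ∈ closedBall y₀ ρ, ‖V y‖ ≤ C)
    (hL : LipschitzOnWith K V (closedBall y₀ ρ)) {u : F} (hu : C * ‖u‖ ≤ ρ) :
    ∃ α : ℝ → E, α 0 = y₀ ∧ ∀ s ∈ Icc (0 : ℝ) 1, α s ∈ closedBall y₀ ρ ∧
      HasDerivWithinAt α (V (α s) u) (Icc 0 1) s := by
  have hρ : 0 ≤ ρ := le_trans (by positivity) hu
  lift ρ to NNReal using hρ
  lift C to NNReal using hC
  let t₀ : Icc (0 : ℝ) 1 := ⟨0, by simp⟩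
  have hpl : IsPicardLindelof (fun _ y => V y u) t₀ y₀ ρ 0 (C * ‖u‖₊) (K * ‖u‖₊) := by
    refine ⟨fun _ _ => ?_, fun _ _ => continuousOn_const, fun _ _ y hy => ?_, ?_⟩
    · refine LipschitzOnWith.of_dist_le_mul fun x hx y hy => ?_
      rw [dist_eq_norm, ← sub_apply]
      refine ((V x - V y).le_opNorm u).trans ?_
      have := hL.dist_le_mul x hx y hy
      rw [dist_eq_norm] at this
      push_cast
      calc _ ≤ K * dist x y * ‖u‖ := by gcongr
        _ = _ := by ring
    · exact ((V y).le_opNorm u).trans (mul_le_mul_of_nonneg_right (hV y hy) (norm_nonneg u))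
    · simpa [t₀] using hu
  obtain ⟨α, hα⟩ := ODE.FunSpace.exists_isFixedPt_next hpl (mem_closedBall_self le_rfl)
  have hmem : ∀ s, α.compProj s ∈ closedBall y₀ ρ := fun s =>
    α.compProj_mem_closedBall hpl.mul_max_le
  refine ⟨α.compProj, ?_, fun s hs => ⟨hmem s, ?_⟩⟩
  · have : α.compProj (t₀ : ℝ) = y₀ := by
      rw [ODE.FunSpace.compProj_val, ← hα, ODE.FunSpace.next_apply₀]
    exact this
  · refine (ODE.hasDerivWithinAt_picard_Icc t₀.2 hpl.continuousOn_uncurry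
      α.continuous_compProj.continuousOn (fun _ _ => hmem _) y₀ hs).congr_of_mem ?_ hs
    intro t' ht'
    nth_rw 1 [← hα]
    rw [ODE.FunSpace.compProj_of_mem ht', ODE.FunSpace.next_apply]

/-- The first-order correction `z(s) = y(s) + s V(y(s)) h` of a solution of `y' = V(y) u` solves
`z' = V(z) (u + h)` up to an error of second order in `h`. The first-order terms cancel because
of the integrability condition `hsymm`. -/
lemma norm_radial_defect_le {V : E → F →L[ℝ] E} {B : Set E} {C M K : ℝ} (hB : Convex ℝ B)
    (hd : ∀ y ∈ B, DifferentiableAt ℝ V y)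
    (hM : ∀ x ∈ B, ∀ y ∈ B, ‖fderiv ℝ V x - fderiv ℝ V y‖ ≤ M * ‖x - y‖) (hM0 : 0 ≤ M)
    (hK : ∀ y ∈ B, ‖fderiv ℝ V y‖ ≤ K)
    (hC : ∀ y ∈ B, ‖V y‖ ≤ C)
    (hsymm : ∀ y ∈ B, ∀ u v, fderiv ℝ V y (V y u) v = fderiv ℝ V y (V y v) u)
    {y : E} (hy : y ∈ B) {s : ℝ} (hs : s ∈ Icc (0 : ℝ) 1) {u h : F}
    (hz : y + s • V y h ∈ B) :
    ‖V y u + (V y h + s • fderiv ℝ V y (V y u) h) - V (y + s • V y h) (u + h)‖ ≤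
      (M * C ^ 2 * ‖u + h‖ + K * C) * ‖h‖ ^ 2 := by
  have hC0 : 0 ≤ C := (norm_nonneg _).trans (hC y hy)
  have hK0 : 0 ≤ K := (norm_nonneg (fderiv ℝ V y)).trans (hK y hy)
  set z := y + s • V y h with hzdef
  have hzy : z - y = s • V y h := by simp [hzdef]
  have hsn : ‖s‖ ≤ 1 := by rw [Real.norm_eq_abs, abs_le]; constructor <;> linarith [hs.1, hs.2]
  have hVh : ‖V y h‖ ≤ C * ‖h‖ := ((V y).le_opNorm h).trans (by gcongr; exact hC y hy)
  have hzyn : ‖z - y‖ ≤ C * ‖h‖ := by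
    rw [hzy, norm_smul]
    calc ‖s‖ * ‖V y h‖ ≤ 1 * (C * ‖h‖) := by gcongr
      _ = _ := one_mul _
  have hR : ‖V z - V y - fderiv ℝ V y (z - y)‖ ≤ M * C ^ 2 * ‖h‖ ^ 2 := by
    have hseg : segment ℝ y z ⊆ B := hB.segment_subset hy hz
    have := (convex_segment (𝕜 := ℝ) y z).norm_image_sub_le_of_norm_fderiv_le' (f := V)
      (φ := fderiv ℝ V y) (C := M * ‖z - y‖)
      (fun x hx => hd x (hseg hx)) (fun x hx => (hM x (hseg hx) y hy).trans ?_)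
      (left_mem_segment ℝ y z) (right_mem_segment ℝ y z)
    · refine this.trans ?_
      calc M * ‖z - y‖ * ‖z - y‖ ≤ M * (C * ‖h‖) * (C * ‖h‖) := by gcongr
        _ = _ := by ring
    · gcongr
      exact norm_sub_le_of_mem_segment hx
  have hkey : V y u + (V y h + s • fderiv ℝ V y (V y u) h) - V z (u + h) =
      -((V z - V y - fderiv ℝ V y (z - y)) (u + h)) - s • fderiv ℝ V y (V y h) h := by
    rw [hzy, map_smul]
    simp only [sub_apply, smul_apply, map_add]
    rw [hsymm y hy u h]
    abel
  rw [hkey]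
  have h2 : ‖s • fderiv ℝ V y (V y h) h‖ ≤ K * C * ‖h‖ ^ 2 := by
    rw [norm_smul]
    calc ‖s‖ * ‖fderiv ℝ V y (V y h) h‖ ≤ 1 * (K * (C * ‖h‖) * ‖h‖) := by
          gcongr
          refine (ContinuousLinearMap.le_opNorm _ _).trans ?_
          gcongr
          refine (ContinuousLinearMap.le_opNorm _ _).trans ?_
          gcongr
          exact hK y hy
      _ = _ := by ring
  calc _ ≤ ‖(V z - V y - fderiv ℝ V y (z - y)) (u + h)‖ + ‖s • fderiv ℝ V y (V y h) h‖ := by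
        refine (norm_sub_le _ _).trans ?_
        rw [norm_neg]
    _ ≤ M * C ^ 2 * ‖h‖ ^ 2 * ‖u + h‖ + K * C * ‖h‖ ^ 2 := by
        gcongr
        refine (ContinuousLinearMap.le_opNorm _ _).trans ?_
        gcongr
    _ = _ := by ring

/-- The local Frobenius theorem for the total differential equation `Dσ = V ∘ σ`: it is solvable
near `0` for every initial value if the second derivatives it prescribes are symmetric. The
solution is built from the solutions of `y' = V(y) u` along the rays `s ↦ s u`; Grönwall's
inequality, applied to the first-order corrections of these, shows that it is differentiable. -/
theorem exists_hasFDerivAt_eq_of_symm [CompleteSpace E] {V : E → F →L[ℝ] E} {S : Set E}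
    (hS : IsOpen S) {y₀ : E} (hy₀ : y₀ ∈ S) (hV : ContDiffOn ℝ 2 V S)
    (hsymm : ∀ y ∈ S, ∀ u v, fderiv ℝ V y (V y u) v = fderiv ℝ V y (V y v) u) :
    ∃ r > 0, ∃ σ : F → E, σ 0 = y₀ ∧ ∀ t ∈ ball (0 : F) r, σ t ∈ S ∧ HasFDerivAt σ (V (σ t)) t := by
  have hVat : ContDiffAt ℝ 2 V y₀ := hV.contDiffAt (hS.mem_nhds hy₀)
  have hDVat : ContDiffAt ℝ 1 (fderiv ℝ V) y₀ := hVat.fderiv_right (by norm_num)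
  obtain ⟨M, S₁, hS₁, hM⟩ := hDVat.exists_lipschitzOnWith
  obtain ⟨S₂, hS₂, hK⟩ : ∃ S₂ ∈ 𝓝 y₀, ∀ y ∈ S₂, ‖fderiv ℝ V y‖ ≤ ‖fderiv ℝ V y₀‖ + 1 := by
    have hc : ContinuousAt (fun y => ‖fderiv ℝ V y‖) y₀ :=
      ContinuousAt.norm (E := E →L[ℝ] F →L[ℝ] E) hDVat.continuousAt
    exact ⟨_, hc.eventually_le_const (lt_add_one ‖fderiv ℝ V y₀‖), fun _ h => h⟩
  obtain ⟨S₃, hS₃, hC⟩ : ∃ S₃ ∈ 𝓝 y₀, ∀ y ∈ S₃, ‖V y‖ ≤ ‖V y₀‖ + 1 := by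
    have hc : ContinuousAt (fun y => ‖V y‖) y₀ := hVat.continuousAt.norm
    exact ⟨_, hc.eventually_le_const (lt_add_one ‖V y₀‖), fun _ h => h⟩
  obtain ⟨ρ', hρ', hball⟩ := nhds_basis_closedBall.mem_iff.1
    (Filter.inter_mem (Filter.inter_mem hS₁ hS₂) (Filter.inter_mem hS₃ (hS.mem_nhds hy₀)))
  set C := ‖V y₀‖ + 1
  set Kd := ‖fderiv ℝ V y₀‖ + 1
  have hC0 : 0 < C := by positivity
  have hKd0 : 0 < Kd := by positivity
  set B := closedBall y₀ ρ' with hBdef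
  have hBconv : Convex ℝ B := convex_closedBall _ _
  have hBS : B ⊆ S := fun y hy => (hball hy).2.2
  have hd : ∀ y ∈ B, DifferentiableAt ℝ V y := fun y hy =>
    (hV.contDiffAt (hS.mem_nhds (hBS hy))).differentiableAt (by norm_num)
  have hCB : ∀ y ∈ B, ‖V y‖ ≤ C := fun y hy => hC y (hball hy).2.1
  have hKB : ∀ y ∈ B, ‖fderiv ℝ V y‖ ≤ Kd := fun y hy => hK y (hball hy).1.2
  have hMB : ∀ x ∈ B, ∀ y ∈ B, ‖fderiv ℝ V x - fderiv ℝ V y‖ ≤ M * ‖x - y‖ := fun x hx y hy => by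
    simpa [dist_eq_norm] using hM.dist_le_mul x (hball hx).1.1 y (hball hy).1.1
  have hLip : LipschitzOnWith ⟨Kd, hKd0.le⟩ V B :=
    hBconv.lipschitzOnWith_of_nnnorm_fderiv_le hd fun y hy => hKB y hy
  -- the radial solutions stay within `ρ' / 2` of `y₀`, so that their first-order corrections,
  -- which move by at most `C ‖h‖ ≤ ρ' / 2`, stay within `B`
  set ρ := ρ' / 2 with hρdef
  have hρ : 0 < ρ := by positivity
  have hsub : closedBall y₀ ρ ⊆ B := closedBall_subset_closedBall (by linarith)
  set r := ρ / C with hrdef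
  have hr : 0 < r := by positivity
  have hCr : ∀ u : F, ‖u‖ ≤ r → C * ‖u‖ ≤ ρ := fun u hu => by
    calc C * ‖u‖ ≤ C * r := by gcongr
      _ = ρ := by rw [hrdef]; field_simp
  have hrad : ∀ u : F, ∃ α : ℝ → E, ‖u‖ ≤ r → α 0 = y₀ ∧ ∀ s ∈ Icc (0 : ℝ) 1,
      α s ∈ closedBall y₀ ρ ∧ HasDerivWithinAt α (V (α s) u) (Icc 0 1) s := fun u => by
    by_cases hu : ‖u‖ ≤ r
    · obtain ⟨α, hα⟩ := exists_radial_solution hC0.le (fun y hy => hCB y (hsub hy))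
        (hLip.mono hsub) (hCr u hu)
      exact ⟨α, fun _ => hα⟩
    · exact ⟨fun _ => 0, fun h => absurd h hu⟩
  choose α hα using hrad
  have hα_right : ∀ u : F, ‖u‖ ≤ r → ∀ s ∈ Ico (0 : ℝ) 1,
      HasDerivWithinAt (α u) (V (α u s) u) (Ici s) s := fun u hu s hs =>
    ((hα u hu).2 s (Ico_subset_Icc_self hs)).2.mono_of_mem_nhdsWithin
      (Icc_mem_nhdsGE_of_mem hs)
  have hα_cont : ∀ u : F, ‖u‖ ≤ r → ContinuousOn (α u) (Icc 0 1) := fun u hu s hs =>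
    ((hα u hu).2 s hs).2.continuousWithinAt
  have h1 : (1 : ℝ) ∈ Icc (0 : ℝ) 1 := by simp
  refine ⟨r, hr, fun u => α u 1, ?_, fun t ht => ?_⟩
  · have h0 : ‖(0 : F)‖ ≤ r := by simpa using hr.le
    have := constant_of_has_deriv_right_zero (hα_cont 0 h0) (fun s hs => by
      simpa using hα_right 0 h0 s hs) 1 h1
    exact this.trans (hα 0 h0).1
  · have htr : ‖t‖ < r := by simpa using ht
    refine ⟨hBS (hsub ((hα t htr.le).2 1 h1).1), ?_⟩
    -- the Lipschitz constant of the fields `y ↦ V y (t + h)`, kept positive for Grönwall's bound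
    set L : NNReal := ⟨Kd * r, by positivity⟩ with hLdef
    have hL0 : (L : ℝ) ≠ 0 := by
      change Kd * r ≠ 0
      positivity
    set A : ℝ := (M * C ^ 2 * r + Kd * C) / L * (Real.exp (L * 1) - 1) with hA
    -- Grönwall: `α (t + h)` and the correction of `α t` both nearly solve `y' = V(y) (t + h)`
    have hmain : ∀ h : F, ‖t + h‖ ≤ r → ‖h‖ ≤ r →
        ‖α (t + h) 1 - α t 1 - V (α t 1) h‖ ≤ A * ‖h‖ ^ 2 := by
      intro h hth hh
      set z : ℝ → E := fun s => α t s + s • V (α t s) h with hz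
      have hyB : ∀ s ∈ Icc (0 : ℝ) 1, α t s ∈ B := fun s hs => hsub ((hα t htr.le).2 s hs).1
      have hzB : ∀ s ∈ Icc (0 : ℝ) 1, z s ∈ B := fun s hs => by
        have hy := ((hα t htr.le).2 s hs).1
        rw [mem_closedBall, dist_eq_norm] at hy
        rw [hBdef, mem_closedBall, dist_eq_norm, hz]
        have hsn : ‖s‖ ≤ 1 := by
          rw [Real.norm_eq_abs, abs_le]; constructor <;> linarith [hs.1, hs.2]
        calc ‖α t s + s • V (α t s) h - y₀‖ = ‖(α t s - y₀) + s • V (α t s) h‖ := by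
              congr 1; abel
          _ ≤ ‖α t s - y₀‖ + ‖s‖ * ‖V (α t s) h‖ := by
              refine (norm_add_le _ _).trans ?_
              rw [norm_smul]
          _ ≤ ρ + 1 * (C * ‖h‖) := by
              gcongr
              exact ((V _).le_opNorm h).trans (by gcongr; exact hCB _ (hyB s hs))
          _ ≤ ρ + ρ := by linarith [hCr h hh]
          _ = ρ' := by rw [hρdef]; ring
      have hzd : ∀ s ∈ Icc (0 : ℝ) 1, HasDerivWithinAt z (V (α t s) t +
          (V (α t s) h + s • fderiv ℝ V (α t s) (V (α t s) t) h)) (Icc 0 1) s := fun s hs => by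
        have h1 := ((hα t htr.le).2 s hs).2
        have h2 : HasDerivWithinAt (fun s => V (α t s)) (fderiv ℝ V (α t s) (V (α t s) t))
            (Icc 0 1) s := (hd _ (hyB s hs)).hasFDerivAt.comp_hasDerivWithinAt s h1
        have h3 : HasDerivWithinAt (fun s => V (α t s) h)
            (fderiv ℝ V (α t s) (V (α t s) t) h) (Icc 0 1) s := by
          have := h2.clm_apply (hasDerivWithinAt_const s (Icc 0 1) h)
          simpa using this
        have h4 := (hasDerivWithinAt_id s (Icc (0 : ℝ) 1)).smul h3
        refine (h1.add h4).congr_deriv ?_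
        simp only [id_eq, one_smul]
        abel
      have hG := dist_le_of_approx_trajectories_ODE_of_mem (K := L) (a := 0) (b := 1)
        (v := fun _ y => V y (t + h)) (s := fun _ => B) (f := α (t + h))
        (f' := fun s => V (α (t + h) s) (t + h)) (g := z) (εf := 0) (δ := 0)
        (εg := (M * C ^ 2 * r + Kd * C) * ‖h‖ ^ 2)
        (g' := fun s => V (α t s) t + (V (α t s) h + s • fderiv ℝ V (α t s) (V (α t s) t) h))
        (fun s _ => ?_) (hα_cont _ hth) (hα_right _ hth) (fun s _ => by simp)
        (fun s hs => hsub ((hα _ hth).2 s (Ico_subset_Icc_self hs)).1)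
        (fun s hs => (hzd s hs).continuousWithinAt)
        (fun s hs => (hzd s (Ico_subset_Icc_self hs)).mono_of_mem_nhdsWithin
          (Icc_mem_nhdsGE_of_mem hs))
        (fun s hs => ?_) (fun s hs => hzB s (Ico_subset_Icc_self hs)) ?_ 1 h1
      · rw [dist_eq_norm, gronwallBound_of_K_ne_0 hL0] at hG
        have e1 : α (t + h) 1 - α t 1 - V (α t 1) h = α (t + h) 1 - z 1 := by
          simp only [hz, one_smul]; abel
        rw [e1]
        refine hG.trans (le_of_eq ?_)
        rw [hA]
        simp only [zero_mul, zero_add, sub_zero]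
        ring
      · refine LipschitzOnWith.of_dist_le_mul fun x hx y hy => ?_
        rw [dist_eq_norm, ← sub_apply]
        refine ((V x - V y).le_opNorm _).trans ?_
        have h5 := hLip.dist_le_mul x hx y hy
        rw [dist_eq_norm] at h5
        change _ ≤ Kd * r * dist x y
        calc _ ≤ Kd * dist x y * r := by gcongr; exact h5
          _ = _ := by ring
      · rw [dist_eq_norm]
        refine (norm_radial_defect_le hBconv hd hMB M.2 hKB hCB
          (fun y hy => hsymm y (hBS hy)) (hyB s (Ico_subset_Icc_self hs))
          (Ico_subset_Icc_self hs) (hzB s (Ico_subset_Icc_self hs))).trans ?_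
        gcongr
      · simp [hz, (hα _ hth).1, (hα t htr.le).1]
    rw [hasFDerivAt_iff_isLittleO_nhds_zero]
    refine Asymptotics.IsBigO.trans_isLittleO (g := fun h : F => ‖h‖ ^ 2) ?_ ?_
    · refine Asymptotics.IsBigO.of_bound A ?_
      have hmem : ball (0 : F) (r - ‖t‖) ∈ 𝓝 (0 : F) := ball_mem_nhds _ (by linarith)
      filter_upwards [hmem] with h hh
      have hh' : ‖h‖ < r - ‖t‖ := by simpa using hh
      have := hmain h ((norm_add_le t h).trans (by linarith)) (by linarith [norm_nonneg t])
      simpa using this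
    · exact Asymptotics.isLittleO_norm_pow_id one_lt_two

/-- A solution of `Dσ = V ∘ σ` is as smooth as `V`. -/
lemma contDiffOn_of_hasFDerivAt_eq {V : E → F →L[ℝ] E} {S : Set E} (hV : ContDiffOn ℝ ∞ V S)
    {U : Set F} (hU : IsOpen U) {σ : F → E}
    (hσ : ∀ t ∈ U, σ t ∈ S ∧ HasFDerivAt σ (V (σ t)) t) : ContDiffOn ℝ ∞ σ U := by
  rw [contDiffOn_infty]
  intro n
  induction n with
  | zero =>
    exact contDiffOn_zero.2 fun t ht => (hσ t ht).2.continuousAt.continuousWithinAt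
  | succ n ih =>
    have : ((n + 1 : ℕ) : WithTop ℕ∞) = (n : WithTop ℕ∞) + 1 := by push_cast; rfl
    rw [this, contDiffOn_succ_iff_fderiv_of_isOpen hU]
    refine ⟨fun t ht => (hσ t ht).2.differentiableAt.differentiableWithinAt, by simp, ?_⟩
    have h1 : ContDiffOn ℝ n (fun t => V (σ t)) U :=
      (hV.of_le (by exact_mod_cast le_top)).comp ih fun t ht => (hσ t ht).1
    exact h1.congr fun t ht => (hσ t ht).2.fderiv

end TotalODE

/-! ### Gluing local sections over a vector space -/

section Gluing

open Set Metric

variable {E : Type*} [NormedAddCommGroup E] [NormedSpace ℝ E] {P : Type*}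

/-- The intersection of the balls of radius `δ` around two points `x`, `y` of the closed ball of
radius `R`, if non-empty, meets the open ball of radius `R`. -/
lemma exists_mem_ball_inter_ball_inter_ball {R δ : ℝ} (hR : 0 < R) {x y z : E} (hx : ‖x‖ ≤ R)
    (hy : ‖y‖ ≤ R) (hzx : z ∈ ball x δ) (hzy : z ∈ ball y δ) :
    ∃ w, w ∈ ball x δ ∧ w ∈ ball y δ ∧ w ∈ ball (0 : E) R := by
  have hxy : dist x y < 2 * δ := by
    have := dist_triangle x z y
    rw [mem_ball] at hzx hzy
    rw [dist_comm] at hzx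
    linarith
  have hopen : IsOpen (ball x δ ∩ ball y δ) := isOpen_ball.inter isOpen_ball
  have hm1 : midpoint ℝ x y ∈ ball x δ := by
    rw [mem_ball, dist_midpoint_left, Real.norm_ofNat]
    linarith
  have hm2 : midpoint ℝ x y ∈ ball y δ := by
    rw [mem_ball, dist_midpoint_right, Real.norm_ofNat]
    linarith
  have hm3 : midpoint ℝ x y ∈ closure (ball (0 : E) R) := by
    rw [closure_ball _ hR.ne']
    exact (convex_closedBall (0 : E) R).midpoint_mem (by simpa using hx) (by simpa using hy)
  obtain ⟨w, hw, hwR⟩ := mem_closure_iff.1 hm3 _ hopen ⟨hm1, hm2⟩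
  exact ⟨w, hw.1, hw.2, hwR⟩

variable [ProperSpace E] {S : Set E → (E → P) → Prop}

/-- A section over an open ball extends to a larger concentric ball: extend it over balls of a
uniform radius around the points of the boundary sphere. -/
lemma exists_section_larger_ball
    (mono : ∀ U W φ, S U φ → W ⊆ U → IsOpen W → S W φ)
    (glue : ∀ U φ, IsOpen U →
      (∀ t ∈ U, ∃ W ψ, IsOpen W ∧ t ∈ W ∧ S W ψ ∧ EqOn φ ψ W) → S U φ)
    (uniq : ∀ U φ ψ t, IsOpen U → Convex ℝ U → t ∈ U → S U φ → S U ψ → φ t = ψ t → EqOn φ ψ U)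
    (ext : ∀ t₀, ∃ r > 0, ∀ t ∈ ball t₀ r, ∀ W φ, S W φ → t ∈ W →
      ∃ ψ, S (ball t₀ r) ψ ∧ ψ t = φ t)
    {R : ℝ} (hR : 0 < R) {φ : E → P} (hφ : S (ball 0 R) φ) :
    ∃ R' > R, ∃ φ', S (ball 0 R') φ' ∧ EqOn φ' φ (ball 0 R) := by
  classical
  choose r hr hext using ext
  obtain ⟨δ, hδ, hleb⟩ := lebesgue_number_lemma_of_metric (isCompact_closedBall (0 : E) R)
    (c := fun t₀ => ball t₀ (r t₀)) (fun _ => isOpen_ball)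
    (fun x _ => mem_iUnion.2 ⟨x, mem_ball_self (hr x)⟩)
  -- `δ` is a Lebesgue number of the cover by the balls of continuation; so `φ` continues to the
  -- ball of radius `δ` around each point of the sphere
  have hψ : ∀ x : E, ∃ ψ, ‖x‖ = R → S (ball x δ) ψ ∧ EqOn ψ φ (ball x δ ∩ ball 0 R) := by
    intro x
    by_cases hx : ‖x‖ = R
    · obtain ⟨t₀, ht₀⟩ := hleb x (by simp [hx])
      obtain ⟨w, hw1, -, hw2⟩ := exists_mem_ball_inter_ball_inter_ball hR hx.le hx.le
        (mem_ball_self hδ) (mem_ball_self hδ)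
      obtain ⟨ψ, hψ, hψw⟩ := hext t₀ w (ht₀ hw1) _ φ hφ hw2
      refine ⟨ψ, fun _ => ⟨mono _ _ _ hψ ht₀ isOpen_ball, ?_⟩⟩
      have hopen : IsOpen (ball x δ ∩ ball 0 R) := isOpen_ball.inter isOpen_ball
      exact uniq _ ψ φ w hopen ((convex_ball _ _).inter (convex_ball _ _)) ⟨hw1, hw2⟩
        (mono _ _ _ hψ (inter_subset_left.trans ht₀) hopen)
        (mono _ _ _ hφ inter_subset_right hopen) hψw
    · exact ⟨φ, fun h => absurd h hx⟩
  choose ψ hψ using hψ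
  -- the radial projection to the sphere of radius `R`
  let p : E → E := fun t => (R / ‖t‖) • t
  have hp : ∀ t : E, R ≤ ‖t‖ → ‖p t‖ = R := fun t ht => by
    have : 0 < ‖t‖ := hR.trans_le ht
    simp only [p, norm_smul, norm_div, Real.norm_eq_abs, abs_of_pos hR, abs_of_pos this]
    field_simp
  have hpd : ∀ t : E, R ≤ ‖t‖ → dist t (p t) = ‖t‖ - R := fun t ht => by
    have h0 : 0 < ‖t‖ := hR.trans_le ht
    have e : t - p t = (1 - R / ‖t‖) • t := by simp only [p, sub_smul, one_smul]
    have h1 : 0 ≤ 1 - R / ‖t‖ := by rw [sub_nonneg, div_le_one h0]; exact ht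
    rw [dist_eq_norm, e, norm_smul, Real.norm_of_nonneg h1]
    field_simp
  let φ' : E → P := fun t => if ‖t‖ < R then φ t else ψ (p t) t
  have hφ' : EqOn φ' φ (ball 0 R) := fun t ht => if_pos (by simpa using ht)
  refine ⟨R + δ, by linarith, φ', glue _ _ isOpen_ball fun t ht => ?_, hφ'⟩
  have ht' : ‖t‖ < R + δ := by simpa using ht
  rcases lt_or_ge ‖t‖ R with h | h
  · exact ⟨ball 0 R, φ, isOpen_ball, by simpa using h, hφ, hφ'⟩
  · have hx := hp t h
    refine ⟨ball (p t) δ, ψ (p t), isOpen_ball, ?_, (hψ _ hx).1, fun s hs => ?_⟩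
    · rw [mem_ball, hpd t h]
      linarith
    · rcases lt_or_ge ‖s‖ R with hsR | hsR
      · have hsb : s ∈ ball (0 : E) R := by simpa using hsR
        exact (hφ' hsb).trans ((hψ _ hx).2 ⟨hs, hsb⟩).symm
      · have e : φ' s = ψ (p s) s := if_neg hsR.not_gt
        rw [e]
        have hsx := hp s hsR
        have hs2 : s ∈ ball (p s) δ := by
          rw [mem_ball, hpd s hsR]
          have h1 : ‖s‖ - ‖p t‖ ≤ ‖s - p t‖ := norm_sub_norm_le _ _
          rw [mem_ball, dist_eq_norm] at hs
          linarith
        -- two of the continuations agree on their overlap, as both agree with `φ` at a point of it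
        obtain ⟨w, hw1, hw2, hw3⟩ := exists_mem_ball_inter_ball_inter_ball hR hsx.le hx.le hs2 hs
        have hopen : IsOpen (ball (p s) δ ∩ ball (p t) δ) := isOpen_ball.inter isOpen_ball
        refine uniq _ _ _ w hopen ((convex_ball _ _).inter (convex_ball _ _)) ⟨hw1, hw2⟩
          (mono _ _ _ (hψ _ hsx).1 inter_subset_left hopen)
          (mono _ _ _ (hψ _ hx).1 inter_subset_right hopen) ?_ ⟨hs2, hs⟩
        exact ((hψ _ hsx).2 ⟨hw1, hw3⟩).trans ((hψ _ hx).2 ⟨hw2, hw3⟩).symm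

/-- Monodromy over a finite-dimensional vector space. Let `S U φ` stand for a notion "`φ` is a
section over `U`" that is local and satisfies unique continuation on convex open sets. If every
point has a ball to all of which each section given at some point of it continues, then a section
defined near `0` continues to the whole space. -/
theorem exists_section_univ
    (mono : ∀ U W φ, S U φ → W ⊆ U → IsOpen W → S W φ)
    (glue : ∀ U φ, IsOpen U →
      (∀ t ∈ U, ∃ W ψ, IsOpen W ∧ t ∈ W ∧ S W ψ ∧ EqOn φ ψ W) → S U φ)
    (uniq : ∀ U φ ψ t, IsOpen U → Convex ℝ U → t ∈ U → S U φ → S U ψ → φ t = ψ t → EqOn φ ψ U)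
    (ext : ∀ t₀, ∃ r > 0, ∀ t ∈ ball t₀ r, ∀ W φ, S W φ → t ∈ W →
      ∃ ψ, S (ball t₀ r) ψ ∧ ψ t = φ t)
    {r₀ : ℝ} (hr₀ : 0 < r₀) {φ₀ : E → P} (hφ₀ : S (ball 0 r₀) φ₀) :
    ∃ φ, S univ φ := by
  classical
  -- the radii of the balls to which the given section continues; the continuations agree with each
  -- other, and the supremum of the radii would be in the set if it were finite
  let A : Set ℝ := {R | 0 < R ∧ ∃ φ, S (ball 0 R) φ ∧ φ 0 = φ₀ 0}
  have hA0 : r₀ ∈ A := ⟨hr₀, φ₀, hφ₀, rfl⟩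
  have hsec : ∀ R, ∃ φ, R ∈ A → S (ball 0 R) φ ∧ φ 0 = φ₀ 0 := fun R => by
    by_cases hR : R ∈ A
    · exact ⟨hR.2.choose, fun _ => hR.2.choose_spec⟩
    · exact ⟨φ₀, fun h => absurd h hR⟩
  choose Φ hΦ using hsec
  have hagree : ∀ R ∈ A, ∀ R' ∈ A, ∀ t, ‖t‖ < R → ‖t‖ < R' → Φ R t = Φ R' t := by
    intro R hR R' hR' t ht ht'
    have h := uniq (ball 0 (min R R')) (Φ R) (Φ R') 0 isOpen_ball (convex_ball _ _)
      (mem_ball_self (lt_min hR.1 hR'.1))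
      (mono _ _ _ (hΦ R hR).1 (ball_subset_ball (min_le_left _ _)) isOpen_ball)
      (mono _ _ _ (hΦ R' hR').1 (ball_subset_ball (min_le_right _ _)) isOpen_ball)
      ((hΦ R hR).2.trans (hΦ R' hR').2.symm)
    exact h (by simpa using ⟨ht, ht'⟩)
  have hrad : ∀ t : E, ∃ R, (∃ R' ∈ A, ‖t‖ < R') → R ∈ A ∧ ‖t‖ < R := fun t => by
    by_cases h : ∃ R' ∈ A, ‖t‖ < R'
    · exact ⟨h.choose, fun _ => h.choose_spec⟩
    · exact ⟨0, fun h' => absurd h' h⟩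
  choose ρ hρ using hrad
  let φ : E → P := fun t => Φ (ρ t) t
  have hφ : ∀ R ∈ A, EqOn φ (Φ R) (ball 0 R) := fun R hR t ht => by
    have ht' : ‖t‖ < R := by simpa using ht
    have h := hρ t ⟨R, hR, ht'⟩
    exact hagree _ h.1 R hR t h.2 ht'
  have hglue : ∀ U : Set E, IsOpen U → (∀ t ∈ U, ∃ R ∈ A, ‖t‖ < R) → S U φ :=
    fun U hU h => glue U φ hU fun t ht => by
      obtain ⟨R, hR, htR⟩ := h t ht
      exact ⟨ball 0 R, Φ R, isOpen_ball, by simpa using htR, (hΦ R hR).1, hφ R hR⟩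
  by_cases hbdd : BddAbove A
  · exfalso
    set R := sSup A
    have hR : 0 < R := hr₀.trans_le (le_csSup hbdd hA0)
    have hS : S (ball 0 R) φ := hglue _ isOpen_ball fun t ht => by
      have ht' : ‖t‖ < R := by simpa using ht
      exact exists_lt_of_lt_csSup ⟨r₀, hA0⟩ ht'
    obtain ⟨R', hR', φ', hφ', he⟩ := exists_section_larger_ball mono glue uniq ext hR hS
    have hmem : R' ∈ A := by
      refine ⟨hR.trans hR', φ', hφ', ?_⟩
      rw [he (mem_ball_self hR), hφ r₀ hA0 (mem_ball_self hr₀), (hΦ r₀ hA0).2]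
    exact absurd (le_csSup hbdd hmem) (not_le.2 hR')
  · refine ⟨φ, hglue univ isOpen_univ fun t _ => ?_⟩
    rw [not_bddAbove_iff] at hbdd
    exact hbdd ‖t‖

end Gluing

/-! ### Immersions and submersions -/

section ImmersionSubmersion

open Set Manifold

variable {E : Type*} [NormedAddCommGroup E] [NormedSpace ℝ E]
  {M : Type*} [TopologicalSpace M] [ChartedSpace E M]
  {E' : Type*} [NormedAddCommGroup E'] [NormedSpace ℝ E'] {H' : Type*} [TopologicalSpace H']
  {J : ModelWithCorners ℝ E' H'}
  {M' : Type*} [TopologicalSpace M'] [ChartedSpace H' M']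

/-- An immersion has, locally, a smooth left inverse. -/
lemma Manifold.IsImmersionAt.exists_leftInverse [IsManifold 𝓘(ℝ, E) ∞ M] [IsManifold J ∞ M']
    {f : M → M'} {x : M} (h : IsImmersionAt 𝓘(ℝ, E) J ∞ f x) :
    ∃ (U : Set M') (r : M' → M), IsOpen U ∧ f x ∈ U ∧ ContMDiffOn J 𝓘(ℝ, E) ∞ r U ∧
      ∀ᶠ y in 𝓝 x, r (f y) = y := by
  let g : M' → E := fun z => (h.equiv.symm (h.codChart.extend J z)).1
  have hg : ContMDiffOn J 𝓘(ℝ, E) ∞ g h.codChart.source := by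
    have h1 : ContMDiffOn J 𝓘(ℝ, E') ∞ (h.codChart.extend J) h.codChart.source :=
      h.codChart.contMDiffOn_extend h.codChart_mem_maximalAtlas
    have h2 : ContMDiff 𝓘(ℝ, E') 𝓘(ℝ, E) ∞
        (fun z : E' => (h.equiv.symm z).1) :=
      (contDiff_fst.comp h.equiv.symm.contDiff).contMDiff
    exact h2.comp_contMDiffOn h1
  have hgf : ∀ y ∈ h.domChart.source, g (f y) = h.domChart y := fun y hy => by
    have hy' : h.domChart y ∈ (h.domChart.extend 𝓘(ℝ, E)).target := by
      simpa using h.domChart.map_source hy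
    have := h.writtenInCharts hy'
    simp only [Function.comp_apply] at this
    have e : (h.domChart.extend 𝓘(ℝ, E)).symm (h.domChart y) = y := by
      simpa using h.domChart.left_inv hy
    rw [e] at this
    simp only [g]
    rw [this, ContinuousLinearEquiv.symm_apply_apply]
  have hopen : IsOpen (h.codChart.source ∩ g ⁻¹' h.domChart.target) :=
    hg.continuousOn.isOpen_inter_preimage h.codChart.open_source h.domChart.open_target
  refine ⟨h.codChart.source ∩ g ⁻¹' h.domChart.target, fun z => h.domChart.symm (g z), hopen,
    ⟨h.mem_codChart_source, ?_⟩, ?_, ?_⟩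
  · rw [mem_preimage, hgf x h.mem_domChart_source]
    exact h.domChart.map_source h.mem_domChart_source
  · exact (contMDiffOn_symm_of_mem_maximalAtlas h.domChart_mem_maximalAtlas).comp
      (hg.mono inter_subset_left) fun z hz => hz.2
  · filter_upwards [h.domChart.open_source.mem_nhds h.mem_domChart_source] with y hy
    rw [hgf y hy, h.domChart.left_inv hy]

lemma Manifold.IsImmersionAt.mfderiv_injective [IsManifold 𝓘(ℝ, E) ∞ M] [IsManifold J ∞ M']
    {f : M → M'} {x : M} (h : IsImmersionAt 𝓘(ℝ, E) J ∞ f x) :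
    Function.Injective (mfderiv 𝓘(ℝ, E) J f x) := by
  obtain ⟨U, r, hU, hxU, hr, hrf⟩ := h.exists_leftInverse
  have h1 : MDifferentiableAt J 𝓘(ℝ, E) r (f x) :=
    (hr.contMDiffAt (hU.mem_nhds hxU)).mdifferentiableAt (by simp)
  have h2 : MDifferentiableAt 𝓘(ℝ, E) J f x := h.contMDiffAt.mdifferentiableAt (by simp)
  have h3 := mfderiv_comp x h1 h2
  have h4 : mfderiv 𝓘(ℝ, E) 𝓘(ℝ, E) (r ∘ f) x = mfderiv 𝓘(ℝ, E) 𝓘(ℝ, E) id x :=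
    Filter.EventuallyEq.mfderiv_eq hrf
  intro v w hvw
  have h5 : ∀ u : TangentSpace 𝓘(ℝ, E) x, mfderiv J 𝓘(ℝ, E) r (f x) (mfderiv 𝓘(ℝ, E) J f x u) =
      mfderiv 𝓘(ℝ, E) 𝓘(ℝ, E) id x u := fun u => by
    rw [← h4, h3]; rfl
  have h6 := (h5 v).symm.trans ((congrArg _ hvw).trans (h5 w))
  rw [mfderiv_id] at h6
  exact h6

/-- A vector field that an immersion maps to a smooth vector field is smooth. -/
lemma Manifold.IsImmersion.contMDiff_of_related [IsManifold 𝓘(ℝ, E) ∞ M] [IsManifold J ∞ M']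
    {f : M → M'} (hf : IsImmersion 𝓘(ℝ, E) J ∞ f) {V : ∀ x : M, TangentSpace 𝓘(ℝ, E) x}
    {W : ∀ y : M', TangentSpace J y}
    (hW : ContMDiff J J.tangent ∞ (fun y => (⟨y, W y⟩ : TangentBundle J M')))
    (hVW : ∀ x, mfderiv 𝓘(ℝ, E) J f x (V x) = W (f x)) :
    IsSmoothVectorField V := by
  intro x
  have hx := hf.isImmersionAt x
  obtain ⟨U, r, hU, hxU, hr, hrf⟩ := hx.exists_leftInverse
  have hT := hr.contMDiffOn_tangentMapWithin (m := ∞) (by simp) hU.uniqueMDiffOn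
  have hfc : ContMDiff 𝓘(ℝ, E) J ∞ f := hf.contMDiff
  have hfU : f ⁻¹' U ∈ 𝓝 x := hfc.continuous.continuousAt (hU.mem_nhds hxU)
  have h1 : ContMDiffAt 𝓘(ℝ, E) 𝓘(ℝ, E).tangent ∞
      (fun y => tangentMapWithin J 𝓘(ℝ, E) r U (⟨f y, W (f y)⟩ : TangentBundle J M')) x := by
    have h2 : ContMDiffAt 𝓘(ℝ, E) J.tangent ∞
        (fun y => (⟨f y, W (f y)⟩ : TangentBundle J M')) x := (hW.comp hfc) x
    exact (hT.contMDiffAt ((hU.preimage (FiberBundle.continuous_proj _ _)).mem_nhds hxU)).comp x h2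
  refine h1.congr_of_eventuallyEq ?_
  filter_upwards [hrf.eventually_nhds, hfU] with y hy hyU
  have hry : r (f y) = y := hy.self_of_nhds
  have h3 : mfderivWithin J 𝓘(ℝ, E) r U (f y) = mfderiv J 𝓘(ℝ, E) r (f y) :=
    mfderivWithin_of_isOpen hU hyU
  have h4 : mfderiv 𝓘(ℝ, E) 𝓘(ℝ, E) (r ∘ f) y = mfderiv 𝓘(ℝ, E) 𝓘(ℝ, E) id y :=
    Filter.EventuallyEq.mfderiv_eq hy
  have h5 := mfderiv_comp y ((hr.contMDiffAt (hU.mem_nhds hyU)).mdifferentiableAt (by simp))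
    (hfc.mdifferentiable (by simp) y)
  rw [h4, mfderiv_id] at h5
  have h6 : mfderiv J 𝓘(ℝ, E) r (f y) (W (f y)) = V y := by
    rw [← hVW y]
    exact (DFunLike.congr_fun h5 (V y)).symm
  simp only [tangentMapWithin]
  rw [h3, h6]
  exact congrArg (fun z : M => (⟨z, (V y : E)⟩ : TangentBundle 𝓘(ℝ, E) M)) hry.symm

variable {E'' : Type*} [NormedAddCommGroup E''] [NormedSpace ℝ E'']
  {Q : Type*} [TopologicalSpace Q] [ChartedSpace E'' Q]

/-- A submersion has a smooth local section through each point. -/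
lemma Manifold.IsSubmersionAt.exists_localSection [IsManifold 𝓘(ℝ, E) ∞ M]
    [IsManifold 𝓘(ℝ, E'') ∞ Q] {f : M → Q} {x : M}
    (h : IsSubmersionAt 𝓘(ℝ, E) 𝓘(ℝ, E'') ∞ f x) :
    ∃ s : Q → M, s (f x) = x ∧ ContMDiffAt 𝓘(ℝ, E'') 𝓘(ℝ, E) ∞ s (f x) ∧
      ∀ᶠ q in 𝓝 (f x), f (s q) = q := by
  let c := (h.equiv (h.domChart x)).2
  let g : Q → E := fun q => h.equiv.symm (h.codChart q, c)
  have hw : ∀ z ∈ h.domChart.target, h.codChart (f (h.domChart.symm z)) = (h.equiv z).1 := by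
    intro z hz
    have hz' : z ∈ (h.domChart.extend 𝓘(ℝ, E)).target := by simpa using hz
    have := h.writtenInCharts hz'
    simpa using this
  have hfx : h.codChart (f x) = (h.equiv (h.domChart x)).1 := by
    have := hw (h.domChart x) (h.domChart.map_source h.mem_domChart_source)
    rwa [h.domChart.left_inv h.mem_domChart_source] at this
  have hgx : g (f x) = h.domChart x := by
    simp only [g, hfx, c]
    exact h.equiv.symm_apply_apply _
  have hg : ContMDiffAt 𝓘(ℝ, E'') 𝓘(ℝ, E) ∞ g (f x) := by
    have h1 := contMDiffAt_of_mem_maximalAtlas h.codChart_mem_maximalAtlas h.mem_codChart_source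
    have h2 : ContMDiff 𝓘(ℝ, E'') 𝓘(ℝ, E) ∞ (fun z : E'' => h.equiv.symm (z, c)) :=
      (h.equiv.symm.contDiff.comp (contDiff_id.prodMk contDiff_const)).contMDiff
    exact (h2 _).comp _ h1
  have ht : g (f x) ∈ h.domChart.target := by
    rw [hgx]; exact h.domChart.map_source h.mem_domChart_source
  refine ⟨fun q => h.domChart.symm (g q), ?_, ?_, ?_⟩
  · simp only [hgx]
    exact h.domChart.left_inv h.mem_domChart_source
  · exact (contMDiffAt_symm_of_mem_maximalAtlas h.domChart_mem_maximalAtlas ht).comp _ hg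
  · filter_upwards [hg.continuousAt (h.domChart.open_target.mem_nhds ht),
      h.codChart.open_source.mem_nhds h.mem_codChart_source] with q hq hq'
    have h1 := hw _ hq
    have h2 : (h.equiv (g q)).1 = h.codChart q := by simp [g]
    rw [h2] at h1
    exact h.codChart.injOn (h.source_subset_preimage_source (h.domChart.map_target hq)) hq' h1

/-- A vector field to which a smooth vector field projects under a surjective submersion is
smooth. -/
lemma Manifold.IsSubmersion.contMDiff_of_related [IsManifold 𝓘(ℝ, E) ∞ M]
    [IsManifold 𝓘(ℝ, E'') ∞ Q] {f : M → Q} (hf : IsSubmersion 𝓘(ℝ, E) 𝓘(ℝ, E'') ∞ f)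
    (hsurj : Function.Surjective f)
    {V : ∀ x : M, TangentSpace 𝓘(ℝ, E) x} {W : ∀ y : Q, TangentSpace 𝓘(ℝ, E'') y}
    (hV : IsSmoothVectorField V)
    (hVW : ∀ x, mfderiv 𝓘(ℝ, E) 𝓘(ℝ, E'') f x (V x) = W (f x)) :
    IsSmoothVectorField W := by
  intro q
  obtain ⟨x, rfl⟩ := hsurj q
  obtain ⟨s, hsx, hs, hfs⟩ := (hf.isSubmersionAt x).exists_localSection
  have hT := hf.contMDiff.contMDiff_tangentMap (m := ∞) (by simp)
  have h1 := (hT.comp hV).contMDiffAt (x := s (f x)) |>.comp _ hs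
  refine h1.congr_of_eventuallyEq ?_
  filter_upwards [hfs] with q hq
  simp only [Function.comp_apply, tangentMap]
  rw [hVW, hq]

end ImmersionSubmersion

/-! ### Integral sections -/

section IntegralSections

open Set Manifold Metric

variable {k : ℕ} {E : Type*} [NormedAddCommGroup E] [NormedSpace ℝ E]
  {M : Type*} [TopologicalSpace M] [ChartedSpace E M]

lemma EuclideanSpace.sum_smul_single (v : EuclideanSpace ℝ (Fin k)) :
    ∑ a, v a • EuclideanSpace.single a (1 : ℝ) = v := by
  simpa using (EuclideanSpace.basisFun (Fin k) ℝ).sum_repr v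

/-- The vector field `∑ₐ vᵃ Yₐ`. -/
noncomputable def KVectorField.comb (Y : KVectorField k E M) (v : EuclideanSpace ℝ (Fin k))
    (x : M) : TangentSpace 𝓘(ℝ, E) x :=
  ∑ a, v a • Y a x

lemma KVectorField.isSmoothVectorField_comb [IsManifold 𝓘(ℝ, E) ∞ M] {Y : KVectorField k E M}
    (hY : ∀ a, IsSmoothVectorField (Y a)) (v : EuclideanSpace ℝ (Fin k)) :
    IsSmoothVectorField (Y.comb v) := by
  have h : ∀ a ∈ Finset.univ, IsSmoothVectorField (fun x : M => (v a • Y a x)) :=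
    fun a _ => (hY a).const_smul_section
  exact ContMDiff.sum_section h

lemma IsIntegralSectionOn.mono {Y : KVectorField k E M} {φ : EuclideanSpace ℝ (Fin k) → M}
    {U W : Set (EuclideanSpace ℝ (Fin k))} (h : IsIntegralSectionOn Y φ U) (hWU : W ⊆ U) :
    IsIntegralSectionOn Y φ W :=
  ⟨h.1.mono hWU, fun t ht => h.2 t (hWU ht)⟩

lemma IsIntegralSectionOn.mdifferentiableAt {Y : KVectorField k E M}
    {φ : EuclideanSpace ℝ (Fin k) → M} {U : Set (EuclideanSpace ℝ (Fin k))}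
    (h : IsIntegralSectionOn Y φ U) (hU : IsOpen U) {t : EuclideanSpace ℝ (Fin k)} (ht : t ∈ U) :
    MDifferentiableAt 𝓘(ℝ, EuclideanSpace ℝ (Fin k)) 𝓘(ℝ, E) φ t :=
  (h.1.contMDiffAt (hU.mem_nhds ht)).mdifferentiableAt (by simp)

lemma isIntegralSectionOn_of_locally {Y : KVectorField k E M} {φ : EuclideanSpace ℝ (Fin k) → M}
    {U : Set (EuclideanSpace ℝ (Fin k))}
    (h : ∀ t ∈ U, ∃ (W : Set (EuclideanSpace ℝ (Fin k))) (ψ : EuclideanSpace ℝ (Fin k) → M),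
      IsOpen W ∧ t ∈ W ∧ IsIntegralSectionOn Y ψ W ∧ EqOn φ ψ W) :
    IsIntegralSectionOn Y φ U := by
  refine ⟨fun t ht => ?_, fun t ht a => ?_⟩
  · obtain ⟨W, ψ, hW, htW, hψ, he⟩ := h t ht
    exact ((hψ.1.contMDiffAt (hW.mem_nhds htW)).congr_of_eventuallyEq
      (he.eventuallyEq_of_mem (hW.mem_nhds htW))).contMDiffWithinAt
  · obtain ⟨W, ψ, hW, htW, hψ, he⟩ := h t ht
    have h1 := hψ.2 t htW a
    have h2 : (partialAt E φ t a : E) = partialAt E ψ t a := by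
      have h4 : (mfderiv 𝓘(ℝ, EuclideanSpace ℝ (Fin k)) 𝓘(ℝ, E) φ t :
          EuclideanSpace ℝ (Fin k) →L[ℝ] E) =
          mfderiv 𝓘(ℝ, EuclideanSpace ℝ (Fin k)) 𝓘(ℝ, E) ψ t :=
        (he.eventuallyEq_of_mem (hW.mem_nhds htW)).mfderiv_eq
      exact DFunLike.congr_fun h4 _
    have h3 : (Y a (φ t) : E) = Y a (ψ t) := by rw [he htW]
    exact h2.trans (h1.trans h3.symm)

lemma IsIntegralSectionOn.mfderiv_apply {Y : KVectorField k E M}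
    {φ : EuclideanSpace ℝ (Fin k) → M} {U : Set (EuclideanSpace ℝ (Fin k))}
    (h : IsIntegralSectionOn Y φ U) {t : EuclideanSpace ℝ (Fin k)} (ht : t ∈ U)
    (v : EuclideanSpace ℝ (Fin k)) :
    mfderiv 𝓘(ℝ, EuclideanSpace ℝ (Fin k)) 𝓘(ℝ, E) φ t v = Y.comb v (φ t) := by
  let L : EuclideanSpace ℝ (Fin k) →L[ℝ] E :=
    mfderiv 𝓘(ℝ, EuclideanSpace ℝ (Fin k)) 𝓘(ℝ, E) φ t
  have h1 : L v = ∑ a, v a • L (EuclideanSpace.single a (1 : ℝ)) := by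
    conv_lhs => rw [← EuclideanSpace.sum_smul_single v]
    rw [map_sum]
    simp only [map_smul]
  refine h1.trans (Finset.sum_congr rfl fun a _ => ?_)
  exact congrArg (fun w : E => v a • w) (h.2 t ht a)

/-- An integral section, restricted to a line, is an integral curve. -/
lemma IsIntegralSectionOn.isMIntegralCurveOn_line {Y : KVectorField k E M}
    {φ : EuclideanSpace ℝ (Fin k) → M} {U : Set (EuclideanSpace ℝ (Fin k))}
    (h : IsIntegralSectionOn Y φ U) (hU : IsOpen U) (t v : EuclideanSpace ℝ (Fin k)) :
    IsMIntegralCurveOn (I := 𝓘(ℝ, E)) (fun s : ℝ => φ (t + s • v)) (Y.comb v)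
      {s | t + s • v ∈ U} := by
  intro s hs
  have h1 : HasMFDerivAt 𝓘(ℝ, ℝ) 𝓘(ℝ, EuclideanSpace ℝ (Fin k)) (fun s : ℝ => t + s • v) s
      ((1 : ℝ →L[ℝ] ℝ).smulRight v) := by
    have h0 : HasDerivAt (fun s : ℝ => t + s • v) ((1 : ℝ) • v) s :=
      ((hasDerivAt_id s).smul_const v).const_add t
    refine h0.hasFDerivAt.hasMFDerivAt.congr_mfderiv ?_
    refine ContinuousLinearMap.ext fun c : ℝ => ?_
    change c • ((1 : ℝ) • v) = c • v
    rw [one_smul]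
  have h2 := (h.mdifferentiableAt hU hs).hasMFDerivAt.comp s h1
  refine HasMFDerivAt.hasMFDerivWithinAt ?_
  refine h2.congr_mfderiv ?_
  refine ContinuousLinearMap.ext fun c : ℝ => ?_
  let L : EuclideanSpace ℝ (Fin k) →L[ℝ] E :=
    mfderiv 𝓘(ℝ, EuclideanSpace ℝ (Fin k)) 𝓘(ℝ, E) φ (t + s • v)
  have h3 : L (c • v) = c • L v := L.map_smul c v
  exact h3.trans (congrArg (fun w : E => c • w) (h.mfderiv_apply hs v))

/-- The segment between two points of a convex open set can be prolonged a little at both ends. -/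
lemma exists_Ioo_subset_preimage_of_convex {F : Type*} [NormedAddCommGroup F] [NormedSpace ℝ F]
    {U : Set F} (hU : IsOpen U)
    (hconv : Convex ℝ U) {t t' : F} (ht : t ∈ U) (ht' : t' ∈ U) :
    ∃ δ > (0 : ℝ), ∀ s ∈ Ioo (-δ) (1 + δ), t + s • (t' - t) ∈ U := by
  have hc : Continuous fun s : ℝ => t + s • (t' - t) := by fun_prop
  have hV : IsOpen {s : ℝ | t + s • (t' - t) ∈ U} := hU.preimage hc
  have hVc : Convex ℝ {s : ℝ | t + s • (t' - t) ∈ U} := by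
    have : {s : ℝ | t + s • (t' - t) ∈ U} = AffineMap.lineMap t t' ⁻¹' U := by
      ext s
      simp [AffineMap.lineMap_apply, add_comm]
    rw [this]
    exact hconv.affine_preimage _
  obtain ⟨δ₀, hδ₀, h0⟩ := Metric.isOpen_iff.1 hV 0 (by simpa using ht)
  obtain ⟨δ₁, hδ₁, h1⟩ := Metric.isOpen_iff.1 hV 1 (by simpa using ht')
  refine ⟨min δ₀ δ₁ / 2, by positivity, fun s hs => ?_⟩
  have hm0 : min δ₀ δ₁ / 2 < δ₀ := by
    have := min_le_left δ₀ δ₁; linarith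
  have hm1 : min δ₀ δ₁ / 2 < δ₁ := by
    have := min_le_right δ₀ δ₁; linarith
  have hm : 0 < min δ₀ δ₁ / 2 := by positivity
  have ha : -(min δ₀ δ₁ / 2) ∈ {s : ℝ | t + s • (t' - t) ∈ U} :=
    h0 (by rw [Real.ball_eq_Ioo]; constructor <;> linarith)
  have hb : 1 + (min δ₀ δ₁ / 2) ∈ {s : ℝ | t + s • (t' - t) ∈ U} :=
    h1 (by rw [Real.ball_eq_Ioo]; constructor <;> linarith)
  exact hVc.ordConnected.out ha hb ⟨hs.1.le, hs.2.le⟩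

/-- Integral sections of a smooth `k`-vector field over a convex open set are determined by their
value at one point. -/
lemma IsIntegralSectionOn.eqOn_of_convex [CompleteSpace E] [IsManifold 𝓘(ℝ, E) ∞ M] [T2Space M]
    {Y : KVectorField k E M} (hY : ∀ a, IsSmoothVectorField (Y a))
    {φ ψ : EuclideanSpace ℝ (Fin k) → M} {U : Set (EuclideanSpace ℝ (Fin k))}
    (hφ : IsIntegralSectionOn Y φ U) (hψ : IsIntegralSectionOn Y ψ U) (hU : IsOpen U)
    (hconv : Convex ℝ U) {t : EuclideanSpace ℝ (Fin k)} (ht : t ∈ U) (h : φ t = ψ t) :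
    EqOn φ ψ U := by
  intro t' ht'
  obtain ⟨δ, hδ, hsub⟩ := exists_Ioo_subset_preimage_of_convex hU hconv ht ht'
  have : IsManifold 𝓘(ℝ, E) 1 M := .of_le (n := ∞) (by simp)
  have := isMIntegralCurveOn_Ioo_eqOn_of_contMDiff_boundaryless (t₀ := 0) (a := -δ) (b := 1 + δ)
    (by constructor <;> linarith)
    ((KVectorField.isSmoothVectorField_comb hY (t' - t)).of_le (by simp))
    ((hφ.isMIntegralCurveOn_line hU t (t' - t)).mono hsub)
    ((hψ.isMIntegralCurveOn_line hU t (t' - t)).mono hsub) (by simpa using h)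
  have h1 := this (x := 1) (by constructor <;> linarith)
  simpa using h1

/-- Related `k`-vector fields: integral sections are mapped to integral sections. -/
lemma IsIntegralSectionOn.comp_of_related {E'' : Type*} [NormedAddCommGroup E'']
    [NormedSpace ℝ E''] {Q : Type*} [TopologicalSpace Q] [ChartedSpace E'' Q]
    {Y : KVectorField k E M} {Z : KVectorField k E'' Q} {f : M → Q}
    (hf : ContMDiff 𝓘(ℝ, E) 𝓘(ℝ, E'') ∞ f)
    (hYZ : ∀ a x, mfderiv 𝓘(ℝ, E) 𝓘(ℝ, E'') f x (Y a x) = Z a (f x))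
    {φ : EuclideanSpace ℝ (Fin k) → M} {U : Set (EuclideanSpace ℝ (Fin k))} (hU : IsOpen U)
    (hφ : IsIntegralSectionOn Y φ U) : IsIntegralSectionOn Z (fun t => f (φ t)) U := by
  refine ⟨hf.comp_contMDiffOn hφ.1, fun t ht a => ?_⟩
  have h1 := mfderiv_comp t (hf.mdifferentiable (by simp) (φ t)) (hφ.mdifferentiableAt hU ht)
  have h2 := DFunLike.congr_fun h1 (EuclideanSpace.single a (1 : ℝ))
  refine h2.trans ?_
  rw [← hYZ a (φ t), ← hφ.2 t ht a]
  rfl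

lemma IsIntegralSectionOn.comp_sub {Y : KVectorField k E M} {φ : EuclideanSpace ℝ (Fin k) → M}
    {U : Set (EuclideanSpace ℝ (Fin k))} (hU : IsOpen U) (hφ : IsIntegralSectionOn Y φ U)
    (t₀ : EuclideanSpace ℝ (Fin k)) :
    IsIntegralSectionOn Y (fun t => φ (t - t₀)) {t | t - t₀ ∈ U} := by
  have hc : ContMDiff 𝓘(ℝ, EuclideanSpace ℝ (Fin k)) 𝓘(ℝ, EuclideanSpace ℝ (Fin k)) ∞
      (fun t : EuclideanSpace ℝ (Fin k) => t - t₀) :=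
    (contDiff_id.sub contDiff_const).contMDiff
  refine ⟨hφ.1.comp hc.contMDiffOn fun t ht => ht, fun t ht a => ?_⟩
  have h1 := mfderiv_comp t (hφ.mdifferentiableAt hU ht) (hc.mdifferentiable (by simp) t)
  have h2 := DFunLike.congr_fun h1 (EuclideanSpace.single a (1 : ℝ))
  have h3 : mfderiv 𝓘(ℝ, EuclideanSpace ℝ (Fin k)) 𝓘(ℝ, EuclideanSpace ℝ (Fin k))
      (fun t : EuclideanSpace ℝ (Fin k) => t - t₀) t (EuclideanSpace.single a (1 : ℝ)) =
      EuclideanSpace.single a (1 : ℝ) := by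
    rw [mfderiv_eq_fderiv]
    have : HasFDerivAt (fun t : EuclideanSpace ℝ (Fin k) => t - t₀)
      (ContinuousLinearMap.id ℝ _) t := (hasFDerivAt_id t).sub_const t₀
    rw [this.fderiv]
    rfl
  refine h2.trans ?_
  rw [← hφ.2 _ ht a]
  exact congrArg (mfderiv 𝓘(ℝ, EuclideanSpace ℝ (Fin k)) 𝓘(ℝ, E) φ (t - t₀)) h3

/-- If every point of `ℝᵏ` has a ball over which there are integral sections of a smooth
`k`-vector field `Y` that lift `φ̄` and take a prescribed value at a given point, then `φ̄` lifts to
a global integral section of `Y`. -/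
theorem exists_integralSection_lift [CompleteSpace E] [IsManifold 𝓘(ℝ, E) ∞ M] [T2Space M]
    {Y : KVectorField k E M} (hY : ∀ a, IsSmoothVectorField (Y a)) {Q : Type*} {f : M → Q}
    {φbar : EuclideanSpace ℝ (Fin k) → Q} (hne : ∃ p, f p = φbar 0)
    (hloc : ∀ t₀, ∃ r > 0, ∀ t ∈ ball t₀ r, ∀ p, f p = φbar t →
      ∃ ψ, IsIntegralSectionOn Y ψ (ball t₀ r) ∧ (∀ s ∈ ball t₀ r, f (ψ s) = φbar s) ∧ ψ t = p) :
    ∃ φ, IsIntegralSection Y φ ∧ ∀ t, f (φ t) = φbar t := by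
  obtain ⟨p, hp⟩ := hne
  obtain ⟨r₀, hr₀, h₀⟩ := hloc 0
  obtain ⟨ψ₀, hψ₀, hψ₀f, -⟩ := h₀ 0 (mem_ball_self hr₀) p hp
  obtain ⟨φ, hφ, hφf⟩ := exists_section_univ
    (S := fun U φ => IsIntegralSectionOn Y φ U ∧ ∀ s ∈ U, f (φ s) = φbar s)
    (fun U W φ hφ hWU _ => ⟨hφ.1.mono hWU, fun s hs => hφ.2 s (hWU hs)⟩)
    (fun U φ hU h => ⟨isIntegralSectionOn_of_locally fun t ht => by
        obtain ⟨W, ψ, hW, htW, hψ, he⟩ := h t ht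
        exact ⟨W, ψ, hW, htW, hψ.1, he⟩, fun t ht => by
        obtain ⟨W, ψ, hW, htW, hψ, he⟩ := h t ht
        rw [he htW]
        exact hψ.2 t htW⟩)
    (fun U φ ψ t hU hconv ht hφ hψ h => hφ.1.eqOn_of_convex hY hψ.1 hU hconv ht h)
    (fun t₀ => by
      obtain ⟨r, hr, h⟩ := hloc t₀
      refine ⟨r, hr, fun t ht W φ hφ htW => ?_⟩
      obtain ⟨ψ, hψ, hψf, he⟩ := h t ht (φ t) (hφ.2 t htW)
      exact ⟨ψ, ⟨hψ, hψf⟩, he⟩)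
    hr₀ ⟨hψ₀, hψ₀f⟩
  exact ⟨φ, hφ, fun t => hφf t (mem_univ t)⟩

end IntegralSections

/-! ### Commuting vector fields -/

section Commuting

open Set Manifold Metric VectorField

variable {k : ℕ} {E : Type*} [NormedAddCommGroup E] [NormedSpace ℝ E]
  {M : Type*} [TopologicalSpace M] [ChartedSpace E M] [IsManifold 𝓘(ℝ, E) ∞ M]

lemma two_le_infty : (2 : WithTop ℕ∞) ≤ ∞ := by
  exact WithTop.coe_le_coe.2 (le_top : (2 : ℕ∞) ≤ ⊤)

/-- The vector field `V` read in the chart at `p`. -/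
noncomputable def vectorFieldInChart (p : M) (V : ∀ x : M, TangentSpace 𝓘(ℝ, E) x) (y : E) : E :=
  mpullback 𝓘(ℝ, E) 𝓘(ℝ, E) (extChartAt 𝓘(ℝ, E) p).symm V y

lemma contMDiffAt_extChartAt_symm_of_mem (p : M) {y : E}
    (hy : y ∈ (extChartAt 𝓘(ℝ, E) p).target) :
    ContMDiffAt 𝓘(ℝ, E) 𝓘(ℝ, E) ∞ (extChartAt 𝓘(ℝ, E) p).symm y :=
  (contMDiffOn_extChartAt_symm p).contMDiffAt ((isOpen_extChartAt_target p).mem_nhds hy)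

lemma isInvertible_mfderiv_extChartAt_symm_of_mem (p : M) {y : E}
    (hy : y ∈ (extChartAt 𝓘(ℝ, E) p).target) :
    (mfderiv 𝓘(ℝ, E) 𝓘(ℝ, E) (extChartAt 𝓘(ℝ, E) p).symm y).IsInvertible := by
  have := isInvertible_mfderivWithin_extChartAt_symm (I := 𝓘(ℝ, E)) hy
  rwa [modelWithCornersSelf_coe, range_id, mfderivWithin_univ] at this

lemma mfderiv_extChartAt_symm_vectorFieldInChart (p : M) (V : ∀ x : M, TangentSpace 𝓘(ℝ, E) x)
    {y : E} (hy : y ∈ (extChartAt 𝓘(ℝ, E) p).target) :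
    mfderiv 𝓘(ℝ, E) 𝓘(ℝ, E) (extChartAt 𝓘(ℝ, E) p).symm y (vectorFieldInChart (E := E) p V y) =
      V ((extChartAt 𝓘(ℝ, E) p).symm y) :=
  (isInvertible_mfderiv_extChartAt_symm_of_mem p hy).self_apply_inverse
    (V ((extChartAt 𝓘(ℝ, E) p).symm y))

variable [CompleteSpace E]

lemma contDiffAt_vectorFieldInChart (p : M) {V : ∀ x : M, TangentSpace 𝓘(ℝ, E) x}
    (hV : IsSmoothVectorField V) {y : E} (hy : y ∈ (extChartAt 𝓘(ℝ, E) p).target) :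
    ContDiffAt ℝ ∞ (vectorFieldInChart p V) y := by
  refine contMDiffAt_vectorSpace_iff_contDiffAt.1 ?_
  exact ContMDiffAt.mpullback_vectorField_preimage (hV _)
    (contMDiffAt_extChartAt_symm_of_mem p hy) (isInvertible_mfderiv_extChartAt_symm_of_mem p hy)
    (by simp)

lemma mfderiv_extChartAt_symm_lieBracket (p : M) {V W : ∀ x : M, TangentSpace 𝓘(ℝ, E) x}
    (hV : IsSmoothVectorField V) (hW : IsSmoothVectorField W) {y : E}
    (hy : y ∈ (extChartAt 𝓘(ℝ, E) p).target) :
    mfderiv 𝓘(ℝ, E) 𝓘(ℝ, E) (extChartAt 𝓘(ℝ, E) p).symm y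
        (lieBracket ℝ (E := E) (vectorFieldInChart p V) (vectorFieldInChart p W) y) =
      mlieBracket 𝓘(ℝ, E) V W ((extChartAt 𝓘(ℝ, E) p).symm y) := by
  have : IsManifold 𝓘(ℝ, E) (minSmoothness ℝ 2) M := by
    rw [minSmoothness_of_isRCLikeNormedField]
    exact .of_le two_le_infty
  have h := mpullback_mlieBracket (hV.mdifferentiable (by simp) _)
    (hW.mdifferentiable (by simp) _) (contMDiffAt_extChartAt_symm_of_mem p hy)
    (by rw [minSmoothness_of_isRCLikeNormedField]; exact two_le_infty)
  have h2 : lieBracket ℝ (vectorFieldInChart p V) (vectorFieldInChart p W) y =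
      mpullback 𝓘(ℝ, E) 𝓘(ℝ, E) (extChartAt 𝓘(ℝ, E) p).symm (mlieBracket 𝓘(ℝ, E) V W) y := by
    refine Eq.trans ?_ h.symm
    rw [← mlieBracketWithin_univ, mlieBracketWithin_eq_lieBracketWithin]
    exact (congrFun lieBracketWithin_univ y).symm
  rw [h2]
  exact (isInvertible_mfderiv_extChartAt_symm_of_mem p hy).self_apply_inverse
    (mlieBracket 𝓘(ℝ, E) V W ((extChartAt 𝓘(ℝ, E) p).symm y))

/-- If the derivatives of `f` along two vector fields are constant, then the derivative of `f`
along their Lie bracket vanishes. -/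
lemma mfderiv_mlieBracket_eq_zero {F : Type*} [NormedAddCommGroup F] [NormedSpace ℝ F]
    {f : M → F} (hf : ContMDiff 𝓘(ℝ, E) 𝓘(ℝ, F) ∞ f) {V W : ∀ x : M, TangentSpace 𝓘(ℝ, E) x}
    (hV : IsSmoothVectorField V) (hW : IsSmoothVectorField W) {c d : F}
    (hfV : ∀ x, mfderiv 𝓘(ℝ, E) 𝓘(ℝ, F) f x (V x) = c)
    (hfW : ∀ x, mfderiv 𝓘(ℝ, E) 𝓘(ℝ, F) f x (W x) = d) (x : M) :
    mfderiv 𝓘(ℝ, E) 𝓘(ℝ, F) f x (mlieBracket 𝓘(ℝ, E) V W x) = 0 := by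
  set e := extChartAt 𝓘(ℝ, E) x
  have hy : e x ∈ e.target := mem_extChartAt_target x
  have hfe : ∀ y ∈ e.target, ContDiffAt ℝ ∞ (f ∘ e.symm) y := fun y hy => by
    rw [← contMDiffAt_iff_contDiffAt]
    exact (hf _).comp y (contMDiffAt_extChartAt_symm_of_mem x hy)
  -- derivatives along the fields in the chart
  have hchain : ∀ y ∈ e.target, ∀ v : E, fderiv ℝ (f ∘ e.symm) y v =
      mfderiv 𝓘(ℝ, E) 𝓘(ℝ, F) f (e.symm y) (mfderiv 𝓘(ℝ, E) 𝓘(ℝ, E) e.symm y v) := by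
    intro y hy v
    rw [← mfderiv_eq_fderiv, mfderiv_comp y (hf.mdifferentiable (by simp) _)
      ((contMDiffAt_extChartAt_symm_of_mem x hy).mdifferentiableAt (by simp))]
    rfl
  have hconst : ∀ (Z : ∀ x : M, TangentSpace 𝓘(ℝ, E) x) (c : F), IsSmoothVectorField Z →
      (∀ x, mfderiv 𝓘(ℝ, E) 𝓘(ℝ, F) f x (Z x) = c) → ∀ u : E,
      fderiv ℝ (fderiv ℝ (f ∘ e.symm)) (e x) u (vectorFieldInChart x Z (e x)) =
        -fderiv ℝ (f ∘ e.symm) (e x) (fderiv ℝ (vectorFieldInChart x Z) (e x) u) := by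
    intro Z c hZ hfZ u
    have h1 : (fun y => fderiv ℝ (f ∘ e.symm) y (vectorFieldInChart x Z y)) =ᶠ[𝓝 (e x)]
        fun _ => c := by
      filter_upwards [(isOpen_extChartAt_target x).mem_nhds hy] with y hy
      rw [hchain y hy, mfderiv_extChartAt_symm_vectorFieldInChart x Z hy]
      exact hfZ _
    have h2 := ((((hfe _ hy).fderiv_right (m := 1)
      (by rw [one_add_one_eq_two]; exact two_le_infty)).differentiableAt
      (by simp)).hasFDerivAt).clm_apply
      ((contDiffAt_vectorFieldInChart x hZ hy).differentiableAt (by simp)).hasFDerivAt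
    have h3 := h2.congr_of_eventuallyEq h1.symm
    have h4 := DFunLike.congr_fun (h3.unique (hasFDerivAt_const c (e x))) u
    simp only [add_apply, ContinuousLinearMap.coe_comp, Function.comp_apply,
      ContinuousLinearMap.flip_apply, zero_apply] at h4
    exact eq_neg_of_add_eq_zero_right h4
  have hsymm : IsSymmSndFDerivAt ℝ (f ∘ e.symm) (e x) :=
    (hfe _ hy).isSymmSndFDerivAt
      (by rw [minSmoothness_of_isRCLikeNormedField]; exact two_le_infty)
  have hb := mfderiv_extChartAt_symm_lieBracket x hV hW hy
  have hx : e.symm (e x) = x := extChartAt_to_inv x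
  have h0 := hchain _ hy (lieBracket ℝ (E := E) (vectorFieldInChart x V) (vectorFieldInChart x W) (e x))
  rw [hb] at h0
  have h5 : fderiv ℝ (f ∘ e.symm) (e x)
      (lieBracket ℝ (E := E) (vectorFieldInChart x V) (vectorFieldInChart x W) (e x)) = 0 := by
    rw [lieBracket_eq, map_sub]
    have hv := hconst V c hV hfV (vectorFieldInChart x W (e x))
    have hw := hconst W d hW hfW (vectorFieldInChart x V (e x))
    rw [hsymm.eq] at hv
    rw [hv] at hw
    exact sub_eq_zero.2 (neg_injective hw).symm
  rw [h5] at h0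
  rw [← hx]
  exact h0.symm

/-- The Frobenius theorem for commuting vector fields: they admit integral sections through
every point. -/
theorem exists_integralSectionOn_of_mlieBracket_eq_zero {Y : KVectorField k E M}
    (hY : ∀ a, IsSmoothVectorField (Y a))
    (hcomm : ∀ a b x, mlieBracket 𝓘(ℝ, E) (Y a) (Y b) x = 0) (p : M) :
    ∃ r > 0, ∃ σ : EuclideanSpace ℝ (Fin k) → M, σ 0 = p ∧
      IsIntegralSectionOn Y σ (ball 0 r) := by
  set e := extChartAt 𝓘(ℝ, E) p
  have hT : IsOpen e.target := isOpen_extChartAt_target p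
  let W : Fin k → E → E := fun a => vectorFieldInChart p (Y a)
  have hW : ∀ a, ∀ y ∈ e.target, ContDiffAt ℝ ∞ (W a) y := fun a y hy =>
    contDiffAt_vectorFieldInChart p (hY a) hy
  -- in the chart, an integral section is a solution of `Dσ = V ∘ σ`
  let V : E → EuclideanSpace ℝ (Fin k) →L[ℝ] E := fun y =>
    ∑ a, (EuclideanSpace.proj a : EuclideanSpace ℝ (Fin k) →L[ℝ] ℝ).smulRight (W a y)
  have hVapp : ∀ y v, V y v = ∑ a, v a • W a y := fun y v => by
    simp [V]
  have hV : ContDiffOn ℝ ∞ V e.target := fun y hy => by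
    refine ContDiffAt.contDiffWithinAt (ContDiffAt.sum fun a _ => ?_)
    exact ContDiffAt.continuousLinearMap_comp
      (ContinuousLinearMap.smulRightL ℝ (EuclideanSpace ℝ (Fin k)) E
        (EuclideanSpace.proj a : EuclideanSpace ℝ (Fin k) →L[ℝ] ℝ)) (hW a y hy)
  have hbr : ∀ a b, ∀ y ∈ e.target, fderiv ℝ (W b) y (W a y) = fderiv ℝ (W a) y (W b y) := by
    intro a b y hy
    have h := mfderiv_extChartAt_symm_lieBracket p (hY a) (hY b) hy
    rw [hcomm] at h
    have h0 : lieBracket ℝ (W a) (W b) y = 0 :=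
      (isInvertible_mfderiv_extChartAt_symm_of_mem p hy).injective (h.trans
        (mfderiv 𝓘(ℝ, E) 𝓘(ℝ, E) (extChartAt 𝓘(ℝ, E) p).symm y).map_zero.symm)
    rw [lieBracket_eq] at h0
    exact sub_eq_zero.1 h0
  have hfd : ∀ y ∈ e.target, ∀ w v, fderiv ℝ V y w v = ∑ b, v b • fderiv ℝ (W b) y w := by
    intro y hy w v
    have h1 : HasFDerivAt (fun y => V y v) ((fderiv ℝ V y).flip v) y := by
      have := (((hV y hy).contDiffAt (hT.mem_nhds hy)).differentiableAt
        (by simp)).hasFDerivAt.clm_apply (hasFDerivAt_const v y)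
      simpa using this
    have h2 : HasFDerivAt (fun y => V y v) (∑ b, v b • fderiv ℝ (W b) y) y := by
      simp only [hVapp]
      exact HasFDerivAt.fun_sum fun b _ =>
        (((hW b y hy).differentiableAt (by simp)).hasFDerivAt).const_smul (v b)
    have h3 := DFunLike.congr_fun (h1.unique h2) w
    simpa using h3
  have hsymm : ∀ y ∈ e.target, ∀ u v, fderiv ℝ V y (V y u) v = fderiv ℝ V y (V y v) u := by
    intro y hy u v
    rw [hfd y hy, hfd y hy, hVapp, hVapp]
    simp only [map_sum, map_smul, Finset.smul_sum]
    rw [Finset.sum_comm]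
    refine Finset.sum_congr rfl fun a _ => Finset.sum_congr rfl fun b _ => ?_
    rw [hbr a b y hy, smul_comm]
  obtain ⟨r, hr, σ, hσ0, hσ⟩ := exists_hasFDerivAt_eq_of_symm hT (mem_extChartAt_target p)
    (hV.of_le two_le_infty) hsymm
  have hσs : ContDiffOn ℝ ∞ σ (ball 0 r) := contDiffOn_of_hasFDerivAt_eq hV isOpen_ball hσ
  refine ⟨r, hr, fun t => e.symm (σ t), ?_, ?_, fun t ht a => ?_⟩
  · change e.symm (σ 0) = p
    rw [hσ0]
    exact extChartAt_to_inv p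
  · exact (contMDiffOn_extChartAt_symm p).comp hσs.contMDiffOn fun t ht => (hσ t ht).1
  · obtain ⟨htT, hd⟩ := hσ t ht
    have h1 := mfderiv_comp t ((contMDiffAt_extChartAt_symm_of_mem p htT).mdifferentiableAt
      (by simp)) hd.hasMFDerivAt.mdifferentiableAt
    have h2 := DFunLike.congr_fun h1 (EuclideanSpace.single a (1 : ℝ))
    refine h2.trans ?_
    rw [← mfderiv_extChartAt_symm_vectorFieldInChart p (Y a) htT]
    refine congrArg (mfderiv 𝓘(ℝ, E) 𝓘(ℝ, E) e.symm (σ t)) ?_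
    rw [hd.hasMFDerivAt.mfderiv]
    refine (hVapp (σ t) (EuclideanSpace.single a (1 : ℝ))).trans ?_
    simp [W, ite_smul]

end Commuting

/-! ### Invariant and reduced `k`-vector fields -/

section OrbitProj

variable {K : Type*} [Group K] {P : Type*} [MulAction K P]

lemma orbitProj_smul (g : K) (p : P) : orbitProj K (g • p) = orbitProj K p :=
  Quotient.sound ⟨g, rfl⟩

lemma exists_smul_eq_of_orbitProj_eq {p q : P} (h : orbitProj K p = orbitProj K q) :
    ∃ g : K, g • q = p :=
  Quotient.exact h

lemma orbitProj_out (q : MulAction.orbitRel.Quotient K P) : orbitProj K q.out = q :=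
  Quotient.out_eq q

lemma orbitProj_surjective : Function.Surjective (orbitProj K (P := P)) := fun q =>
  ⟨q.out, orbitProj_out q⟩

end OrbitProj

section Reduction

open Set Manifold Metric

variable {k : ℕ} {EK : Type*} [NormedAddCommGroup EK] [NormedSpace ℝ EK] {K : Type*}
  [TopologicalSpace K] [ChartedSpace EK K] [Group K]
  {EP : Type*} [NormedAddCommGroup EP] [NormedSpace ℝ EP] {P : Type*} [TopologicalSpace P]
  [ChartedSpace EP P] [MulAction K P]

lemma contMDiff_const_smul_of_contMDiff_smul
    (hact : ContMDiff (𝓘(ℝ, EK).prod 𝓘(ℝ, EP)) 𝓘(ℝ, EP) ∞ (fun q : K × P => q.1 • q.2)) (g : K) :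
    ContMDiff 𝓘(ℝ, EP) 𝓘(ℝ, EP) ∞ (fun p : P => g • p) :=
  hact.comp (contMDiff_const.prodMk contMDiff_id)

lemma contMDiff_smul_const_of_contMDiff_smul
    (hact : ContMDiff (𝓘(ℝ, EK).prod 𝓘(ℝ, EP)) 𝓘(ℝ, EP) ∞ (fun q : K × P => q.1 • q.2)) (p : P) :
    ContMDiff 𝓘(ℝ, EK) 𝓘(ℝ, EP) ∞ (fun g : K => g • p) :=
  hact.comp (contMDiff_id.prodMk contMDiff_const)

/-- The action permutes the integral sections of an invariant `k`-vector field. -/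
lemma IsIntegralSectionOn.smul
    (hact : ContMDiff (𝓘(ℝ, EK).prod 𝓘(ℝ, EP)) 𝓘(ℝ, EP) ∞ (fun q : K × P => q.1 • q.2))
    {Y : KVectorField k EP P} (hinv : ∀ (g : K) a p, tangentAct EP g p (Y a p) = Y a (g • p))
    {φ : EuclideanSpace ℝ (Fin k) → P} {U : Set (EuclideanSpace ℝ (Fin k))} (hU : IsOpen U)
    (hφ : IsIntegralSectionOn Y φ U) (g : K) : IsIntegralSectionOn Y (fun t => g • φ t) U :=
  hφ.comp_of_related (contMDiff_const_smul_of_contMDiff_smul hact g) (hinv g) hU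

variable {EQ : Type*} [NormedAddCommGroup EQ] [NormedSpace ℝ EQ]
  [ChartedSpace EQ (MulAction.orbitRel.Quotient K P)]

lemma mfderiv_orbitProj_tangentAct
    (hact : ContMDiff (𝓘(ℝ, EK).prod 𝓘(ℝ, EP)) 𝓘(ℝ, EP) ∞ (fun q : K × P => q.1 • q.2))
    (hπ : ContMDiff 𝓘(ℝ, EP) 𝓘(ℝ, EQ) ∞ (orbitProj K (P := P))) (g : K) (p : P)
    (v : TangentSpace 𝓘(ℝ, EP) p) :
    (mfderiv 𝓘(ℝ, EP) 𝓘(ℝ, EQ) (orbitProj K (P := P)) (g • p) (tangentAct EP g p v) : EQ) =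
      mfderiv 𝓘(ℝ, EP) 𝓘(ℝ, EQ) (orbitProj K (P := P)) p v := by
  have h1 := mfderiv_comp p (hπ.mdifferentiable (by simp) (g • p))
    ((contMDiff_const_smul_of_contMDiff_smul hact g).mdifferentiable (by simp) p)
  have h2 : (orbitProj K (P := P)) ∘ (fun p : P => g • p) = orbitProj K :=
    funext fun p => orbitProj_smul g p
  rw [h2] at h1
  exact (DFunLike.congr_fun h1 v).symm

/-- An invariant `k`-vector field projects onto its reduced `k`-vector field. -/
lemma mfderiv_orbitProj_apply
    (hact : ContMDiff (𝓘(ℝ, EK).prod 𝓘(ℝ, EP)) 𝓘(ℝ, EP) ∞ (fun q : K × P => q.1 • q.2))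
    (hπ : ContMDiff 𝓘(ℝ, EP) 𝓘(ℝ, EQ) ∞ (orbitProj K (P := P)))
    {Y : KVectorField k EP P} (hinv : ∀ (g : K) a p, tangentAct EP g p (Y a p) = Y a (g • p))
    (a : Fin k) (p : P) :
    mfderiv 𝓘(ℝ, EP) 𝓘(ℝ, EQ) (orbitProj K (P := P)) p (Y a p) =
      reducedKVF K EQ Y a (orbitProj K p) := by
  obtain ⟨g, hg⟩ := exists_smul_eq_of_orbitProj_eq (K := K) (p := p) (q := (orbitProj K p).out)
    (orbitProj_out _).symm
  have h := mfderiv_orbitProj_tangentAct hact hπ g (orbitProj K p).out (Y a (orbitProj K p).out)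
  rw [hinv] at h
  have h2 : ∀ p' : P, p' = p →
      (mfderiv 𝓘(ℝ, EP) 𝓘(ℝ, EQ) (orbitProj K (P := P)) p' (Y a p') : EQ) =
        mfderiv 𝓘(ℝ, EP) 𝓘(ℝ, EQ) (orbitProj K (P := P)) p (Y a p) := by
    rintro _ rfl
    rfl
  exact (h2 _ hg).symm.trans h

/-- Over a convex open set, an integral section lies over any integral section of the projected
`k`-vector field that its projection meets. -/
lemma IsIntegralSectionOn.proj_eq [CompleteSpace EQ] {Q : Type*} [TopologicalSpace Q]
    [ChartedSpace EQ Q] [IsManifold 𝓘(ℝ, EQ) ∞ Q] [T2Space Q]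
    {f : P → Q} (hf : ContMDiff 𝓘(ℝ, EP) 𝓘(ℝ, EQ) ∞ f) {Y : KVectorField k EP P}
    {Z : KVectorField k EQ Q} (hZ : ∀ a, IsSmoothVectorField (Z a))
    (hYZ : ∀ a x, mfderiv 𝓘(ℝ, EP) 𝓘(ℝ, EQ) f x (Y a x) = Z a (f x))
    {φbar : EuclideanSpace ℝ (Fin k) → Q} (hφbar : IsIntegralSection Z φbar)
    {ψ : EuclideanSpace ℝ (Fin k) → P} {U : Set (EuclideanSpace ℝ (Fin k))} (hU : IsOpen U)
    (hconv : Convex ℝ U) (hψ : IsIntegralSectionOn Y ψ U) {t₀ : EuclideanSpace ℝ (Fin k)}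
    (ht₀ : t₀ ∈ U) (h0 : f (ψ t₀) = φbar t₀) : ∀ t ∈ U, f (ψ t) = φbar t :=
  (hψ.comp_of_related hf hYZ hU).eqOn_of_convex hZ (IsIntegralSectionOn.mono hφbar (subset_univ U))
    hU hconv ht₀ h0

/-- Let `Y` be a smooth invariant `k`-vector field that projects onto `Z`. If there are local
integral sections of `Y` through the points over the integral section `φ̄` of `Z`, then `φ̄` lifts
to a global integral section of `Y`: by invariance, the domain of a local section through a point
does not depend on the point of the fibre. -/
theorem exists_integralSection_lift_of_invariant [CompleteSpace EP] [IsManifold 𝓘(ℝ, EP) ∞ P]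
    [T2Space P] [CompleteSpace EQ] [IsManifold 𝓘(ℝ, EQ) ∞ (MulAction.orbitRel.Quotient K P)]
    [T2Space (MulAction.orbitRel.Quotient K P)]
    (hact : ContMDiff (𝓘(ℝ, EK).prod 𝓘(ℝ, EP)) 𝓘(ℝ, EP) ∞ (fun q : K × P => q.1 • q.2))
    (hπ : ContMDiff 𝓘(ℝ, EP) 𝓘(ℝ, EQ) ∞ (orbitProj K (P := P)))
    {Y : KVectorField k EP P} (hY : ∀ a, IsSmoothVectorField (Y a))
    (hinv : ∀ (g : K) a p, tangentAct EP g p (Y a p) = Y a (g • p))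
    {Z : KVectorField k EQ (MulAction.orbitRel.Quotient K P)}
    (hZ : ∀ a, IsSmoothVectorField (Z a))
    (hYZ : ∀ a x, mfderiv 𝓘(ℝ, EP) 𝓘(ℝ, EQ) (orbitProj K (P := P)) x (Y a x) =
      Z a (orbitProj K x))
    {φbar : EuclideanSpace ℝ (Fin k) → MulAction.orbitRel.Quotient K P}
    (hφbar : IsIntegralSection Z φbar)
    (hloc : ∀ t₀ p, orbitProj K p = φbar t₀ →
      ∃ r > 0, ∃ ψ, ψ t₀ = p ∧ IsIntegralSectionOn Y ψ (ball t₀ r)) :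
    ∃ φ, IsIntegralSection Y φ ∧ ∀ t, orbitProj K (φ t) = φbar t := by
  refine exists_integralSection_lift hY (orbitProj_surjective _) fun t₀ => ?_
  obtain ⟨p₀, hp₀⟩ := orbitProj_surjective (φbar t₀)
  obtain ⟨r, hr, ψ, hψ0, hψ⟩ := hloc t₀ p₀ hp₀
  have hproj : ∀ t ∈ ball t₀ r, orbitProj K (ψ t) = φbar t :=
    hψ.proj_eq hπ hZ hYZ hφbar isOpen_ball (convex_ball _ _) (mem_ball_self hr) (by rw [hψ0, hp₀])
  refine ⟨r, hr, fun t ht p hp => ?_⟩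
  obtain ⟨g, hg⟩ := exists_smul_eq_of_orbitProj_eq (hp.trans (hproj t ht).symm)
  exact ⟨fun s => g • ψ s, hψ.smul hact hinv isOpen_ball g,
    fun s hs => (orbitProj_smul g _).trans (hproj s hs), hg⟩

end Reduction

/-! ### The flat connection on the pullback bundle -/

section Flat

open Set Manifold Metric VectorField

/-- The velocity of a curve that lies in an embedded submanifold is tangent to it. -/
lemma Manifold.IsSmoothEmbedding.exists_mfderiv_eq_of_curve {E : Type*} [NormedAddCommGroup E]
    [NormedSpace ℝ E] {M : Type*} [TopologicalSpace M] [ChartedSpace E M] [IsManifold 𝓘(ℝ, E) ∞ M]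
    {E' : Type*} [NormedAddCommGroup E'] [NormedSpace ℝ E'] {H' : Type*} [TopologicalSpace H']
    {J : ModelWithCorners ℝ E' H'} {M' : Type*} [TopologicalSpace M'] [ChartedSpace H' M']
    [IsManifold J ∞ M'] {f : M → M'} (hf : IsSmoothEmbedding 𝓘(ℝ, E) J ∞ f) {x : M}
    {d : ℝ → M'} {v : E'} {t : ℝ} (hx : f x = d t)
    (hd : HasMFDerivAt 𝓘(ℝ, ℝ) J d t ((1 : ℝ →L[ℝ] ℝ).smulRight v))
    (hmem : ∀ᶠ s in 𝓝 t, d s ∈ range f) :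
    ∃ w : TangentSpace 𝓘(ℝ, E) x, (mfderiv 𝓘(ℝ, E) J f x w : E') = v := by
  obtain ⟨U, r, hU, hxU, hr, hrf⟩ := (hf.isImmersion.isImmersionAt x).exists_leftInverse
  have hrd : MDifferentiableAt J 𝓘(ℝ, E) r (f x) :=
    (hr.contMDiffAt (hU.mem_nhds hxU)).mdifferentiableAt (by simp)
  -- since `f` is a topological embedding, `f ∘ r` is the identity along `d`
  have hfr : ∀ᶠ s in 𝓝 t, f (r (d s)) = d s := by
    have hrf' : ∀ᶠ z in 𝓝[range f] (f x), f (r z) = z := by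
      rw [← hf.isEmbedding.map_nhds_eq, Filter.eventually_map]
      filter_upwards [hrf] with y hy
      rw [hy]
    have htend : Filter.Tendsto d (𝓝 t) (𝓝[range f] (f x)) :=
      tendsto_nhdsWithin_iff.2 ⟨hx ▸ hd.continuousAt, hmem⟩
    exact htend.eventually hrf'
  have hrx : r (f x) = x := hrf.self_of_nhds
  have h1 : HasMFDerivAt J 𝓘(ℝ, E) r (d t) (mfderiv J 𝓘(ℝ, E) r (d t)) := by
    rw [← hx]; exact hrd.hasMFDerivAt
  have h2 := h1.comp t hd
  have h3 : HasMFDerivAt 𝓘(ℝ, E) J f ((r ∘ d) t) (mfderiv 𝓘(ℝ, E) J f ((r ∘ d) t)) :=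
    (hf.contMDiff.mdifferentiable (by simp) _).hasMFDerivAt
  have h4 := (h3.comp t h2).congr_of_eventuallyEq (hfr.mono fun s hs => hs.symm)
  have h5 := DFunLike.congr_fun (hasMFDerivAt_unique h4 hd) (1 : ℝ)
  have hpt : (r ∘ d) t = x := by simp [← hx, hrx]
  have h6 : ∀ y : M, y = x → ∀ w : E, (mfderiv 𝓘(ℝ, E) J f y w : E') =
      mfderiv 𝓘(ℝ, E) J f x w := by
    rintro _ rfl _; rfl
  have h7 : ((1 : ℝ →L[ℝ] ℝ).smulRight v) (1 : ℝ) = v := by simp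
  exact ⟨(mfderiv J 𝓘(ℝ, E) r (d t) (((1 : ℝ →L[ℝ] ℝ).smulRight v) (1 : ℝ)) : E),
    (h6 _ hpt _).symm.trans (h5.trans h7)⟩

/-- The horizontal part is determined by its defining property if the horizontal and vertical
distributions intersect trivially. -/
lemma horPart_eq {EB : Type*} [NormedAddCommGroup EB] [NormedSpace ℝ EB] {B : Type*}
    [TopologicalSpace B] [ChartedSpace EB B]
    {Hd Vd : ∀ b : B, Submodule ℝ (TangentSpace 𝓘(ℝ, EB) b)} {b : B}
    (hdisj : ∀ u ∈ Hd b, u ∈ Vd b → u = 0) {v w : TangentSpace 𝓘(ℝ, EB) b} (hw : w ∈ Hd b)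
    (hvw : v - w ∈ Vd b) : horPart Hd Vd b v = w := by
  have h : horPart Hd Vd b v ∈ Hd b ∧ v - horPart Hd Vd b v ∈ Vd b :=
    Classical.epsilon_spec (p := fun w => w ∈ Hd b ∧ v - w ∈ Vd b) ⟨w, hw, hvw⟩
  refine sub_eq_zero.1 (hdisj _ ((Hd b).sub_mem h.1 hw) ?_)
  have := (Vd b).sub_mem hvw h.2
  rwa [sub_sub_sub_cancel_left] at this

variable {k : ℕ} {K : Type*} [Group K]
  {EP : Type*} [NormedAddCommGroup EP] [NormedSpace ℝ EP] {P : Type*} [TopologicalSpace P]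
  [ChartedSpace EP P] [IsManifold 𝓘(ℝ, EP) ∞ P] [MulAction K P]
  {EQ : Type*} [NormedAddCommGroup EQ] [NormedSpace ℝ EQ]
  [ChartedSpace EQ (MulAction.orbitRel.Quotient K P)]

/-- The vector `∂/∂tᵃ + Xₐ` is tangent to the pullback bundle: the integral curve of `Xₐ` lies
over `φ̄`. -/
lemma exists_mfderiv_pullbackIncl_eq [CompleteSpace EP] [CompleteSpace EQ]
    [IsManifold 𝓘(ℝ, EQ) ∞ (MulAction.orbitRel.Quotient K P)]
    [T2Space (MulAction.orbitRel.Quotient K P)]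
    (hπ : ContMDiff 𝓘(ℝ, EP) 𝓘(ℝ, EQ) ∞ (orbitProj K (P := P)))
    {X : KVectorField k EP P} (hX : ∀ a, IsSmoothVectorField (X a))
    {Z : KVectorField k EQ (MulAction.orbitRel.Quotient K P)}
    (hZ : ∀ a, IsSmoothVectorField (Z a))
    (hXZ : ∀ a x, mfderiv 𝓘(ℝ, EP) 𝓘(ℝ, EQ) (orbitProj K (P := P)) x (X a x) =
      Z a (orbitProj K x))
    {φbar : EuclideanSpace ℝ (Fin k) → MulAction.orbitRel.Quotient K P}
    (hφbar : IsIntegralSection Z φbar)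
    {EB : Type*} [NormedAddCommGroup EB] [NormedSpace ℝ EB]
    [ChartedSpace EB (PullbackBundle φbar)] [IsManifold 𝓘(ℝ, EB) ∞ (PullbackBundle φbar)]
    (hB : IsSmoothEmbedding 𝓘(ℝ, EB) (𝓘(ℝ, EuclideanSpace ℝ (Fin k)).prod 𝓘(ℝ, EP)) ∞
      (PullbackBundle.incl φbar)) (a : Fin k) (b : PullbackBundle φbar) :
    ∃ w : TangentSpace 𝓘(ℝ, EB) b,
      (mfderiv 𝓘(ℝ, EB) (𝓘(ℝ, EuclideanSpace ℝ (Fin k)).prod 𝓘(ℝ, EP))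
        (PullbackBundle.incl φbar) b w : EuclideanSpace ℝ (Fin k) × EP) =
      (EuclideanSpace.single a (1 : ℝ), X a b.1.2) := by
  have : IsManifold 𝓘(ℝ, EP) 1 P := .of_le (n := ∞) (by simp)
  have : IsManifold 𝓘(ℝ, EQ) 1 (MulAction.orbitRel.Quotient K P) := .of_le (n := ∞) (by simp)
  obtain ⟨γ, hγ0, hγ⟩ := exists_isMIntegralCurveAt_of_contMDiffAt_boundaryless 0
    (((hX a) b.1.2).of_le (by simp))
  set e : EuclideanSpace ℝ (Fin k) := EuclideanSpace.single a (1 : ℝ) with he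
  have hcomb : ∀ q, Z.comb e q = Z a q := fun q => by
    simp [KVectorField.comb, he, ite_smul]
  have hline : IsMIntegralCurveAt (I := 𝓘(ℝ, EQ)) (fun s : ℝ => φbar (b.1.1 + s • e)) (Z a) 0 := by
    have h := IsIntegralSectionOn.isMIntegralCurveOn_line hφbar isOpen_univ b.1.1 e
    rw [show Z.comb e = Z a from funext hcomb] at h
    exact h.isMIntegralCurveAt (by simp)
  have hproj : IsMIntegralCurveAt (I := 𝓘(ℝ, EQ)) (fun s => orbitProj K (γ s)) (Z a) 0 := by
    filter_upwards [hγ] with s hs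
    refine ((hπ.mdifferentiable (by simp) (γ s)).hasMFDerivAt.comp s hs).congr_mfderiv ?_
    refine ContinuousLinearMap.ext fun c : ℝ => ?_
    let L : EP →L[ℝ] EQ := mfderiv 𝓘(ℝ, EP) 𝓘(ℝ, EQ) (orbitProj K (P := P)) (γ s)
    have h3 : L (c • (X a (γ s) : EP)) = c • L (X a (γ s)) := L.map_smul c _
    exact h3.trans (congrArg (fun w : EQ => c • w) (hXZ a (γ s)))
  have heq := isMIntegralCurveAt_eventuallyEq_of_contMDiffAt_boundaryless (t₀ := 0)
    (((hZ a) _).of_le (by simp)) hline hproj (by simp [hγ0, b.2])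
  have hl : HasMFDerivAt 𝓘(ℝ, ℝ) 𝓘(ℝ, EuclideanSpace ℝ (Fin k)) (fun s : ℝ => b.1.1 + s • e) 0
      ((1 : ℝ →L[ℝ] ℝ).smulRight e) := by
    have h0 : HasDerivAt (fun s : ℝ => b.1.1 + s • e) ((1 : ℝ) • e) 0 :=
      ((hasDerivAt_id 0).smul_const e).const_add b.1.1
    refine h0.hasFDerivAt.hasMFDerivAt.congr_mfderiv ?_
    refine ContinuousLinearMap.ext fun c : ℝ => ?_
    change c • ((1 : ℝ) • e) = c • e
    rw [one_smul]
  refine hB.exists_mfderiv_eq_of_curve (t := 0) (d := fun s => (b.1.1 + s • e, γ s)) ?_ ?_ ?_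
  · simp [hγ0, PullbackBundle.incl]
  · refine (hl.prodMk hγ.hasMFDerivAt).congr_mfderiv ?_
    refine ContinuousLinearMap.ext fun c : ℝ => ?_
    have h2 : (X a (γ 0) : EP) = X a b.1.2 := by rw [hγ0]
    exact congrArg (fun w : EP => (c • e, c • w)) h2
  · filter_upwards [heq] with s hs
    exact ⟨⟨(b.1.1 + s • e, γ s), hs⟩, rfl⟩

end Flat

section FlatSections

open Set Manifold Metric VectorField

lemma IsSmoothVectorField.prodMk {E : Type*} [NormedAddCommGroup E] [NormedSpace ℝ E]
    {M : Type*} [TopologicalSpace M] [ChartedSpace E M] [IsManifold 𝓘(ℝ, E) ∞ M]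
    {E' : Type*} [NormedAddCommGroup E'] [NormedSpace ℝ E']
    {M' : Type*} [TopologicalSpace M'] [ChartedSpace E' M'] [IsManifold 𝓘(ℝ, E') ∞ M']
    {V : ∀ x : M, TangentSpace 𝓘(ℝ, E) x} {W : ∀ x : M', TangentSpace 𝓘(ℝ, E') x}
    (hV : IsSmoothVectorField V) (hW : IsSmoothVectorField W) :
    ContMDiff (𝓘(ℝ, E).prod 𝓘(ℝ, E')) (𝓘(ℝ, E).prod 𝓘(ℝ, E')).tangent ∞
      (fun x : M × M' => (⟨x, ((V x.1 : E), (W x.2 : E'))⟩ :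
        TangentBundle (𝓘(ℝ, E).prod 𝓘(ℝ, E')) (M × M'))) := by
  have : IsManifold 𝓘(ℝ, E) 1 M := .of_le (n := ∞) (by simp)
  have : IsManifold 𝓘(ℝ, E') 1 M' := .of_le (n := ∞) (by simp)
  have h := (contMDiff_equivTangentBundleProd_symm (n := ∞) (I := 𝓘(ℝ, E)) (M := M)
    (I' := 𝓘(ℝ, E')) (M' := M')).comp
    ((hV.comp contMDiff_fst).prodMk (hW.comp contMDiff_snd))
  exact h

lemma isSmoothVectorField_const {E : Type*} [NormedAddCommGroup E] [NormedSpace ℝ E] (v : E) :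
    IsSmoothVectorField (fun x : E => (v : TangentSpace 𝓘(ℝ, E) x)) :=
  fun _ => contMDiffAt_vectorSpace_iff_contDiffAt.2 contDiffAt_const

/-- A vector that lies in the graph of a linear map on `ℝᵏ` and over `0` vanishes. -/
lemma eq_zero_of_mem_span_single_prod {k : ℕ} {E : Type*} [AddCommGroup E] [Module ℝ E]
    {w : Fin k → E} {d : EuclideanSpace ℝ (Fin k) × E}
    (hd : d ∈ Submodule.span ℝ (range fun a : Fin k =>
      ((EuclideanSpace.single a (1 : ℝ) : EuclideanSpace ℝ (Fin k)), w a)))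
    (h0 : d.1 = 0) : d = 0 := by
  obtain ⟨c, rfl⟩ := (Submodule.mem_span_range_iff_exists_fun ℝ).1 hd
  have hc : ∀ a, c a = 0 := fun a => by
    rw [Prod.fst_sum] at h0
    have h := congrArg (fun v : EuclideanSpace ℝ (Fin k) => v a) h0
    simpa [Pi.single_apply] using h
  simp [hc]

variable {k : ℕ} {K : Type*} [Group K]
  {EP : Type*} [NormedAddCommGroup EP] [NormedSpace ℝ EP] {P : Type*} [TopologicalSpace P]
  [ChartedSpace EP P] [IsManifold 𝓘(ℝ, EP) ∞ P] [MulAction K P]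
  {EQ : Type*} [NormedAddCommGroup EQ] [NormedSpace ℝ EQ]
  [ChartedSpace EQ (MulAction.orbitRel.Quotient K P)]

/-- The horizontal and vertical distributions of the pullback bundle intersect trivially. -/
lemma eq_zero_of_mem_horizontalDist_of_mem_verticalDist {X : KVectorField k EP P}
    {φbar : EuclideanSpace ℝ (Fin k) → MulAction.orbitRel.Quotient K P}
    {EB : Type*} [NormedAddCommGroup EB] [NormedSpace ℝ EB]
    [ChartedSpace EB (PullbackBundle φbar)] [IsManifold 𝓘(ℝ, EB) ∞ (PullbackBundle φbar)]
    (hB : IsSmoothEmbedding 𝓘(ℝ, EB) (𝓘(ℝ, EuclideanSpace ℝ (Fin k)).prod 𝓘(ℝ, EP)) ∞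
      (PullbackBundle.incl φbar)) {b : PullbackBundle φbar} {u : TangentSpace 𝓘(ℝ, EB) b}
    (hh : u ∈ horizontalDist X φbar EB b) (hv : u ∈ verticalDist φbar EB b) : u = 0 := by
  let D : EB →L[ℝ] EuclideanSpace ℝ (Fin k) × EP :=
    mfderiv 𝓘(ℝ, EB) (𝓘(ℝ, EuclideanSpace ℝ (Fin k)).prod 𝓘(ℝ, EP)) (PullbackBundle.incl φbar) b
  have hD : Function.Injective D := (hB.isImmersion.isImmersionAt b).mfderiv_injective
  have hfst : (D u).1 = 0 := by
    have h1 := mfderiv_comp b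
      (mdifferentiableAt_fst (I := 𝓘(ℝ, EuclideanSpace ℝ (Fin k))) (I' := 𝓘(ℝ, EP))
        (x := PullbackBundle.incl φbar b))
      (hB.contMDiff.mdifferentiable (by simp) b)
    rw [mfderiv_fst] at h1
    have h2 := DFunLike.congr_fun h1 u
    exact h2.symm.trans hv
  exact hD ((eq_zero_of_mem_span_single_prod (w := fun a => X a b.1.2) hh hfst).trans
    D.map_zero.symm)

/-- If the connection is flat, then the horizontal lifts of the coordinate fields of `ℝᵏ` commute;
so there are integral sections of `X` through each point over `φ̄`. -/
theorem exists_integralSectionOn_of_isFlat [CompleteSpace EP] [CompleteSpace EQ]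
    [IsManifold 𝓘(ℝ, EQ) ∞ (MulAction.orbitRel.Quotient K P)]
    [T2Space (MulAction.orbitRel.Quotient K P)]
    (hπ : ContMDiff 𝓘(ℝ, EP) 𝓘(ℝ, EQ) ∞ (orbitProj K (P := P)))
    {X : KVectorField k EP P} (hX : ∀ a, IsSmoothVectorField (X a))
    {Z : KVectorField k EQ (MulAction.orbitRel.Quotient K P)}
    (hZ : ∀ a, IsSmoothVectorField (Z a))
    (hXZ : ∀ a x, mfderiv 𝓘(ℝ, EP) 𝓘(ℝ, EQ) (orbitProj K (P := P)) x (X a x) =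
      Z a (orbitProj K x))
    {φbar : EuclideanSpace ℝ (Fin k) → MulAction.orbitRel.Quotient K P}
    (hφbar : IsIntegralSection Z φbar)
    {EB : Type*} [NormedAddCommGroup EB] [NormedSpace ℝ EB] [CompleteSpace EB]
    [ChartedSpace EB (PullbackBundle φbar)] [IsManifold 𝓘(ℝ, EB) ∞ (PullbackBundle φbar)]
    (hB : IsSmoothEmbedding 𝓘(ℝ, EB) (𝓘(ℝ, EuclideanSpace ℝ (Fin k)).prod 𝓘(ℝ, EP)) ∞
      (PullbackBundle.incl φbar))
    (hflat : IsFlat (horizontalDist X φbar EB) (verticalDist φbar EB))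
    (t₀ : EuclideanSpace ℝ (Fin k)) (p : P) (hp : orbitProj K p = φbar t₀) :
    ∃ r > 0, ∃ ψ, ψ t₀ = p ∧ IsIntegralSectionOn X ψ (ball t₀ r) := by
  -- the horizontal lifts of the coordinate fields
  choose Y hY using fun a b => exists_mfderiv_pullbackIncl_eq hπ hX hZ hXZ hφbar hB a b
  have hYs : ∀ a, IsSmoothVectorField (Y a) := fun a =>
    hB.isImmersion.contMDiff_of_related
      ((isSmoothVectorField_const (EuclideanSpace.single a (1 : ℝ))).prodMk (hX a)) (hY a)
  have hdisj : ∀ b, ∀ u ∈ horizontalDist X φbar EB b, u ∈ verticalDist φbar EB b → u = 0 :=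
    fun b u hh hv => eq_zero_of_mem_horizontalDist_of_mem_verticalDist hB hh hv
  have hYhor : ∀ a b, Y a b ∈ horizontalDist X φbar EB b := fun a b => by
    have hmem : ((EuclideanSpace.single a (1 : ℝ) : EuclideanSpace ℝ (Fin k)), (X a b.1.2 : EP)) ∈
        Submodule.span ℝ (range fun a : Fin k =>
          ((EuclideanSpace.single a (1 : ℝ) : EuclideanSpace ℝ (Fin k)), (X a b.1.2 : EP))) :=
      Submodule.subset_span (mem_range_self a)
    rw [← hY a b] at hmem
    exact hmem
  have hhor : ∀ a, (fun b => horPart (horizontalDist X φbar EB) (verticalDist φbar EB) b (Y a b)) =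
      Y a := fun a => funext fun b => horPart_eq (hdisj b) (hYhor a b) (by simp)
  have hbasefst : ∀ b (u : TangentSpace 𝓘(ℝ, EB) b),
      mfderiv 𝓘(ℝ, EB) 𝓘(ℝ, EuclideanSpace ℝ (Fin k)) (fun b : PullbackBundle φbar => b.1.1) b u =
        (mfderiv 𝓘(ℝ, EB) (𝓘(ℝ, EuclideanSpace ℝ (Fin k)).prod 𝓘(ℝ, EP))
          (PullbackBundle.incl φbar) b u : EuclideanSpace ℝ (Fin k) × EP).1 := fun b u => by
    have h1 := mfderiv_comp b
      (mdifferentiableAt_fst (I := 𝓘(ℝ, EuclideanSpace ℝ (Fin k))) (I' := 𝓘(ℝ, EP))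
        (x := PullbackBundle.incl φbar b))
      (hB.contMDiff.mdifferentiable (by simp) b)
    rw [mfderiv_fst] at h1
    exact DFunLike.congr_fun h1 u
  have hcomm : ∀ a c b, mlieBracket 𝓘(ℝ, EB) (Y a) (Y c) b = 0 := by
    intro a c b
    -- the bracket of lifts of coordinate fields is vertical, and flatness makes it horizontal
    have hver : mlieBracket 𝓘(ℝ, EB) (Y a) (Y c) b ∈ verticalDist φbar EB b :=
      mfderiv_mlieBracket_eq_zero (f := fun b : PullbackBundle φbar => b.1.1)
        (contMDiff_fst.comp hB.contMDiff) (hYs a) (hYs c)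
        (c := EuclideanSpace.single a (1 : ℝ)) (d := EuclideanSpace.single c (1 : ℝ))
        (fun x => (hbasefst x _).trans (congrArg Prod.fst (hY a x)))
        (fun x => (hbasefst x _).trans (congrArg Prod.fst (hY c x))) b
    have hK := hflat (Y a) (Y c) (hYs a) (hYs c) b
    unfold curvature at hK
    rw [hhor, hhor, neg_eq_zero] at hK
    unfold verPart at hK
    rw [horPart_eq (hdisj b) (Submodule.zero_mem _) (by simpa using hver), sub_zero] at hK
    exact hK
  obtain ⟨r, hr, σ, hσ0, hσ⟩ := exists_integralSectionOn_of_mlieBracket_eq_zero hYs hcomm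
    (⟨(t₀, p), hp.symm⟩ : PullbackBundle φbar)
  have hsnd : ContMDiff 𝓘(ℝ, EB) 𝓘(ℝ, EP) ∞ (fun b : PullbackBundle φbar => b.1.2) :=
    contMDiff_snd.comp hB.contMDiff
  have hrel : ∀ a b, mfderiv 𝓘(ℝ, EB) 𝓘(ℝ, EP) (fun b : PullbackBundle φbar => b.1.2) b (Y a b) =
      X a b.1.2 := fun a b => by
    have h1 := mfderiv_comp b
      (mdifferentiableAt_snd (I := 𝓘(ℝ, EuclideanSpace ℝ (Fin k))) (I' := 𝓘(ℝ, EP))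
        (x := PullbackBundle.incl φbar b))
      (hB.contMDiff.mdifferentiable (by simp) b)
    rw [mfderiv_snd] at h1
    exact (DFunLike.congr_fun h1 (Y a b)).trans (congrArg Prod.snd (hY a b))
  have hψ := (hσ.comp_of_related hsnd hrel isOpen_ball).comp_sub isOpen_ball t₀
  refine ⟨r, hr, fun t => (σ (t - t₀)).1.2, by simp [hσ0], hψ.mono fun t ht => ?_⟩
  simpa [dist_eq_norm] using ht

end FlatSections

/-! ### Division in a free and proper action -/

section Division

open Set Manifold Filter Topology

lemma isClosedEmbedding_smul_pair {K P : Type*} [Group K] [TopologicalSpace K] [TopologicalSpace P]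
    [MulAction K P] [hproper : ProperSMul K P] (hfree : ∀ (g : K) (p : P), g • p = p → g = 1) :
    IsClosedEmbedding (fun q : K × P => (q.1 • q.2, q.2)) := by
  refine .of_continuous_injective_isClosedMap hproper.isProperMap_smul_pair.continuous ?_
    hproper.isProperMap_smul_pair.isClosedMap
  rintro ⟨g, p⟩ ⟨h, q⟩ he
  obtain ⟨h1, rfl⟩ := Prod.mk.inj he
  have : h⁻¹ * g = 1 := hfree _ p (by rw [mul_smul, h1, inv_smul_smul])
  rw [inv_mul_eq_one.1 this]

/-- The group element that moves `φ₁ t` to `φ₂ t` depends continuously on `t`. -/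
lemma continuousAt_of_smul_eq {K P : Type*} [Group K] [TopologicalSpace K] [TopologicalSpace P]
    [MulAction K P] [ProperSMul K P] (hfree : ∀ (g : K) (p : P), g • p = p → g = 1)
    {T : Type*} [TopologicalSpace T] {φ₁ φ₂ : T → P} {g : T → K} {t : T}
    (h₁ : ContinuousAt φ₁ t) (h₂ : ContinuousAt φ₂ t) (hg : ∀ᶠ s in 𝓝 t, φ₂ s = g s • φ₁ s) :
    ContinuousAt g t := by
  have h : ContinuousAt (fun s => (g s, φ₁ s)) t := by
    rw [(isClosedEmbedding_smul_pair hfree).isInducing.continuousAt_iff]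
    exact (h₂.prodMk h₁).congr (hg.mono fun s hs => by simp [hs])
  exact h.fst

variable {EK : Type*} [NormedAddCommGroup EK] [NormedSpace ℝ EK] {K : Type*}
  [TopologicalSpace K] [ChartedSpace EK K] [Group K] [LieGroup 𝓘(ℝ, EK) ∞ K]
  {EP : Type*} [NormedAddCommGroup EP] [NormedSpace ℝ EP] {P : Type*} [TopologicalSpace P]
  [ChartedSpace EP P] [MulAction K P]
  {T : Type*} [NormedAddCommGroup T] [NormedSpace ℝ T]

/-- If the infinitesimal action at `φ₁ t` is a split injection, then by the inverse function theorem
the group element near `1` that moves `φ₁ s` to `φ₂ s` depends smoothly on `s`. -/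
lemma contMDiffAt_of_smul_eq_of_eq_one [CompleteSpace EK] [CompleteSpace T]
    (hact : ContMDiff (𝓘(ℝ, EK).prod 𝓘(ℝ, EP)) 𝓘(ℝ, EP) ∞ (fun q : K × P => q.1 • q.2))
    {φ₁ φ₂ : T → P} {g : T → K} {t : T}
    (h₁ : ContMDiffAt 𝓘(ℝ, T) 𝓘(ℝ, EP) ∞ φ₁ t) (h₂ : ContMDiffAt 𝓘(ℝ, T) 𝓘(ℝ, EP) ∞ φ₂ t)
    (hgc : ContinuousAt g t) (hg : ∀ᶠ s in 𝓝 t, φ₂ s = g s • φ₁ s) (hgt : g t = 1)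
    {l : EP →L[ℝ] EK} (hl : ∀ ξ : EK, l (infGen (EG := EK) (G := K) ξ (φ₁ t)) = ξ) :
    ContMDiffAt 𝓘(ℝ, T) 𝓘(ℝ, EK) ∞ g t := by
  have : IsManifold 𝓘(ℝ, EK) ∞ K := inferInstance
  let κ := extChartAt 𝓘(ℝ, EK) (1 : K)
  let χ := extChartAt 𝓘(ℝ, EP) ((1 : K) • φ₁ t)
  let F : T × EK → EP := fun z => χ (κ.symm z.2 • φ₁ z.1)
  have hκ1 : κ.symm (κ 1) = 1 := extChartAt_to_inv (I := 𝓘(ℝ, EK)) (1 : K)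
  have hκs : ContMDiffAt 𝓘(ℝ, EK) 𝓘(ℝ, EK) ∞ κ.symm (κ 1) :=
    (contMDiffOn_extChartAt_symm (1 : K)).contMDiffAt (extChartAt_target_mem_nhds (1 : K))
  have hF : ContDiffAt ℝ ∞ F (t, κ 1) := by
    have h3 : ContMDiffAt 𝓘(ℝ, T × EK) 𝓘(ℝ, EP) ∞ (fun z : T × EK => κ.symm z.2 • φ₁ z.1)
        (t, κ 1) := by
      refine (hact _).comp _ (ContMDiffAt.prodMk ?_ ?_)
      · exact ContMDiffAt.comp (t, κ 1) (g := κ.symm) (f := Prod.snd) hκs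
          contDiff_snd.contMDiff.contMDiffAt
      · exact ContMDiffAt.comp (t, κ 1) (g := φ₁) (f := Prod.fst) h₁
          contDiff_fst.contMDiff.contMDiffAt
    have h4 : ContMDiffAt 𝓘(ℝ, EP) 𝓘(ℝ, EP) ∞ χ (κ.symm (κ 1) • φ₁ t) := by
      rw [hκ1]; exact contMDiffAt_extChartAt
    exact (ContMDiffAt.comp (t, κ 1) (g := χ) h4 h3).contDiffAt
  let D : T × EK →L[ℝ] EP := fderiv ℝ F (t, κ 1)
  have hFD : HasFDerivAt F D (t, κ 1) := (hF.differentiableAt (by simp)).hasFDerivAt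
  -- the derivative in the group variable is the infinitesimal action
  have hD2 : ∀ ξ : EK, l (D (0, ξ)) = ξ := fun ξ => by
    have h3 : HasFDerivAt (fun y : EK => F (t, y)) (D.comp (ContinuousLinearMap.inr ℝ T EK)) (κ 1) :=
      hFD.comp (κ 1) (hasFDerivAt_prodMk_right t (κ 1))
    have h4 : (infGen (EG := EK) (G := K) ξ (φ₁ t) : EP) =
        fderivWithin ℝ (fun y : EK => F (t, y)) (range 𝓘(ℝ, EK)) (κ 1) ξ :=
      DFunLike.congr_fun (((contMDiff_smul_const_of_contMDiff_smul hact (φ₁ t)).mdifferentiable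
        (by simp) (1 : K)).mfderiv) ξ
    have h5 : fderivWithin ℝ (fun y : EK => F (t, y)) (range 𝓘(ℝ, EK)) (κ 1) =
        D.comp (ContinuousLinearMap.inr ℝ T EK) := by
      rw [ModelWithCorners.range_eq_univ, fderivWithin_univ, h3.fderiv]
    rw [h5] at h4
    exact (congrArg l h4).symm.trans (hl ξ)
  -- so `Θ` is a local diffeomorphism, and `(s, g s)` is, in the chart, the preimage of
  -- `(s, l (χ (φ₂ s)))`
  let Θ : T × EK → T × EK := fun z => (z.1, l (F z))
  have hΘ : ContDiffAt ℝ ∞ Θ (t, κ 1) :=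
    contDiffAt_fst.prodMk (l.contDiff.contDiffAt.comp _ hF)
  let Θ' : (T × EK) ≃L[ℝ] T × EK :=
    (ContinuousLinearEquiv.refl ℝ T).skewProd (ContinuousLinearEquiv.refl ℝ EK)
      ((l.comp D).comp (ContinuousLinearMap.inl ℝ T EK))
  have hΘ' : HasFDerivAt Θ (Θ' : T × EK →L[ℝ] T × EK) (t, κ 1) := by
    refine (hasFDerivAt_fst.prodMk (l.hasFDerivAt.comp (t, κ 1) hFD)).congr_fderiv ?_
    refine ContinuousLinearMap.ext fun z => Prod.ext (by simp [Θ']) ?_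
    have h3 : l (D z) = l (D (0, z.2)) + l (D (z.1, 0)) := by
      rw [← map_add, ← map_add, Prod.mk_add_mk, zero_add, add_zero]
    rw [hD2] at h3
    simpa [Θ'] using h3
  have hinv := hΘ.to_localInverse hΘ' (by simp)
  have hleft := (hΘ.hasStrictFDerivAt' hΘ' (by simp)).eventually_left_inverse
  have hκ : ContinuousAt κ (1 : K) := continuousAt_extChartAt (1 : K)
  have hφ₁c : ContinuousAt φ₁ t := h₁.continuousAt
  have hgκ : Tendsto (fun s => (s, κ (g s))) (𝓝 t) (𝓝 (t, κ 1)) := by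
    rw [nhds_prod_eq]
    refine tendsto_id.prodMk ?_
    have := hκ.tendsto.comp (hgt ▸ hgc.tendsto)
    exact this
  have hgsrc : ∀ᶠ s in 𝓝 t, κ.symm (κ (g s)) = g s := by
    have h3 : ∀ᶠ h in 𝓝 (1 : K), κ.symm (κ h) = h :=
      (extChartAt_source_mem_nhds (I := 𝓘(ℝ, EK)) (1 : K)) |> fun h => by
        filter_upwards [h] with y hy using κ.left_inv hy
    exact (hgt ▸ hgc.tendsto : Tendsto g (𝓝 t) (𝓝 1)).eventually h3
  have hχφ : ContMDiffAt 𝓘(ℝ, T) 𝓘(ℝ, EP) ∞ (fun s => χ (φ₂ s)) t := by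
    have h4 : ContMDiffAt 𝓘(ℝ, EP) 𝓘(ℝ, EP) ∞ χ (φ₂ t) := by
      rw [hg.self_of_nhds, hgt]; exact contMDiffAt_extChartAt
    exact ContMDiffAt.comp t h4 h₂
  have hval : Θ (t, κ 1) = (t, l (χ (φ₂ t))) := by
    simp only [Θ, F, hκ1, hg.self_of_nhds, hgt]
  have hsol : ContDiffAt ℝ ∞
      (fun s => (hΘ.localInverse hΘ' (by simp) (s, l (χ (φ₂ s)))).2) t := by
    have h3 : ContDiffAt ℝ ∞ (fun s => (s, l (χ (φ₂ s)))) t :=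
      contDiffAt_id.prodMk (l.contDiff.contDiffAt.comp t hχφ.contDiffAt)
    rw [hval] at hinv
    exact contDiffAt_snd.comp t (hinv.comp t h3)
  have hgeq : ∀ᶠ s in 𝓝 t, g s =
      κ.symm (hΘ.localInverse hΘ' (by simp) (s, l (χ (φ₂ s)))).2 := by
    filter_upwards [hgκ.eventually hleft, hgsrc, hg] with s hs1 hs2 hs3
    have h3 : Θ (s, κ (g s)) = (s, l (χ (φ₂ s))) := by
      simp only [Θ, F, hs2, hs3]
    rw [h3] at hs1
    have h4 := congrArg Prod.snd hs1
    exact hs2.symm.trans (congrArg κ.symm h4.symm)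
  refine ContMDiffAt.congr_of_eventuallyEq ?_ hgeq
  refine ContMDiffAt.comp t (g := κ.symm) ?_ hsol.contMDiffAt
  have h3 : (hΘ.localInverse hΘ' (by simp) (t, l (χ (φ₂ t)))).2 = κ 1 := by
    rw [← hval, hΘ.localInverse_apply_image hΘ']
  rw [h3]
  exact hκs

/-- The group element that moves `φ₁ s` to `φ₂ s` depends smoothly on `s`. -/
lemma contMDiffAt_of_smul_eq [CompleteSpace EK] [CompleteSpace T] [ProperSMul K P]
    [IsManifold 𝓘(ℝ, EP) ∞ P]
    (hfree : ∀ (g : K) (p : P), g • p = p → g = 1)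
    (hact : ContMDiff (𝓘(ℝ, EK).prod 𝓘(ℝ, EP)) 𝓘(ℝ, EP) ∞ (fun q : K × P => q.1 • q.2))
    (A : PrincipalConnection EK K EP P) {φ₁ φ₂ : T → P} {g : T → K} {t : T}
    (h₁ : ContMDiffAt 𝓘(ℝ, T) 𝓘(ℝ, EP) ∞ φ₁ t) (h₂ : ContMDiffAt 𝓘(ℝ, T) 𝓘(ℝ, EP) ∞ φ₂ t)
    (hg : ∀ᶠ s in 𝓝 t, φ₂ s = g s • φ₁ s) : ContMDiffAt 𝓘(ℝ, T) 𝓘(ℝ, EK) ∞ g t := by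
  have hgc : ContinuousAt g t := continuousAt_of_smul_eq hfree h₁.continuousAt h₂.continuousAt hg
  have := topologicalGroup_of_lieGroup 𝓘(ℝ, EK) ∞ (G := K)
  have h3 := contMDiffAt_of_smul_eq_of_eq_one (g := fun s => g s * (g t)⁻¹)
    (φ₁ := fun s => g t • φ₁ s) (l := A.form (g t • φ₁ t)) hact
    ((contMDiff_const_smul_of_contMDiff_smul hact (g t)).contMDiffAt.comp t h₁) h₂
    (hgc.mul continuousAt_const) (hg.mono fun s hs => by
      rw [hs, smul_smul, inv_mul_cancel_right]) (mul_inv_cancel _)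
    (fun ξ => A.reproduces ξ _)
  have h4 : ContMDiffAt 𝓘(ℝ, T) 𝓘(ℝ, EK) ∞ (fun s => g s * (g t)⁻¹ * g t) t :=
    h3.mul contMDiffAt_const
  simpa using h4

end Division

/-! ### Vertical vectors and horizontal lifts -/

section HorizontalLift

open Set Manifold Filter Topology

/-- A vector in the kernel of the derivative of a submersion is the velocity of a curve in the
fibre. -/
lemma Manifold.IsSubmersionAt.exists_curve_of_mfderiv_eq_zero {E : Type*} [NormedAddCommGroup E]
    [NormedSpace ℝ E] {M : Type*} [TopologicalSpace M] [ChartedSpace E M] [IsManifold 𝓘(ℝ, E) ∞ M]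
    {E' : Type*} [NormedAddCommGroup E'] [NormedSpace ℝ E'] {Q : Type*} [TopologicalSpace Q]
    [ChartedSpace E' Q] [IsManifold 𝓘(ℝ, E') ∞ Q] {f : M → Q} {x : M}
    (h : IsSubmersionAt 𝓘(ℝ, E) 𝓘(ℝ, E') ∞ f x) {v : TangentSpace 𝓘(ℝ, E) x}
    (hv : mfderiv 𝓘(ℝ, E) 𝓘(ℝ, E') f x v = 0) :
    ∃ d : ℝ → M, d 0 = x ∧ ContMDiffAt 𝓘(ℝ, ℝ) 𝓘(ℝ, E) ∞ d 0 ∧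
      (mfderiv 𝓘(ℝ, ℝ) 𝓘(ℝ, E) d 0 (1 : ℝ) : E) = v ∧ ∀ᶠ s in 𝓝 0, f (d s) = f x := by
  have hc : ContMDiffAt 𝓘(ℝ, E) 𝓘(ℝ, E) ∞ h.domChart x :=
    contMDiffAt_of_mem_maximalAtlas h.domChart_mem_maximalAtlas h.mem_domChart_source
  have hcs : ContMDiffAt 𝓘(ℝ, E) 𝓘(ℝ, E) ∞ h.domChart.symm (h.domChart x) :=
    contMDiffAt_symm_of_mem_maximalAtlas h.domChart_mem_maximalAtlas
      (h.domChart.map_source h.mem_domChart_source)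
  have hb : ContMDiffAt 𝓘(ℝ, E') 𝓘(ℝ, E') ∞ h.codChart (f x) :=
    contMDiffAt_of_mem_maximalAtlas h.codChart_mem_maximalAtlas h.mem_codChart_source
  have hw : ∀ z ∈ h.domChart.target, h.codChart (f (h.domChart.symm z)) = (h.equiv z).1 := by
    intro z hz
    have hz' : z ∈ (h.domChart.extend 𝓘(ℝ, E)).target := by simpa using hz
    have := h.writtenInCharts hz'
    simpa using this
  have hw' : ∀ y ∈ h.domChart.source, h.codChart (f y) = (h.equiv (h.domChart y)).1 := by
    intro y hy
    have := hw _ (h.domChart.map_source hy)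
    rwa [h.domChart.left_inv hy] at this
  let Dc : E →L[ℝ] E := mfderiv 𝓘(ℝ, E) 𝓘(ℝ, E) h.domChart x
  let Ds : E →L[ℝ] E := mfderiv 𝓘(ℝ, E) 𝓘(ℝ, E) h.domChart.symm (h.domChart x)
  let Db : E' →L[ℝ] E' := mfderiv 𝓘(ℝ, E') 𝓘(ℝ, E') h.codChart (f x)
  let w : E := Dc v
  have hmc : HasMFDerivAt 𝓘(ℝ, E) 𝓘(ℝ, E) h.domChart x Dc :=
    (hc.mdifferentiableAt (by simp)).hasMFDerivAt
  have hms : HasMFDerivAt 𝓘(ℝ, E) 𝓘(ℝ, E) h.domChart.symm (h.domChart x) Ds :=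
    (hcs.mdifferentiableAt (by simp)).hasMFDerivAt
  have hmb : HasMFDerivAt 𝓘(ℝ, E') 𝓘(ℝ, E') h.codChart (f x) Db :=
    (hb.mdifferentiableAt (by simp)).hasMFDerivAt
  have hmf := (h.contMDiffAt.mdifferentiableAt (by simp)).hasMFDerivAt
  have hsv : Ds w = v := by
    have h1 : HasMFDerivAt 𝓘(ℝ, E) 𝓘(ℝ, E) id x (Ds.comp Dc) :=
      (hms.comp x hmc).congr_of_eventuallyEq <| by
        filter_upwards [h.domChart.open_source.mem_nhds h.mem_domChart_source] with y hy
        exact (h.domChart.left_inv hy).symm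
    exact DFunLike.congr_fun (hasMFDerivAt_unique h1 (hasMFDerivAt_id x)) v
  have hw1 : (h.equiv w).1 = 0 := by
    let q : E →L[ℝ] E' := (ContinuousLinearMap.fst ℝ E' h.complement).comp
      (h.equiv : E →L[ℝ] E' × h.complement)
    have h1 : HasMFDerivAt 𝓘(ℝ, E) 𝓘(ℝ, E') (fun y => q (h.domChart y)) x (q.comp Dc) :=
      (q.hasMFDerivAt (x := h.domChart x)).comp x hmc
    have h2 := (hmb.comp x hmf).congr_of_eventuallyEq (f₁ := fun y => q (h.domChart y)) <| by
      filter_upwards [h.domChart.open_source.mem_nhds h.mem_domChart_source] with y hy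
      exact (hw' y hy).symm
    have h3 := DFunLike.congr_fun (hasMFDerivAt_unique h1 h2) v
    exact h3.trans ((congrArg Db hv).trans Db.map_zero)
  let l : ℝ → E := fun s => h.domChart x + s • w
  have hl0 : l 0 = h.domChart x := by simp [l]
  have hl : ContDiff ℝ ∞ l := contDiff_const.add (contDiff_id.smul contDiff_const)
  have hld : HasFDerivAt l ((1 : ℝ →L[ℝ] ℝ).smulRight w) 0 :=
    ((1 : ℝ →L[ℝ] ℝ).smulRight w).hasFDerivAt.const_add _
  have hltar : ∀ᶠ s in 𝓝 0, l s ∈ h.domChart.target := by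
    refine hl.continuous.continuousAt ?_
    rw [hl0]
    exact h.domChart.open_target.mem_nhds (h.domChart.map_source h.mem_domChart_source)
  have hds : ContMDiffAt 𝓘(ℝ, ℝ) 𝓘(ℝ, E) ∞ (fun s => h.domChart.symm (l s)) 0 :=
    ContMDiffAt.comp (0 : ℝ) (g := h.domChart.symm) (by rwa [hl0]) hl.contMDiff.contMDiffAt
  have hd0 : h.domChart.symm (l 0) = x := by rw [hl0, h.domChart.left_inv h.mem_domChart_source]
  refine ⟨fun s => h.domChart.symm (l s), hd0, hds, ?_, ?_⟩
  · have h1 : HasMFDerivAt 𝓘(ℝ, E) 𝓘(ℝ, E) h.domChart.symm (l 0) Ds := by rwa [hl0]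
    have h2 := DFunLike.congr_fun (h1.comp 0 hld.hasMFDerivAt).mfderiv (1 : ℝ)
    refine h2.trans (Eq.trans ?_ hsv)
    exact congrArg Ds (one_smul ℝ w)
  · have hcont : ∀ᶠ s in 𝓝 (0 : ℝ), f (h.domChart.symm (l s)) ∈ h.codChart.source := by
      refine (ContinuousAt.comp (g := f) (f := fun s => h.domChart.symm (l s)) ?_
        hds.continuousAt) ?_
      · rw [hd0]; exact h.contMDiffAt.continuousAt
      · simp only [Function.comp_apply]
        rw [hd0]; exact h.codChart.open_source.mem_nhds h.mem_codChart_source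
    filter_upwards [hcont, hltar] with s hs hs'
    refine h.codChart.injOn hs h.mem_codChart_source ?_
    rw [hw _ hs', hw' x h.mem_domChart_source]
    simp [l, hw1]

variable {k : ℕ} {EK : Type*} [NormedAddCommGroup EK] [NormedSpace ℝ EK] {K : Type*}
  [TopologicalSpace K] [ChartedSpace EK K] [Group K]
  {EP : Type*} [NormedAddCommGroup EP] [NormedSpace ℝ EP] {P : Type*} [TopologicalSpace P]
  [ChartedSpace EP P] [MulAction K P]
  {EQ : Type*} [NormedAddCommGroup EQ] [NormedSpace ℝ EQ]
  [ChartedSpace EQ (MulAction.orbitRel.Quotient K P)]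

lemma mfderiv_orbitProj_infGen
    (hact : ContMDiff (𝓘(ℝ, EK).prod 𝓘(ℝ, EP)) 𝓘(ℝ, EP) ∞ (fun q : K × P => q.1 • q.2))
    (hπ : ContMDiff 𝓘(ℝ, EP) 𝓘(ℝ, EQ) ∞ (orbitProj K (P := P)))
    (ξ : GroupLieAlgebra 𝓘(ℝ, EK) K) (p : P) :
    (mfderiv 𝓘(ℝ, EP) 𝓘(ℝ, EQ) (orbitProj K (P := P)) p (infGen ξ p : EP) : EQ) = 0 := by
  have h1 := mfderiv_comp (1 : K) (hπ.mdifferentiable (by simp) ((1 : K) • p))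
    ((contMDiff_smul_const_of_contMDiff_smul hact p).mdifferentiable (by simp) (1 : K))
  have h2 : (orbitProj K (P := P)) ∘ (fun g : K => g • p) = fun _ => orbitProj K p :=
    funext fun g => orbitProj_smul g p
  rw [h2, mfderiv_const] at h1
  have h3 : ∀ p' : P, p' = p → ∀ w : EP,
      (mfderiv 𝓘(ℝ, EP) 𝓘(ℝ, EQ) (orbitProj K (P := P)) p' w : EQ) =
        mfderiv 𝓘(ℝ, EP) 𝓘(ℝ, EQ) (orbitProj K (P := P)) p w := by
    rintro _ rfl _
    rfl
  exact (h3 _ (one_smul K p) _).symm.trans (DFunLike.congr_fun h1 ξ).symm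

/-- The kernel of `T π_P` consists of the vertical vectors: a curve in the fibre through `p` has the
form `g(s) · p` with a smooth curve `g` in the group. -/
lemma exists_infGen_eq_of_mfderiv_orbitProj_eq_zero [LieGroup 𝓘(ℝ, EK) ∞ K] [CompleteSpace EK]
    [IsManifold 𝓘(ℝ, EP) ∞ P]
    [IsManifold 𝓘(ℝ, EQ) ∞ (MulAction.orbitRel.Quotient K P)] [ProperSMul K P]
    (hfree : ∀ (g : K) (p : P), g • p = p → g = 1)
    (hact : ContMDiff (𝓘(ℝ, EK).prod 𝓘(ℝ, EP)) 𝓘(ℝ, EP) ∞ (fun q : K × P => q.1 • q.2))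
    (hπ : IsSubmersion 𝓘(ℝ, EP) 𝓘(ℝ, EQ) ∞ (orbitProj K (P := P)))
    (A : PrincipalConnection EK K EP P) {p : P} {v : TangentSpace 𝓘(ℝ, EP) p}
    (hv : mfderiv 𝓘(ℝ, EP) 𝓘(ℝ, EQ) (orbitProj K (P := P)) p v = 0) :
    ∃ ξ : GroupLieAlgebra 𝓘(ℝ, EK) K, (infGen ξ p : EP) = v := by
  obtain ⟨d, hd0, hd, hdv, hfib⟩ := (hπ.isSubmersionAt p).exists_curve_of_mfderiv_eq_zero hv
  have hex : ∀ s, ∃ g : K, orbitProj K (d s) = orbitProj K p → d s = g • p := fun s => by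
    by_cases h : orbitProj K (d s) = orbitProj K p
    · obtain ⟨g, hg⟩ := exists_smul_eq_of_orbitProj_eq h
      exact ⟨g, fun _ => hg.symm⟩
    · exact ⟨1, fun h' => absurd h' h⟩
  choose g hg using hex
  have hgd : ∀ᶠ s in 𝓝 (0 : ℝ), d s = g s • p := hfib.mono fun s hs => hg s hs
  have hgs := contMDiffAt_of_smul_eq hfree hact A (φ₁ := fun _ => p) contMDiffAt_const hd hgd
  have hg0 : g 0 = 1 := hfree _ p (hgd.self_of_nhds.symm.trans hd0)
  have h1 : HasMFDerivAt 𝓘(ℝ, EK) 𝓘(ℝ, EP) (fun g : K => g • p) (g 0)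
      (mfderiv 𝓘(ℝ, EK) 𝓘(ℝ, EP) (fun g : K => g • p) (g 0)) :=
    ((contMDiff_smul_const_of_contMDiff_smul hact p).mdifferentiable (by simp) _).hasMFDerivAt
  have h2 := (h1.comp 0 (hgs.mdifferentiableAt (by simp)).hasMFDerivAt).congr_of_eventuallyEq hgd
  have h3 : ∀ h : K, h = 1 → ∀ w : EK,
      (mfderiv 𝓘(ℝ, EK) 𝓘(ℝ, EP) (fun g : K => g • p) h w : EP) =
        infGen (EG := EK) (G := K) w p := by
    rintro _ rfl _
    rfl
  exact ⟨(mfderiv 𝓘(ℝ, ℝ) 𝓘(ℝ, EK) g 0 (1 : ℝ) : EK), (h3 _ hg0 _).symm.trans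
    ((DFunLike.congr_fun h2.mfderiv (1 : ℝ)).symm.trans hdv)⟩

end HorizontalLift

section HorizontalLiftField

open Set Manifold Filter Topology

variable {k : ℕ} {EK : Type*} [NormedAddCommGroup EK] [NormedSpace ℝ EK] {K : Type*}
  [TopologicalSpace K] [ChartedSpace EK K] [Group K] [LieGroup 𝓘(ℝ, EK) ∞ K]
  {EP : Type*} [NormedAddCommGroup EP] [NormedSpace ℝ EP] {P : Type*} [TopologicalSpace P]
  [ChartedSpace EP P] [MulAction K P] [IsManifold 𝓘(ℝ, EP) ∞ P]

/-- The vector field whose value at `p` is generated by `ξ p` is smooth if `ξ` is. -/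
lemma isSmoothVectorField_infGen
    (hact : ContMDiff (𝓘(ℝ, EK).prod 𝓘(ℝ, EP)) 𝓘(ℝ, EP) ∞ (fun q : K × P => q.1 • q.2))
    {ξ : P → EK} (hξ : ContMDiff 𝓘(ℝ, EP) 𝓘(ℝ, EK) ∞ ξ) :
    IsSmoothVectorField (fun p : P => (infGen (EG := EK) (G := K) (ξ p) p :
      TangentSpace 𝓘(ℝ, EP) p)) := by
  have : IsManifold 𝓘(ℝ, EK) ∞ K := inferInstance
  have : IsManifold 𝓘(ℝ, EK) 1 K := .of_le (n := ∞) (by simp)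
  have : IsManifold 𝓘(ℝ, EP) 1 P := .of_le (n := ∞) (by simp)
  have hone : ContMDiff 𝓘(ℝ, EP) 𝓘(ℝ, EK).tangent ∞
      (fun p : P => (⟨1, ξ p⟩ : TangentBundle 𝓘(ℝ, EK) K)) := fun p => by
    rw [Bundle.contMDiffAt_totalSpace]
    refine ⟨contMDiffAt_const, ?_⟩
    refine ContMDiffAt.congr_of_eventuallyEq (f := ξ) (hξ p) (.of_forall fun q => ?_)
    have hid : fderiv ℝ (chartAt EK (1 : K) ∘ (chartAt EK (1 : K)).symm) (chartAt EK (1 : K) 1) =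
        ContinuousLinearMap.id ℝ EK := by
      rw [← fderiv_id (𝕜 := ℝ) (x := chartAt EK (1 : K) 1)]
      refine EventuallyEq.fderiv_eq ?_
      filter_upwards [(chartAt EK (1 : K)).open_target.mem_nhds (mem_chart_target EK (1 : K))]
        with y hy using (chartAt EK (1 : K)).right_inv hy
    simpa [TangentBundle.trivializationAt_apply] using DFunLike.congr_fun hid (ξ q)
  have hzero : ContMDiff 𝓘(ℝ, EP) 𝓘(ℝ, EP).tangent ∞
      (fun p : P => (⟨p, 0⟩ : TangentBundle 𝓘(ℝ, EP) P)) :=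
    Bundle.contMDiff_zeroSection ℝ _
  have h1 := (contMDiff_equivTangentBundleProd_symm (n := ∞) (I := 𝓘(ℝ, EK)) (M := K)
    (I' := 𝓘(ℝ, EP)) (M' := P)).comp (hone.prodMk hzero)
  have h2 := (hact.contMDiff_tangentMap (m := ∞) (by simp)).comp h1
  have hbase : ∀ p p' : P, p' = p → ∀ w : EP, (⟨p, w⟩ : TangentBundle 𝓘(ℝ, EP) P) = ⟨p', w⟩ := by
    rintro _ _ rfl _
    rfl
  refine h2.congr fun p => ?_
  -- the infinitesimal action is the partial derivative of the action in the group variable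
  have h3 : HasMFDerivAt 𝓘(ℝ, EK) (𝓘(ℝ, EK).prod 𝓘(ℝ, EP)) (fun g : K => (g, p)) 1
      ((ContinuousLinearMap.id ℝ EK).prod (0 : EK →L[ℝ] EP)) :=
    (hasMFDerivAt_id (1 : K)).prodMk (hasMFDerivAt_const p (1 : K))
  have h4 := ((hact.mdifferentiable (by simp) ((1 : K), p)).hasMFDerivAt.comp (1 : K) h3).mfderiv
  refine (hbase p ((1 : K) • p) (one_smul K p) _).trans ?_
  exact congrArg (fun w : EP => (⟨(1 : K) • p, w⟩ : TangentBundle 𝓘(ℝ, EP) P))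
    (DFunLike.congr_fun h4 (ξ p))

variable {EQ : Type*} [NormedAddCommGroup EQ] [NormedSpace ℝ EQ]
  [ChartedSpace EQ (MulAction.orbitRel.Quotient K P)]

/-- A horizontal vector is determined by its projection to the orbit space. -/
lemma PrincipalConnection.eq_of_mfderiv_orbitProj_eq [CompleteSpace EK]
    [IsManifold 𝓘(ℝ, EQ) ∞ (MulAction.orbitRel.Quotient K P)] [ProperSMul K P]
    (hfree : ∀ (g : K) (p : P), g • p = p → g = 1)
    (hact : ContMDiff (𝓘(ℝ, EK).prod 𝓘(ℝ, EP)) 𝓘(ℝ, EP) ∞ (fun q : K × P => q.1 • q.2))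
    (hπ : IsSubmersion 𝓘(ℝ, EP) 𝓘(ℝ, EQ) ∞ (orbitProj K (P := P)))
    (A : PrincipalConnection EK K EP P) {p : P} {v w : TangentSpace 𝓘(ℝ, EP) p}
    (hv : A.form p v = 0) (hw : A.form p w = 0)
    (hvw : (mfderiv 𝓘(ℝ, EP) 𝓘(ℝ, EQ) (orbitProj K (P := P)) p v : EQ) =
      mfderiv 𝓘(ℝ, EP) 𝓘(ℝ, EQ) (orbitProj K (P := P)) p w) : v = w := by
  obtain ⟨ξ, hξ⟩ := exists_infGen_eq_of_mfderiv_orbitProj_eq_zero hfree hact hπ A (v := v - w)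
    ((map_sub _ v w).trans (sub_eq_zero.2 hvw))
  have h1 : ξ = 0 := by
    have h2 : A.form p (v - w) = ξ := (congrArg (A.form p) hξ).symm.trans (A.reproduces ξ p)
    rw [map_sub, hv, hw, sub_zero] at h2
    exact h2.symm
  have h3 : (infGen (EG := EK) (G := K) ξ p : EP) = 0 := by
    rw [h1]
    exact map_zero (mfderiv 𝓘(ℝ, EK) 𝓘(ℝ, EP) (fun g : K => g • p) 1)
  exact sub_eq_zero.1 (hξ.symm.trans h3)

variable [CompleteSpace EK]
    [IsManifold 𝓘(ℝ, EQ) ∞ (MulAction.orbitRel.Quotient K P)] [ProperSMul K P]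
    (hfree : ∀ (g : K) (p : P), g • p = p → g = 1)
    (hact : ContMDiff (𝓘(ℝ, EK).prod 𝓘(ℝ, EP)) 𝓘(ℝ, EP) ∞ (fun q : K × P => q.1 • q.2))
    (hπ : IsSubmersion 𝓘(ℝ, EP) 𝓘(ℝ, EQ) ∞ (orbitProj K (P := P)))
    (A : PrincipalConnection EK K EP P) {X : KVectorField k EP P}
    (hinv : ∀ (g : K) a p, tangentAct EP g p (X a p) = X a (g • p))

include hfree hact hπ hinv

/-- The horizontal lift exists: the horizontal part of `X` projects onto the reduced field. -/
lemma PrincipalConnection.horizontalLift_reducedKVF (a : Fin k) (p : P) :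
    A.form p (A.horizontalLift (reducedKVF K EQ X) a p) = 0 ∧
    (mfderiv 𝓘(ℝ, EP) 𝓘(ℝ, EQ) (orbitProj K (P := P)) p
      (A.horizontalLift (reducedKVF K EQ X) a p) : EQ) = reducedKVF K EQ X a (orbitProj K p) ∧
    A.horizontalLift (reducedKVF K EQ X) a p =
      X a p - (infGen (A.form p (X a p)) p : TangentSpace 𝓘(ℝ, EP) p) := by
  set w : TangentSpace 𝓘(ℝ, EP) p := X a p - (infGen (A.form p (X a p)) p : EP) with hw
  have h1 : A.form p w = 0 := by
    have h2 : A.form p w = A.form p (X a p) - A.form p (infGen (A.form p (X a p)) p) :=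
      map_sub _ _ _
    rw [h2, A.reproduces, sub_self]
  have h2 : (mfderiv 𝓘(ℝ, EP) 𝓘(ℝ, EQ) (orbitProj K (P := P)) p w : EQ) =
      reducedKVF K EQ X a (orbitProj K p) := by
    let L : EP →L[ℝ] EQ := mfderiv 𝓘(ℝ, EP) 𝓘(ℝ, EQ) (orbitProj K (P := P)) p
    have h3 : L w = L (X a p) - L (infGen (A.form p (X a p)) p) := map_sub L _ _
    have h4 : L (infGen (A.form p (X a p)) p) = 0 :=
      mfderiv_orbitProj_infGen hact hπ.contMDiff _ p
    rw [h4, sub_zero] at h3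
    exact h3.trans (mfderiv_orbitProj_apply hact hπ.contMDiff hinv a p)
  have h3 : A.form p (A.horizontalLift (reducedKVF K EQ X) a p) = 0 ∧
      mfderiv 𝓘(ℝ, EP) 𝓘(ℝ, EQ) (orbitProj K (P := P)) p
        (A.horizontalLift (reducedKVF K EQ X) a p) = reducedKVF K EQ X a (orbitProj K p) :=
    Classical.epsilon_spec (p := fun w : TangentSpace 𝓘(ℝ, EP) p => A.form p w = 0 ∧
      mfderiv 𝓘(ℝ, EP) 𝓘(ℝ, EQ) (orbitProj K (P := P)) p w =
        reducedKVF K EQ X a (orbitProj K p)) ⟨w, h1, h2⟩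
  exact ⟨h3.1, h3.2, A.eq_of_mfderiv_orbitProj_eq hfree hact hπ h3.1 h1 (h3.2.trans h2.symm)⟩

lemma PrincipalConnection.tangentAct_horizontalLift (g : K) (a : Fin k) (p : P) :
    tangentAct EP g p (A.horizontalLift (reducedKVF K EQ X) a p) =
      A.horizontalLift (reducedKVF K EQ X) a (g • p) := by
  refine A.eq_of_mfderiv_orbitProj_eq (EQ := EQ) hfree hact hπ ?_
    (A.horizontalLift_reducedKVF hfree hact hπ hinv a _).1 ?_
  · rw [A.equivariant, (A.horizontalLift_reducedKVF hfree hact hπ hinv a p).1]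
    exact map_zero (Ad EK g)
  · refine (mfderiv_orbitProj_tangentAct hact hπ.contMDiff g p _).trans
      ((A.horizontalLift_reducedKVF hfree hact hπ hinv a p).2.1.trans
        (Eq.trans ?_ (A.horizontalLift_reducedKVF hfree hact hπ hinv a (g • p)).2.1.symm))
    rw [orbitProj_smul]

lemma PrincipalConnection.isSmoothVectorField_horizontalLift
    (hX : ∀ a, IsSmoothVectorField (X a)) (a : Fin k) :
    IsSmoothVectorField (A.horizontalLift (reducedKVF K EQ X) a) := by
  have h1 : ContMDiff (M' := EK) 𝓘(ℝ, EP) 𝓘(ℝ, EK) ∞ (fun p => (A.form p (X a p) : EK)) :=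
    A.smooth.comp (hX a)
  have h2 := ContMDiff.sub_section (hX a) (isSmoothVectorField_infGen hact h1)
  refine h2.congr fun p => ?_
  rw [(A.horizontalLift_reducedKVF hfree hact hπ hinv a p).2.2]
  rfl

end HorizontalLiftField

/-! ### The reconstruction equation -/

section Reconstruction

open Set Manifold Filter Topology

variable {k : ℕ} {EK : Type*} [NormedAddCommGroup EK] [NormedSpace ℝ EK] {K : Type*}
  [TopologicalSpace K] [ChartedSpace EK K] [Group K] [LieGroup 𝓘(ℝ, EK) ∞ K]
  {EP : Type*} [NormedAddCommGroup EP] [NormedSpace ℝ EP] {P : Type*} [TopologicalSpace P]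
  [ChartedSpace EP P] [MulAction K P]

/-- The derivative of an orbit map at `g`, by left translation from its derivative at `1`. -/
lemma mfderiv_smul_const_apply
    (hact : ContMDiff (𝓘(ℝ, EK).prod 𝓘(ℝ, EP)) 𝓘(ℝ, EP) ∞ (fun q : K × P => q.1 • q.2))
    (g : K) (p : P) (w : EK) :
    (mfderiv 𝓘(ℝ, EK) 𝓘(ℝ, EP) (fun h : K => h • p) g w : EP) =
      tangentAct EP g p (infGen (EG := EK) (G := K)
        (mfderiv 𝓘(ℝ, EK) 𝓘(ℝ, EK) (fun h : K => g⁻¹ * h) g w : EK) p : EP) := by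
  let l : K → K := fun h => g⁻¹ * h
  have hl : ContMDiff 𝓘(ℝ, EK) 𝓘(ℝ, EK) ∞ l := contMDiff_const.mul contMDiff_id
  have h1 : HasMFDerivAt 𝓘(ℝ, EK) 𝓘(ℝ, EK) l g (mfderiv 𝓘(ℝ, EK) 𝓘(ℝ, EK) l g) :=
    (hl.mdifferentiable (by simp) g).hasMFDerivAt
  have hlg : l g = 1 := inv_mul_cancel g
  have hb : ∀ h : K, h = 1 → HasMFDerivAt 𝓘(ℝ, EK) 𝓘(ℝ, EP) (fun h : K => h • p) h
      (mfderiv 𝓘(ℝ, EK) 𝓘(ℝ, EP) (fun h : K => h • p) 1 : EK →L[ℝ] EP) := by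
    rintro _ rfl
    exact ((contMDiff_smul_const_of_contMDiff_smul hact p).mdifferentiable
      (by simp) (1 : K)).hasMFDerivAt
  have hc : ∀ q : P, q = p → HasMFDerivAt 𝓘(ℝ, EP) 𝓘(ℝ, EP) (fun y : P => g • y) q
      (tangentAct EP g p : EP →L[ℝ] EP) := by
    rintro _ rfl
    exact ((contMDiff_const_smul_of_contMDiff_smul hact g).mdifferentiable
      (by simp) _).hasMFDerivAt
  have h2 := ((hc (l g • p) (by rw [hlg, one_smul])).comp (l g) (hb (l g) hlg)).comp g h1
  have h3 : ((fun y : P => g • y) ∘ fun h : K => h • p) ∘ l = fun h : K => h • p := by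
    funext h
    simp [l, smul_smul]
  rw [h3] at h2
  exact DFunLike.congr_fun h2.mfderiv w

/-- The Leibniz rule for `g(t) · φ(t)`. -/
lemma partialAt_smul
    (hact : ContMDiff (𝓘(ℝ, EK).prod 𝓘(ℝ, EP)) 𝓘(ℝ, EP) ∞ (fun q : K × P => q.1 • q.2))
    {g : EuclideanSpace ℝ (Fin k) → K} {φ : EuclideanSpace ℝ (Fin k) → P}
    {t : EuclideanSpace ℝ (Fin k)}
    (hg : MDifferentiableAt 𝓘(ℝ, EuclideanSpace ℝ (Fin k)) 𝓘(ℝ, EK) g t)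
    (hφ : MDifferentiableAt 𝓘(ℝ, EuclideanSpace ℝ (Fin k)) 𝓘(ℝ, EP) φ t) (a : Fin k) :
    (partialAt EP (fun s => g s • φ s) t a : EP) =
      tangentAct EP (g t) (φ t) ((partialAt EP φ t a : EP) + infGen (EG := EK) (G := K)
        (mfderiv 𝓘(ℝ, EK) 𝓘(ℝ, EK) (fun h : K => (g t)⁻¹ * h) (g t) (partialAt EK g t a) : EK)
        (φ t)) := by
  let D : EK × EP →L[ℝ] EP := mfderiv (𝓘(ℝ, EK).prod 𝓘(ℝ, EP)) 𝓘(ℝ, EP)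
    (fun q : K × P => q.1 • q.2) (g t, φ t)
  have hD : HasMFDerivAt (𝓘(ℝ, EK).prod 𝓘(ℝ, EP)) 𝓘(ℝ, EP) (fun q : K × P => q.1 • q.2)
      (g t, φ t) D := (hact.mdifferentiable (by simp) _).hasMFDerivAt
  let u : EK := partialAt EK g t a
  let v : EP := partialAt EP φ t a
  have h0 : HasMFDerivAt 𝓘(ℝ, EuclideanSpace ℝ (Fin k)) 𝓘(ℝ, EP) (fun s => g s • φ s) t _ :=
    HasMFDerivAt.comp t (f := fun s => (g s, φ s)) hD (hg.hasMFDerivAt.prodMk hφ.hasMFDerivAt)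
  have h1 : (partialAt EP (fun s => g s • φ s) t a : EP) = D (u, v) :=
    DFunLike.congr_fun h0.mfderiv (EuclideanSpace.single a (1 : ℝ))
  have h2 : (tangentAct EP (g t) (φ t) v : EP) = D (0, v) :=
    DFunLike.congr_fun (hD.comp (φ t) ((hasMFDerivAt_const (g t) (φ t)).prodMk
      (hasMFDerivAt_id (φ t)))).mfderiv v
  have h3 : (mfderiv 𝓘(ℝ, EK) 𝓘(ℝ, EP) (fun h : K => h • φ t) (g t) u : EP) = D (u, 0) :=
    DFunLike.congr_fun (hD.comp (g t) ((hasMFDerivAt_id (g t)).prodMk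
      (hasMFDerivAt_const (φ t) (g t)))).mfderiv u
  have h4 : D (u, v) = D (0, v) + D (u, 0) := by
    rw [← map_add, Prod.mk_add_mk, zero_add, add_zero]
  have h5 := mfderiv_smul_const_apply hact (g t) (φ t) u
  refine h1.trans (h4.trans ?_)
  rw [← h2, ← h3, h5]
  exact (map_add (tangentAct EP (g t) (φ t) : EP →L[ℝ] EP) _ _).symm

variable [IsManifold 𝓘(ℝ, EP) ∞ P] {EQ : Type*} [NormedAddCommGroup EQ] [NormedSpace ℝ EQ]
  [ChartedSpace EQ (MulAction.orbitRel.Quotient K P)] [CompleteSpace EK]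
  [IsManifold 𝓘(ℝ, EQ) ∞ (MulAction.orbitRel.Quotient K P)] [ProperSMul K P]

/-- If `φₕ` is an integral section of the horizontal lift of the reduced field of `X`, then the
reconstruction equation says that `g(t) · φₕ(t)` is an integral section of `X`. -/
theorem PrincipalConnection.solvesReconstruction_iff
    (hfree : ∀ (g : K) (p : P), g • p = p → g = 1)
    (hact : ContMDiff (𝓘(ℝ, EK).prod 𝓘(ℝ, EP)) 𝓘(ℝ, EP) ∞ (fun q : K × P => q.1 • q.2))
    (hπ : IsSubmersion 𝓘(ℝ, EP) 𝓘(ℝ, EQ) ∞ (orbitProj K (P := P)))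
    (A : PrincipalConnection EK K EP P) {X : KVectorField k EP P}
    (hinv : ∀ (g : K) a p, tangentAct EP g p (X a p) = X a (g • p))
    {φh : EuclideanSpace ℝ (Fin k) → P}
    (hφh : IsIntegralSection (A.horizontalLift (reducedKVF K EQ X)) φh)
    {g : EuclideanSpace ℝ (Fin k) → K}
    (hg : ContMDiff 𝓘(ℝ, EuclideanSpace ℝ (Fin k)) 𝓘(ℝ, EK) ∞ g) :
    A.SolvesReconstruction X φh g ↔ IsIntegralSection X (fun t => g t • φh t) := by
  have hφs : ContMDiff 𝓘(ℝ, EuclideanSpace ℝ (Fin k)) 𝓘(ℝ, EP) ∞ φh := contMDiffOn_univ.1 hφh.1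
  have hsmul : ContMDiff 𝓘(ℝ, EuclideanSpace ℝ (Fin k)) 𝓘(ℝ, EP) ∞ (fun t => g t • φh t) :=
    hact.comp (hg.prodMk hφs)
  -- `ζ` is the left-translated velocity of `g`
  let ζ : EuclideanSpace ℝ (Fin k) → Fin k → EK := fun t a =>
    mfderiv 𝓘(ℝ, EK) 𝓘(ℝ, EK) (fun h : K => (g t)⁻¹ * h) (g t) (partialAt EK g t a)
  have hpart : ∀ t a, (partialAt EP (fun s => g s • φh s) t a : EP) =
      tangentAct EP (g t) (φh t) ((A.horizontalLift (reducedKVF K EQ X) a (φh t) : EP) +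
        infGen (EG := EK) (G := K) (ζ t a) (φh t)) := fun t a => by
    rw [partialAt_smul hact (hg.mdifferentiable (by simp) t) (hφs.mdifferentiable (by simp) t) a]
    let L : EP →L[ℝ] EP := tangentAct EP (g t) (φh t)
    let w : EP := infGen (EG := EK) (G := K) (ζ t a) (φh t)
    exact congrArg (fun v : EP => L (v + w)) (hφh.2 t (mem_univ t) a)
  have hlift : ∀ t a, ((A.horizontalLift (reducedKVF K EQ X) a (φh t) : EP) +
        infGen (EG := EK) (G := K) (A.form (φh t) (X a (φh t))) (φh t)) = X a (φh t) :=
    fun t a => by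
      rw [(A.horizontalLift_reducedKVF hfree hact hπ hinv a (φh t)).2.2]
      exact sub_add_cancel (X a (φh t) : EP) _
  constructor
  · rintro ⟨-, hsol⟩
    refine ⟨contMDiffOn_univ.2 hsmul, fun t _ a => ?_⟩
    have h1 : ζ t a = A.form (φh t) (X a (φh t)) := hsol t a
    refine (hpart t a).trans ?_
    rw [h1]
    exact (congrArg (fun v : EP => (tangentAct EP (g t) (φh t) v : EP)) (hlift t a)).trans
      (hinv (g t) a (φh t))
  · intro hX
    refine ⟨hg, fun t a => ?_⟩
    have h1 := (hpart t a).symm.trans ((hX.2 t (mem_univ t) a).trans (hinv (g t) a (φh t)).symm)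
    -- apply the connection form, which intertwines `tangentAct` and the injective map `Ad`
    have h2 : Ad EK (g t) (ζ t a) = Ad EK (g t) (A.form (φh t) (X a (φh t)) : EK) := by
      have h3 := congrArg (fun v : EP => (A.form (g t • φh t) v : EK)) h1
      refine Eq.trans ?_ (h3.trans (A.equivariant (g t) (φh t) (X a (φh t))))
      refine Eq.trans ?_ (A.equivariant (g t) (φh t) _).symm
      refine congrArg (Ad EK (g t)) ?_
      refine Eq.trans ?_ (map_add (A.form (φh t)) _ _).symm
      have h4 := (A.horizontalLift_reducedKVF hfree hact hπ hinv a (φh t)).1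
      exact (zero_add _).symm.trans (congrArg₂ (fun x y : EK => x + y) h4.symm
        (A.reproduces (ζ t a) (φh t)).symm)
    have h5 : ∀ v : EK, Ad EK (g t)⁻¹ (Ad EK (g t) v) = v := fun v => by
      have h6 := DFunLike.congr_fun (Ad_mul (EG := EK) (g t)⁻¹ (g t)) v
      rw [inv_mul_cancel, Ad_one] at h6
      exact h6.symm
    exact (h5 _).symm.trans ((congrArg (Ad EK (g t)⁻¹) h2).trans (h5 _))

/-- Two smooth maps over the same map to the orbit space differ by a smooth map to the group. -/
lemma exists_contMDiff_smul_eq {T : Type*} [NormedAddCommGroup T] [NormedSpace ℝ T]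
    [CompleteSpace T] (hfree : ∀ (g : K) (p : P), g • p = p → g = 1)
    (hact : ContMDiff (𝓘(ℝ, EK).prod 𝓘(ℝ, EP)) 𝓘(ℝ, EP) ∞ (fun q : K × P => q.1 • q.2))
    (A : PrincipalConnection EK K EP P) {φ₁ φ₂ : T → P}
    (h₁ : ContMDiff 𝓘(ℝ, T) 𝓘(ℝ, EP) ∞ φ₁) (h₂ : ContMDiff 𝓘(ℝ, T) 𝓘(ℝ, EP) ∞ φ₂)
    (h : ∀ t, orbitProj K (φ₂ t) = orbitProj K (φ₁ t)) :
    ∃ g : T → K, ContMDiff 𝓘(ℝ, T) 𝓘(ℝ, EK) ∞ g ∧ ∀ t, φ₂ t = g t • φ₁ t := by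
  choose g hg using fun t => exists_smul_eq_of_orbitProj_eq (h t)
  exact ⟨g, fun t => contMDiffAt_of_smul_eq hfree hact A (h₁ t) (h₂ t)
    (.of_forall fun s => (hg s).symm), fun t => (hg t).symm⟩

end Reconstruction

/-! ### Lifting integral sections -/

section Lifting

open Set Manifold Filter Topology Metric

variable {k : ℕ} {EK : Type*} [NormedAddCommGroup EK] [NormedSpace ℝ EK] {K : Type*}
  [TopologicalSpace K] [ChartedSpace EK K] [Group K]
  {EP : Type*} [NormedAddCommGroup EP] [NormedSpace ℝ EP] {P : Type*} [TopologicalSpace P]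
  [ChartedSpace EP P] [MulAction K P] [IsManifold 𝓘(ℝ, EP) ∞ P]
  {EQ : Type*} [NormedAddCommGroup EQ] [NormedSpace ℝ EQ]
  [ChartedSpace EQ (MulAction.orbitRel.Quotient K P)]
  [IsManifold 𝓘(ℝ, EQ) ∞ (MulAction.orbitRel.Quotient K P)]

lemma isSmoothVectorField_reducedKVF
    (hact : ContMDiff (𝓘(ℝ, EK).prod 𝓘(ℝ, EP)) 𝓘(ℝ, EP) ∞ (fun q : K × P => q.1 • q.2))
    (hπ : IsSubmersion 𝓘(ℝ, EP) 𝓘(ℝ, EQ) ∞ (orbitProj K (P := P)))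
    {X : KVectorField k EP P} (hX : ∀ a, IsSmoothVectorField (X a))
    (hinv : ∀ (g : K) a p, tangentAct EP g p (X a p) = X a (g • p)) (a : Fin k) :
    IsSmoothVectorField (reducedKVF K EQ X a) :=
  hπ.contMDiff_of_related orbitProj_surjective (hX a)
    (mfderiv_orbitProj_apply hact hπ.contMDiff hinv a)

variable [CompleteSpace EP] [T2Space P] [CompleteSpace EQ]
  [T2Space (MulAction.orbitRel.Quotient K P)]

/-- If the connection `H(X, φ̄)` is flat, then `φ̄` lifts to an integral section of `X`. -/
theorem exists_integralSection_lift_of_isFlat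
    (hact : ContMDiff (𝓘(ℝ, EK).prod 𝓘(ℝ, EP)) 𝓘(ℝ, EP) ∞ (fun q : K × P => q.1 • q.2))
    (hπ : IsSubmersion 𝓘(ℝ, EP) 𝓘(ℝ, EQ) ∞ (orbitProj K (P := P)))
    {X : KVectorField k EP P} (hX : ∀ a, IsSmoothVectorField (X a))
    (hinv : ∀ (g : K) a p, tangentAct EP g p (X a p) = X a (g • p))
    {φbar : EuclideanSpace ℝ (Fin k) → MulAction.orbitRel.Quotient K P}
    (hφbar : IsIntegralSection (reducedKVF K EQ X) φbar)
    {EB : Type*} [NormedAddCommGroup EB] [NormedSpace ℝ EB] [CompleteSpace EB]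
    [ChartedSpace EB (PullbackBundle φbar)] [IsManifold 𝓘(ℝ, EB) ∞ (PullbackBundle φbar)]
    (hB : IsSmoothEmbedding 𝓘(ℝ, EB) (𝓘(ℝ, EuclideanSpace ℝ (Fin k)).prod 𝓘(ℝ, EP)) ∞
      (PullbackBundle.incl φbar))
    (hflat : IsFlat (horizontalDist X φbar EB) (verticalDist φbar EB)) :
    ∃ φ, IsIntegralSection X φ ∧ ∀ t, orbitProj K (φ t) = φbar t :=
  have hZ := isSmoothVectorField_reducedKVF hact hπ hX hinv
  have hXZ := mfderiv_orbitProj_apply hact hπ.contMDiff hinv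
  exists_integralSection_lift_of_invariant hact hπ.contMDiff hX hinv hZ hXZ hφbar
    (exists_integralSectionOn_of_isFlat hπ.contMDiff hX hZ hXZ hφbar hB hflat)

/-- If the horizontal lift of the reduced field is integrable, then `φ̄` has a horizontal lift. -/
theorem PrincipalConnection.exists_isHorizontalLiftOf [LieGroup 𝓘(ℝ, EK) ∞ K] [CompleteSpace EK]
    [ProperSMul K P] (hfree : ∀ (g : K) (p : P), g • p = p → g = 1)
    (hact : ContMDiff (𝓘(ℝ, EK).prod 𝓘(ℝ, EP)) 𝓘(ℝ, EP) ∞ (fun q : K × P => q.1 • q.2))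
    (hπ : IsSubmersion 𝓘(ℝ, EP) 𝓘(ℝ, EQ) ∞ (orbitProj K (P := P)))
    (A : PrincipalConnection EK K EP P) {X : KVectorField k EP P}
    (hX : ∀ a, IsSmoothVectorField (X a))
    (hinv : ∀ (g : K) a p, tangentAct EP g p (X a p) = X a (g • p))
    {φbar : EuclideanSpace ℝ (Fin k) → MulAction.orbitRel.Quotient K P}
    (hφbar : IsIntegralSection (reducedKVF K EQ X) φbar)
    (hint : IsIntegrable (A.horizontalLift (reducedKVF K EQ X))) :
    ∃ φh, A.IsHorizontalLiftOf (reducedKVF K EQ X) φh φbar := by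
  refine exists_integralSection_lift_of_invariant hact hπ.contMDiff
    (A.isSmoothVectorField_horizontalLift hfree hact hπ hinv hX)
    (A.tangentAct_horizontalLift hfree hact hπ hinv)
    (isSmoothVectorField_reducedKVF hact hπ hX hinv)
    (fun a p => (A.horizontalLift_reducedKVF hfree hact hπ hinv a p).2.1) hφbar
    fun t₀ p _ => ?_
  obtain ⟨U, ψ, hU, h0, hψ0, hψ⟩ := hint p
  obtain ⟨r, hr, hrU⟩ := Metric.isOpen_iff.1 hU 0 h0
  refine ⟨r, hr, fun t => ψ (t - t₀), by simp [hψ0],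
    (hψ.comp_sub hU t₀).mono fun t ht => hrU ?_⟩
  simpa [dist_eq_norm] using ht

end Lifting

/-! ### The level set of the momentum map -/

section Level

open Set Manifold Filter Topology Metric

variable {k : ℕ} {EN : Type*} [NormedAddCommGroup EN] [NormedSpace ℝ EN]
  {N : Type*} [TopologicalSpace N] [ChartedSpace EN N]
  {EG : Type*} [NormedAddCommGroup EG] [NormedSpace ℝ EG]
  {G : Type*} [TopologicalSpace G] [ChartedSpace EG G]
  [Group G] [MulAction G N]
  {S : PolyHamiltonianSpace k EN N EG G} {μ : Fin k → EG →L[ℝ] ℝ}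
  {EP : Type*} [NormedAddCommGroup EP] [NormedSpace ℝ EP]
  [ChartedSpace EP (S.Level μ)]

/-- The restricted action of `G_μ` on the level set is smooth, as both are embedded. -/
lemma PolyHamiltonianSpace.contMDiff_level_smul [LieGroup 𝓘(ℝ, EG) ∞ G]
    (hP : IsSmoothEmbedding 𝓘(ℝ, EP) 𝓘(ℝ, EN) ∞ (S.incl μ))
    {EGμ : Type*} [NormedAddCommGroup EGμ] [NormedSpace ℝ EGμ]
    [ChartedSpace EGμ (isotropyK EG G μ)] [IsManifold 𝓘(ℝ, EGμ) ∞ (isotropyK EG G μ)]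
    (hGμ : IsSmoothEmbedding 𝓘(ℝ, EGμ) 𝓘(ℝ, EG) ∞ (Subtype.val : isotropyK EG G μ → G)) :
    ContMDiff (𝓘(ℝ, EGμ).prod 𝓘(ℝ, EP)) 𝓘(ℝ, EP) ∞
      (fun q : isotropyK EG G μ × S.Level μ => q.1 • q.2) := by
  have h1 : ContMDiff (𝓘(ℝ, EGμ).prod 𝓘(ℝ, EP)) 𝓘(ℝ, EN) ∞
      (S.incl μ ∘ fun q : isotropyK EG G μ × S.Level μ => q.1 • q.2) :=
    S.contMDiff_smul.comp ((hGμ.contMDiff.comp contMDiff_fst).prodMk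
      (hP.contMDiff.comp contMDiff_snd))
  exact (ContMDiff.iff_comp_isImmersion hP.isImmersion).2
    ⟨hP.isEmbedding.continuous_iff.2 h1.continuous, h1⟩

lemma PolyHamiltonianSpace.mfderiv_incl_restrict {X : KVectorField k EN N}
    (hXtan : S.IsTangent μ EP X) (a : Fin k) (x : S.Level μ) :
    mfderiv 𝓘(ℝ, EP) 𝓘(ℝ, EN) (S.incl μ) x (S.restrict μ EP X a x) = X a (S.incl μ x) :=
  Classical.epsilon_spec (p := fun w : TangentSpace 𝓘(ℝ, EP) x =>
    mfderiv 𝓘(ℝ, EP) 𝓘(ℝ, EN) (S.incl μ) x w = X a (S.incl μ x)) (hXtan a x)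

lemma PolyHamiltonianSpace.isSmoothVectorField_restrict [IsManifold 𝓘(ℝ, EN) ∞ N]
    [IsManifold 𝓘(ℝ, EP) ∞ (S.Level μ)]
    (hP : IsSmoothEmbedding 𝓘(ℝ, EP) 𝓘(ℝ, EN) ∞ (S.incl μ))
    {X : KVectorField k EN N}
    (hX : ∀ a, IsSmoothVectorField (X a)) (hXtan : S.IsTangent μ EP X) (a : Fin k) :
    IsSmoothVectorField (S.restrict μ EP X a) :=
  hP.isImmersion.contMDiff_of_related (hX a) (S.mfderiv_incl_restrict hXtan a)

lemma PolyHamiltonianSpace.tangentAct_restrict [LieGroup 𝓘(ℝ, EG) ∞ G]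
    [IsManifold 𝓘(ℝ, EN) ∞ N] [IsManifold 𝓘(ℝ, EP) ∞ (S.Level μ)]
    (hP : IsSmoothEmbedding 𝓘(ℝ, EP) 𝓘(ℝ, EN) ∞ (S.incl μ))
    {EGμ : Type*} [NormedAddCommGroup EGμ] [NormedSpace ℝ EGμ]
    [ChartedSpace EGμ (isotropyK EG G μ)] [IsManifold 𝓘(ℝ, EGμ) ∞ (isotropyK EG G μ)]
    (hGμ : IsSmoothEmbedding 𝓘(ℝ, EGμ) 𝓘(ℝ, EG) ∞ (Subtype.val : isotropyK EG G μ → G))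
    {X : KVectorField k EN N} (hXtan : S.IsTangent μ EP X)
    (hXinv : IsInvariantUnder (isotropyK EG G μ) X) (g : isotropyK EG G μ) (a : Fin k)
    (x : S.Level μ) :
    tangentAct EP g x (S.restrict μ EP X a x) = S.restrict μ EP X a (g • x) := by
  have hsm := contMDiff_const_smul_of_contMDiff_smul (S.contMDiff_level_smul hP hGμ) g
  have h1 := mfderiv_comp x (hP.contMDiff.mdifferentiable (by simp) (g • x))
    (hsm.mdifferentiable (by simp) x)
  have h2 := mfderiv_comp x
    ((contMDiff_const_smul_of_contMDiff_smul S.contMDiff_smul (g : G)).mdifferentiable (by simp)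
      (S.incl μ x)) (hP.contMDiff.mdifferentiable (by simp) x)
  have h3 : (S.incl μ ∘ fun y : S.Level μ => g • y) =
      (fun y : N => (g : G) • y) ∘ S.incl μ := rfl
  rw [h3] at h1
  have h4 := DFunLike.congr_fun (h1.symm.trans h2) (S.restrict μ EP X a x)
  refine (hP.isImmersion.isImmersionAt (g • x)).mfderiv_injective ?_
  refine Eq.trans h4 (Eq.trans ?_ (S.mfderiv_incl_restrict hXtan a (g • x)).symm)
  refine Eq.trans ?_ (hXinv g g.2 a (S.incl μ x))
  exact congrArg (fun v : EN => (tangentAct EN (g : G) (S.incl μ x) v : EN))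
    (S.mfderiv_incl_restrict hXtan a x)

end Level

theorem mainTheorem3 {k : ℕ}
    -- the polysymplectic manifold `N` with its Lie group action and momentum map
    {EN : Type*} [NormedAddCommGroup EN] [NormedSpace ℝ EN] [FiniteDimensional ℝ EN]
    {N : Type*} [TopologicalSpace N] [T2Space N] [SecondCountableTopology N] [ChartedSpace EN N]
    [IsManifold 𝓘(ℝ, EN) ∞ N]
    {EG : Type*} [NormedAddCommGroup EG] [NormedSpace ℝ EG] [FiniteDimensional ℝ EG]
    {G : Type*} [TopologicalSpace G] [T2Space G] [SecondCountableTopology G] [ChartedSpace EG G]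
    [Group G] [LieGroup 𝓘(ℝ, EG) ∞ G] [MulAction G N]
    (S : PolyHamiltonianSpace k EN N EG G) (μ : Fin k → EG →L[ℝ] ℝ)
    (hreg : S.IsRegularValue μ)
    -- the smooth structure of the closed subgroup `G_μ` as an embedded Lie subgroup
    {EGμ : Type*} [NormedAddCommGroup EGμ] [NormedSpace ℝ EGμ] [FiniteDimensional ℝ EGμ]
    [ChartedSpace EGμ (isotropyK EG G μ)] [LieGroup 𝓘(ℝ, EGμ) ∞ (isotropyK EG G μ)]
    (hGμ : Manifold.IsSmoothEmbedding 𝓘(ℝ, EGμ) 𝓘(ℝ, EG) ∞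
      (Subtype.val : isotropyK EG G μ → G))
    -- the smooth structure of `J⁻¹(μ)` as an embedded submanifold of `N`
    {EP : Type*} [NormedAddCommGroup EP] [NormedSpace ℝ EP] [FiniteDimensional ℝ EP]
    [ChartedSpace EP (S.Level μ)] [IsManifold 𝓘(ℝ, EP) ∞ (S.Level μ)]
    (hP : Manifold.IsSmoothEmbedding 𝓘(ℝ, EP) 𝓘(ℝ, EN) ∞ (S.incl μ))
    (hC1 : S.CondC1 μ EP) (hC2 : S.CondC2 μ EP)
    (hfree : ∀ (g : isotropyK EG G μ) (x : S.Level μ), g • x = x → g = 1)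
    (hproper : ProperSMul (isotropyK EG G μ) (S.Level μ))
    -- the smooth structure of `N_μ = J⁻¹(μ)/G_μ` for which the projection is a submersion
    {EQ : Type*} [NormedAddCommGroup EQ] [NormedSpace ℝ EQ] [FiniteDimensional ℝ EQ]
    [ChartedSpace EQ (MulAction.orbitRel.Quotient (isotropyK EG G μ) (S.Level μ))]
    [IsManifold 𝓘(ℝ, EQ) ∞ (MulAction.orbitRel.Quotient (isotropyK EG G μ) (S.Level μ))]
    (hπ : Manifold.IsSubmersion 𝓘(ℝ, EP) 𝓘(ℝ, EQ) ∞
      (orbitProj (isotropyK EG G μ) (P := S.Level μ)))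
    -- the invariant Hamiltonian and the `k`-vector field
    (H : N → ℝ) (hH : ContMDiff 𝓘(ℝ, EN) 𝓘(ℝ, ℝ) ∞ H) (hHinv : ∀ (g : G) (x : N), H (g • x) = H x)
    (X : KVectorField k EN N) (hX : ∀ a, IsSmoothVectorField (X a))
    (hXH : IsKSymplecticSolution S.form H X)
    (hXinv : IsInvariantUnder (isotropyK EG G μ) X)
    (hXtan : S.IsTangent μ EP X)
    -- the integral section of the reduced `k`-vector field
    (φbar : EuclideanSpace ℝ (Fin k) →
      MulAction.orbitRel.Quotient (isotropyK EG G μ) (S.Level μ))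
    (hφbar : IsIntegralSection
      (reducedKVF (isotropyK EG G μ) EQ (S.restrict μ EP X)) φbar)
    -- the smooth structure of the pullback bundle as an embedded submanifold of `ℝᵏ × J⁻¹(μ)`
    {EB : Type*} [NormedAddCommGroup EB] [NormedSpace ℝ EB] [FiniteDimensional ℝ EB]
    [ChartedSpace EB (PullbackBundle φbar)] [IsManifold 𝓘(ℝ, EB) ∞ (PullbackBundle φbar)]
    (hB : Manifold.IsSmoothEmbedding 𝓘(ℝ, EB)
      (𝓘(ℝ, EuclideanSpace ℝ (Fin k)).prod 𝓘(ℝ, EP)) ∞ (PullbackBundle.incl φbar))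
    (hflat : IsFlat (horizontalDist (S.restrict μ EP X) φbar EB) (verticalDist φbar EB)) :
    (∃ φ : EuclideanSpace ℝ (Fin k) → S.Level μ,
      IsIntegralSection (S.restrict μ EP X) φ ∧
        ∀ t, orbitProj (isotropyK EG G μ) (φ t) = φbar t) ∧
    ∀ A : PrincipalConnection EGμ (isotropyK EG G μ) EP (S.Level μ),
      IsIntegrable (A.horizontalLift
        (reducedKVF (isotropyK EG G μ) EQ (S.restrict μ EP X))) →
      (∃ φh : EuclideanSpace ℝ (Fin k) → S.Level μ,
        A.IsHorizontalLiftOf (reducedKVF (isotropyK EG G μ) EQ (S.restrict μ EP X)) φh φbar) ∧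
      ∀ φh : EuclideanSpace ℝ (Fin k) → S.Level μ,
        A.IsHorizontalLiftOf (reducedKVF (isotropyK EG G μ) EQ (S.restrict μ EP X)) φh φbar →
        (∃ g : EuclideanSpace ℝ (Fin k) → isotropyK EG G μ,
          A.SolvesReconstruction (S.restrict μ EP X) φh g) ∧
        (∀ g : EuclideanSpace ℝ (Fin k) → isotropyK EG G μ,
          A.SolvesReconstruction (S.restrict μ EP X) φh g →
          IsIntegralSection (S.restrict μ EP X) (fun t => g t • φh t) ∧
            ∀ t, orbitProj (isotropyK EG G μ) (g t • φh t) = φbar t) ∧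
        (∀ φ : EuclideanSpace ℝ (Fin k) → S.Level μ,
          IsIntegralSection (S.restrict μ EP X) φ →
          (∀ t, orbitProj (isotropyK EG G μ) (φ t) = φbar t) →
          ∃ g : EuclideanSpace ℝ (Fin k) → isotropyK EG G μ,
            A.SolvesReconstruction (S.restrict μ EP X) φh g ∧ ∀ t, φ t = g t • φh t) := by
  have hcK : CompleteSpace EGμ := FiniteDimensional.complete ℝ EGμ
  have hcP : CompleteSpace EP := FiniteDimensional.complete ℝ EP
  have hcQ : CompleteSpace EQ := FiniteDimensional.complete ℝ EQ
  have hcB : CompleteSpace EB := FiniteDimensional.complete ℝ EB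
  have hT2 : T2Space (S.Level μ) := hP.isEmbedding.t2Space
  have hT2Q : T2Space (MulAction.orbitRel.Quotient (isotropyK EG G μ) (S.Level μ)) :=
    t2Space_quotient_mulAction_of_properSMul
  have hact := S.contMDiff_level_smul hP hGμ
  have hXs := S.isSmoothVectorField_restrict hP hX hXtan
  have hinv := S.tangentAct_restrict hP hGμ hXtan hXinv
  obtain ⟨φ₀, hφ₀, hφ₀π⟩ :=
    exists_integralSection_lift_of_isFlat hact hπ hXs hinv hφbar hB hflat
  refine ⟨⟨φ₀, hφ₀, hφ₀π⟩, fun A hint => ⟨A.exists_isHorizontalLiftOf hfree hact hπ hXs hinv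
    hφbar hint, fun φh hφh => ?_⟩⟩
  -- a lift of `φ̄` by an integral section of `X_μ` is `g · φₕ` for a solution `g`
  have hrec : ∀ φ : EuclideanSpace ℝ (Fin k) → S.Level μ,
      IsIntegralSection (S.restrict μ EP X) φ →
      (∀ t, orbitProj (isotropyK EG G μ) (φ t) = φbar t) →
      ∃ g : EuclideanSpace ℝ (Fin k) → isotropyK EG G μ,
        A.SolvesReconstruction (S.restrict μ EP X) φh g ∧ ∀ t, φ t = g t • φh t := by
    intro φ hφ hφπ
    obtain ⟨g, hg, hgφ⟩ := exists_contMDiff_smul_eq hfree hact A (contMDiffOn_univ.1 hφh.1.1)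
      (contMDiffOn_univ.1 hφ.1) (fun t => (hφπ t).trans (hφh.2 t).symm)
    obtain rfl : φ = fun t => g t • φh t := funext hgφ
    exact ⟨g, (A.solvesReconstruction_iff hfree hact hπ hinv hφh.1 hg).2 hφ, fun _ => rfl⟩
  refine ⟨?_, fun g hg => ⟨(A.solvesReconstruction_iff hfree hact hπ hinv hφh.1 hg.1).1 hg,
    fun t => (orbitProj_smul _ _).trans (hφh.2 t)⟩, hrec⟩
  obtain ⟨g, hg, -⟩ := hrec φ₀ hφ₀ hφ₀π
  exact ⟨g, hg⟩
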